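/- Let $k$ be a field and let $\pi$ be a proof net of multiplicative linear logic (without units), i.e. a proof structure that is the translation of a sequent calculus proof, with a single conclusion labelled by a formula $A$. Let $U_\pi$ be the set of (unoriented) atoms of $\pi$, that is, of all pairs of an edge of $\pi$ and an occurrence of an atom in the formula labelling it, let $P_\pi = k[U_\pi]$, and let $I_\pi \subseteq P_\pi$ be the ideal generated by the differences $X - X'$, where $X, X'$ are corresponding occurrences of the same atom on two edges incident at an axiom, cut, tensor or par link of $\pi$ (at axiom and cut links, negation reverses the order of the atoms). Write $X \sim X'$ if $X - X'$ or $X' - X$ is one of these generators. Then there are as many positive as negative atoms in $A$. Let $\mathbf U = (U_1,\dots,U_m)$ and $\mathbf V = (V_1,\dots,V_m)$ be the subsequences of positive and of negative atoms in the sequence of atoms of $A$ on the concluding edge, and let $\mathbf W$ be the set of all other elements of $U_\pi$. The natural maps $\beta_+ : k[\mathbf U] \to P_\pi/I_\pi$ and $\beta_- : k[\mathbf V] \to P_\pi/I_\pi$ are isomorphisms, and there is a permutation $\sigma$ of $\{1,\dots,m\}$ with $\beta_-^{-1}\beta_+(U_i) = V_{\sigma(i)}$ for all $i$. Let $I_{\partial\pi}$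 be the kernel of $k[\mathbf U, \mathbf V] \to P_\pi/I_\pi$. Let $<$ be any total order on $U_\pi$ with $V_i < U_j < W$ for all $i, j$ and all $W \in \mathbf W$, and use the lexicographic monomial orders in which larger variables are larger monomials. Let $\mathscr S$ be the graph on $U_\pi$ with an edge $X \to X'$ whenever $X \sim X'$ and $X < X'$. Order edges first by target, then by source. For a graph $\mathscr G$ put $G_{\mathscr G} = \{X' - X \mid X \to X' \text{ an edge of } \mathscr G\}$. A *roof* is a pair $(e,e')$ of edges $e : X \to Z$, $e' : Y \to Z$ with $X < Y$; its *base* is the edge $X \to Y$. Roofs are ordered lexicographically; a roof is *live* if both its edges are. *Falling Roofs.* Start with $\mathscr N = \mathscr S$, all edges live. As long as $\mathscr N$ contains a live roof: take the first one $(e,e')$, mark $e,e'$ as dead, and add its base $d$ to $\mathscr N$ as a live edge unless $d$ is already there; then, as long as $d$ is part of a live roof, take one, of the form $(d,e'')$ if possible and otherwise of the form $(e'',d)$, mark $e''$ as dead, add the base $d'$ of this roof as a live edge unless it is already there, remove $d$ from $\mathscr N$, and replace $d$ by $d'$. Return $\mathscr N$ with its live edges. *Buchberger with Early Stopping.* Start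 with the sequence $G = (f_1,\dots,f_t)$ of the elements of $G_{\mathscr S}$, in the order of the edges, and with $B = \{(i,j) \mid 1 \le i<j\le t\}$. While $B \ne \emptyset$, let $(i,j)$ be its lexicographically first element. If $\operatorname{lcm}(\operatorname{LM} f_i, \operatorname{LM} f_j) \ne \operatorname{LM} f_i \operatorname{LM} f_j$ and there is no $l \notin\{i,j\}$ such that neither of the pairs $\{i,l\}, \{j,l\}$ (in increasing order) is in $B$ and $\operatorname{LM} f_l \mid \operatorname{lcm}(\operatorname{LM} f_i,\operatorname{LM} f_j)$, divide the $S$-polynomial $S(f_i,f_j)$ by $G$ with early stopping: repeatedly cancel the leading term by means of the first element of $G$ whose leading term divides it, and stop as soon as there is none, with what is left as the remainder $S$. If $S \neq 0$, append $f_{t+1} = S/\operatorname{LC}(S)$ to $G$, add the pairs $(l,t+1)$ with $1 \le l\le t$ to $B$, and increase $t$ by one. In every case remove $(i,j)$ from $B$. Return $G$. **Theorem.** For every such order $<$, Falling Roofs terminates on $\mathscr S$; let $\mathscr N$ be its output and $\mathscr N^+$ the subgraph of live edges of $\mathscr N$. Buchberger with Early Stopping terminates on $G_{\mathscr S}$,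 and the set of polynomials in its output is $G_{\mathscr N}$. Moreover $$G_{\mathscr N^+} = \{\, U_i - V_{\sigma(i)} \mid 1 \le i \le m \,\},$$ and this set is a Gröbner basis of $I_{\partial\pi}$ in $k[\mathbf U,\mathbf V]$. -/

import Mathlib

/-! ## Formulas -/

/-- Formulas of multiplicative linear logic over a set `𝕏` of unoriented atoms.  Formulas modulo the
De Morgan equations are represented by their negation normal forms; the sign `true` is `+`. -/
inductive Formula (𝕏 : Type*) : Type _
  | atom (X : 𝕏) (x : Bool) : Formula 𝕏
  | tensor (A B : Formula 𝕏) : Formula 𝕏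
  | par (A B : Formula 𝕏) : Formula 𝕏

namespace Formula

variable {𝕏 : Type*}

/-- Negation. -/
def neg : Formula 𝕏 → Formula 𝕏
  | atom X x => atom X (!x)
  | tensor A B => par B.neg A.neg
  | par A B => tensor B.neg A.neg

theorem neg_neg (A : Formula 𝕏) : A.neg.neg = A := by
  induction A with
  | atom X x => simp [neg]
  | tensor A B hA hB => simp [neg, hA, hB]
  | par A B hA hB => simp [neg, hA, hB]

/-- The sequence of oriented atoms of a formula. -/
def orientedAtoms : Formula 𝕏 → List (𝕏 × Bool)
  | atom X x => [(X, x)]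
  | tensor A B => A.orientedAtoms ++ B.orientedAtoms
  | par A B => A.orientedAtoms ++ B.orientedAtoms

/-- Negation reverses the sequence of oriented atoms and flips all the signs; so the copy in `¬A` of
the `i`-th atom of `A` is the `i`-th atom of `¬A` counted from the right. -/
theorem orientedAtoms_neg (A : Formula 𝕏) :
    A.neg.orientedAtoms = (A.orientedAtoms.map fun p => (p.1, !p.2)).reverse := by
  induction A with
  | atom X x => rfl
  | tensor A B hA hB => simp [neg, orientedAtoms, hA, hB]
  | par A B hA hB => simp [neg, orientedAtoms, hA, hB]

end Formula

/-! ## Proof structures -/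

/-- A vertex of a proof structure with edge set `E`, with its type and its incident edges:
`ax e e'` has conclusions `e, e'`; `cut e e'` has premises `e, e'`; `tensor l r c` and `par l r c`
have left premise `l`, right premise `r` and conclusion `c`; `concl e` has the premise `e`. -/
inductive Link (E : Type) : Type
  | ax (e e' : E) : Link E
  | cut (e e' : E) : Link E
  | tensor (l r c : E) : Link E
  | par (l r c : E) : Link E
  | concl (e : E) : Link E

namespace Link

variable {E E' : Type} {𝕏 : Type*}

/-- The incoming edges. -/
def premises : Link E → List E
  | ax _ _ => []
  | cut e e' => [e, e']
  | tensor l r _ => [l, r]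
  | par l r _ => [l, r]
  | concl e => [e]

/-- The outgoing edges. -/
def conclusions : Link E → List E
  | ax e e' => [e, e']
  | cut _ _ => []
  | tensor _ _ c => [c]
  | par _ _ c => [c]
  | concl _ => []

/-- The labels of the incident edges are as required by the type of the vertex. -/
def WellLabelled (label : E → Formula 𝕏) : Link E → Prop
  | ax e e' => label e' = (label e).neg
  | cut e e' => label e' = (label e).neg
  | tensor l r c => label c = (label l).tensor (label r)
  | par l r c => label c = (label l).par (label r)
  | concl _ => True

/-- Rename the edges. -/
def map (f : E → E') : Link E → Link E'
  | ax e e' => ax (f e) (f e')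
  | cut e e' => cut (f e) (f e')
  | tensor l r c => tensor (f l) (f r) (f c)
  | par l r c => par (f l) (f r) (f c)
  | concl e => concl (f e)

/-- Exchange the two edges at an axiom or cut link (they are not ordered). -/
def swap : Link E → Link E
  | ax e e' => ax e' e
  | cut e e' => cut e' e
  | l => l

theorem premises_map (f : E → E') (l : Link E) : (l.map f).premises = l.premises.map f := by
  cases l <;> rfl

theorem conclusions_map (f : E → E') (l : Link E) :
    (l.map f).conclusions = l.conclusions.map f := by
  cases l <;> rfl

theorem WellLabelled.map {f : E → E'} {label : E → Formula 𝕏} {label' : E' → Formula 𝕏}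
    (h : ∀ e, label' (f e) = label e) {l : Link E} (hl : l.WellLabelled label) :
    (l.map f).WellLabelled label' := by
  cases l <;> simp_all [WellLabelled, Link.map]

end Link

/-- A proof structure: a finite directed multigraph with edges labelled by formulas.  Every edge is
a conclusion of exactly one vertex (its source) and a premise of exactly one vertex (its target). -/
structure ProofStructure (𝕏 : Type*) where
  V : Type
  E : Type
  finite_V : Finite V
  finite_E : Finite E
  label : E → Formula 𝕏
  node : V → Link E
  source : ∀ e, ∃! v, e ∈ (node v).conclusions
  target : ∀ e, ∃! v, e ∈ (node v).premises
  nodup_premises : ∀ v, (node v).premises.Nodup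
  nodup_conclusions : ∀ v, (node v).conclusions.Nodup
  wellLabelled : ∀ v, (node v).WellLabelled label

namespace ProofStructure

variable {𝕏 : Type*}

/-- Isomorphism of proof structures: a renaming of vertices and edges. -/
structure Iso (π ρ : ProofStructure 𝕏) where
  vert : π.V ≃ ρ.V
  edge : π.E ≃ ρ.E
  label_eq : ∀ e, ρ.label (edge e) = π.label e
  node_eq : ∀ v, ρ.node (vert v) = (π.node v).map edge ∨
    ρ.node (vert v) = ((π.node v).map edge).swap

/-- The edge `c` is the only conclusion of `π`. -/
def HasSingleConclusion (π : ProofStructure 𝕏) (c : π.E) : Prop :=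
  ∀ e, (∃ v, π.node v = Link.concl e) ↔ e = c

end ProofStructure

/-! ## Sequent calculus proofs and proof nets -/

/-- Proofs in the one-sided sequent calculus of multiplicative linear logic (without units). -/
inductive SeqProof {𝕏 : Type*} : List (Formula 𝕏) → Type _
  | ax (A : Formula 𝕏) : SeqProof [A.neg, A]
  | exch (Γ : List (Formula 𝕏)) (A B : Formula 𝕏) (Δ : List (Formula 𝕏)) :
      SeqProof (Γ ++ A :: B :: Δ) → SeqProof (Γ ++ B :: A :: Δ)
  | cut (A : Formula 𝕏) (Γ Δ : List (Formula 𝕏)) :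
      SeqProof (A :: Γ) → SeqProof (A.neg :: Δ) → SeqProof (Γ ++ Δ)
  | tensor (A B : Formula 𝕏) (Γ Δ : List (Formula 𝕏)) :
      SeqProof (A :: Γ) → SeqProof (B :: Δ) → SeqProof (A.tensor B :: (Γ ++ Δ))
  | par (A B : Formula 𝕏) (Γ : List (Formula 𝕏)) :
      SeqProof (A :: B :: Γ) → SeqProof (A.par B :: Γ)

/-- Sequences of edges labelled by the formulas of a given sequence. -/
def EdgeSeq {𝕏 : Type*} {E : Type} (label : E → Formula 𝕏) : List (Formula 𝕏) → Type
  | [] => Unit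
  | A :: Γ => {e : E // label e = A} × EdgeSeq label Γ

namespace EdgeSeq

variable {𝕏 : Type*} {E E' : Type} {label : E → Formula 𝕏} {label' : E' → Formula 𝕏}

def cons {A : Formula 𝕏} {Γ : List (Formula 𝕏)} (e : E) (he : label e = A)
    (s : EdgeSeq label Γ) : EdgeSeq label (A :: Γ) := (⟨e, he⟩, s)

def head {A : Formula 𝕏} {Γ : List (Formula 𝕏)} (s : EdgeSeq label (A :: Γ)) : E := s.1.1

theorem label_head {A : Formula 𝕏} {Γ : List (Formula 𝕏)} (s : EdgeSeq label (A :: Γ)) :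
    label s.head = A := s.1.2

def tail {A : Formula 𝕏} {Γ : List (Formula 𝕏)} (s : EdgeSeq label (A :: Γ)) :
    EdgeSeq label Γ := s.2

def toList : (Γ : List (Formula 𝕏)) → EdgeSeq label Γ → List E
  | [], _ => []
  | _ :: Γ, s => s.1.1 :: toList Γ s.2

def map (f : E → E') (h : ∀ e, label' (f e) = label e) :
    (Γ : List (Formula 𝕏)) → EdgeSeq label Γ → EdgeSeq label' Γ
  | [], _ => ()
  | _ :: Γ, s => (⟨f s.1.1, (h s.1.1).trans s.1.2⟩, map f h Γ s.2)

def append : (Γ Δ : List (Formula 𝕏)) →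
    EdgeSeq label Γ → EdgeSeq label Δ → EdgeSeq label (Γ ++ Δ)
  | [], _, _, t => t
  | _ :: Γ, Δ, s, t => (s.1, append Γ Δ s.2 t)

def exch (A B : Formula 𝕏) (Δ : List (Formula 𝕏)) : (Γ : List (Formula 𝕏)) →
    EdgeSeq label (Γ ++ A :: B :: Δ) → EdgeSeq label (Γ ++ B :: A :: Δ)
  | [], s => (s.2.1, s.1, s.2.2)
  | _ :: Γ, s => (s.1, exch A B Δ Γ s.2)

theorem toList_map (f : E → E') (h : ∀ e, label' (f e) = label e) :
    ∀ (Γ : List (Formula 𝕏)) (s : EdgeSeq label Γ),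
      toList Γ (map f h Γ s) = (toList Γ s).map f
  | [], _ => rfl
  | _ :: Γ, s => by simp [toList, map, toList_map f h Γ s.2]

theorem toList_append :
    ∀ (Γ Δ : List (Formula 𝕏)) (s : EdgeSeq label Γ) (t : EdgeSeq label Δ),
      toList (Γ ++ Δ) (append Γ Δ s t) = toList Γ s ++ toList Δ t
  | [], _, _, _ => rfl
  | _ :: Γ, Δ, s, t => by
      simpa [toList, append] using toList_append Γ Δ s.2 t

theorem toList_exch (A B : Formula 𝕏) (Δ : List (Formula 𝕏)) :
    ∀ (Γ : List (Formula 𝕏)) (s : EdgeSeq label (Γ ++ A :: B :: Δ)),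
      (toList _ (exch A B Δ Γ s)).Perm (toList _ s)
  | [], _ => List.Perm.swap _ _ _
  | _ :: Γ, s => List.Perm.cons _ (toList_exch A B Δ Γ s.2)

end EdgeSeq

/-- A proof structure without its vertices of type `c`; instead, the sequence of its conclusions is
recorded.  (The conditions on a proof structure are stated in `IsLawful`.) -/
structure OpenNet {𝕏 : Type*} (Γ : List (Formula 𝕏)) where
  V : Type
  E : Type
  label : E → Formula 𝕏
  node : V → Link E
  concl : EdgeSeq label Γ

namespace OpenNet

variable {𝕏 : Type*} {Γ Δ : List (Formula 𝕏)}

/-- The list of conclusions. -/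
def conclList (N : OpenNet Γ) : List N.E := EdgeSeq.toList Γ N.concl

/-- A single axiom link. -/
def ax (A : Formula 𝕏) : OpenNet [A.neg, A] where
  V := Unit
  E := Bool
  label := fun b => if b then A else A.neg
  node := fun _ => Link.ax true false
  concl := EdgeSeq.cons false rfl (EdgeSeq.cons true rfl ())

/-- Reorder the conclusions. -/
def exch (Γ : List (Formula 𝕏)) (A B : Formula 𝕏) (Δ : List (Formula 𝕏))
    (N : OpenNet (Γ ++ A :: B :: Δ)) : OpenNet (Γ ++ B :: A :: Δ) where
  V := N.V
  E := N.E
  label := N.label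
  node := N.node
  concl := EdgeSeq.exch A B Δ Γ N.concl

/-- The vertices of two disjoint nets. -/
def bothNodes {Γ Δ : List (Formula 𝕏)} (N : OpenNet Γ) (M : OpenNet Δ) :
    N.V ⊕ M.V → Link (N.E ⊕ M.E) :=
  Sum.elim (fun v => (N.node v).map Sum.inl) (fun v => (M.node v).map Sum.inr)

/-- Place two nets next to each other and join their first conclusions by a cut link. -/
def cut (A : Formula 𝕏) (Γ Δ : List (Formula 𝕏)) (N : OpenNet (A :: Γ))
    (M : OpenNet (A.neg :: Δ)) : OpenNet (Γ ++ Δ) where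
  V := (N.V ⊕ M.V) ⊕ Unit
  E := N.E ⊕ M.E
  label := Sum.elim N.label M.label
  node := Sum.elim (bothNodes N M)
    (fun _ => Link.cut (Sum.inl N.concl.head) (Sum.inr M.concl.head))
  concl := EdgeSeq.append Γ Δ
    (EdgeSeq.map Sum.inl (fun _ => rfl) Γ N.concl.tail)
    (EdgeSeq.map Sum.inr (fun _ => rfl) Δ M.concl.tail)

/-- Place two nets next to each other and join their first conclusions by a tensor link, with a new
edge `Sum.inr ()` as its conclusion. -/
def tensor (A B : Formula 𝕏) (Γ Δ : List (Formula 𝕏)) (N : OpenNet (A :: Γ))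
    (M : OpenNet (B :: Δ)) : OpenNet (A.tensor B :: (Γ ++ Δ)) where
  V := (N.V ⊕ M.V) ⊕ Unit
  E := (N.E ⊕ M.E) ⊕ Unit
  label := Sum.elim (Sum.elim N.label M.label) (fun _ => A.tensor B)
  node := Sum.elim (fun v => (bothNodes N M v).map Sum.inl)
    (fun _ => Link.tensor (Sum.inl (Sum.inl N.concl.head)) (Sum.inl (Sum.inr M.concl.head))
      (Sum.inr ()))
  concl := EdgeSeq.cons (Sum.inr ()) rfl (EdgeSeq.map Sum.inl (fun _ => rfl) (Γ ++ Δ)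
    (EdgeSeq.append Γ Δ
      (EdgeSeq.map (label' := Sum.elim N.label M.label) Sum.inl (fun _ => rfl) Γ N.concl.tail)
      (EdgeSeq.map Sum.inr (fun _ => rfl) Δ M.concl.tail)))

/-- Join the first two conclusions by a par link, with a new edge `Sum.inr ()` as its conclusion. -/
def par (A B : Formula 𝕏) (Γ : List (Formula 𝕏)) (N : OpenNet (A :: B :: Γ)) :
    OpenNet (A.par B :: Γ) where
  V := N.V ⊕ Unit
  E := N.E ⊕ Unit
  label := Sum.elim N.label (fun _ => A.par B)
  node := Sum.elim (fun v => (N.node v).map Sum.inl)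
    (fun _ => Link.par (Sum.inl N.concl.head) (Sum.inl N.concl.tail.head) (Sum.inr ()))
  concl := EdgeSeq.cons (Sum.inr ()) rfl (EdgeSeq.map Sum.inl (fun _ => rfl) Γ N.concl.tail.tail)

end OpenNet

/-- The translation of a sequent calculus proof, without the vertices of type `c`. -/
def SeqProof.toOpenNet {𝕏 : Type*} : {Γ : List (Formula 𝕏)} → SeqProof Γ → OpenNet Γ
  | _, .ax A => .ax A
  | _, .exch Γ A B Δ p => .exch Γ A B Δ p.toOpenNet
  | _, .cut A Γ Δ p q => .cut A Γ Δ p.toOpenNet q.toOpenNet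
  | _, .tensor A B Γ Δ p q => .tensor A B Γ Δ p.toOpenNet q.toOpenNet
  | _, .par A B Γ p => .par A B Γ p.toOpenNet

/-- The conditions on a proof structure, for vertices `V` not of type `c` and for the edges `c` at
which such vertices remain to be added. -/
structure IsLawful {𝕏 : Type*} {V E : Type} (label : E → Formula 𝕏) (node : V → Link E)
    (c : List E) : Prop where
  finite_V : Finite V
  finite_E : Finite E
  source : ∀ e, ∃! v, e ∈ (node v).conclusions
  target : ∀ e, e ∉ c → ∃! v, e ∈ (node v).premises
  no_target : ∀ e ∈ c, ∀ v, e ∉ (node v).premises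
  nodup : c.Nodup
  nodup_premises : ∀ v, (node v).premises.Nodup
  nodup_conclusions : ∀ v, (node v).conclusions.Nodup
  wellLabelled : ∀ v, (node v).WellLabelled label

namespace IsLawful

variable {𝕏 : Type*} {V V' E E' : Type} {label : E → Formula 𝕏} {node : V → Link E}
  {label' : E' → Formula 𝕏} {node' : V' → Link E'} {a b : E} {c d : List E} {c' : List E'}

theorem perm (h : IsLawful label node c) (hp : c.Perm d) : IsLawful label node d where
  finite_V := h.finite_V
  finite_E := h.finite_E
  source := h.source
  target := fun e he => h.target e (fun h' => he (hp.mem_iff.1 h'))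
  no_target := fun e he => h.no_target e (hp.mem_iff.2 he)
  nodup := hp.nodup_iff.1 h.nodup
  nodup_premises := h.nodup_premises
  nodup_conclusions := h.nodup_conclusions
  wellLabelled := h.wellLabelled

theorem ax (A : Formula 𝕏) : IsLawful (fun b => if b then A else A.neg)
    (fun _ : Unit => Link.ax true false) [false, true] where
  finite_V := inferInstance
  finite_E := inferInstance
  source := fun e => ⟨(), by cases e <;> simp [Link.conclusions], fun _ _ => rfl⟩
  target := fun e he => by cases e <;> simp at he
  no_target := fun e _ v => by simp [Link.premises]
  nodup := by simp
  nodup_premises := fun v => by simp [Link.premises]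
  nodup_conclusions := fun v => by simp [Link.conclusions]
  wellLabelled := fun v => by simp [Link.WellLabelled]

theorem sum (h : IsLawful label node c) (h' : IsLawful label' node' c') :
    IsLawful (Sum.elim label label')
      (Sum.elim (fun v => (node v).map Sum.inl) (fun v => (node' v).map Sum.inr) :
        V ⊕ V' → Link (E ⊕ E'))
      (c.map Sum.inl ++ c'.map Sum.inr) where
  finite_V := by have := h.finite_V; have := h'.finite_V; infer_instance
  finite_E := by have := h.finite_E; have := h'.finite_E; infer_instance
  source := by
    rintro (e | e)
    · obtain ⟨v, hv, hu⟩ := h.source e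
      refine ⟨Sum.inl v, by simpa [Link.conclusions_map] using hv, ?_⟩
      rintro (w | w) hw
      · rw [hu w (by simpa [Link.conclusions_map] using hw)]
      · simp [Link.conclusions_map] at hw
    · obtain ⟨v, hv, hu⟩ := h'.source e
      refine ⟨Sum.inr v, by simpa [Link.conclusions_map] using hv, ?_⟩
      rintro (w | w) hw
      · simp [Link.conclusions_map] at hw
      · rw [hu w (by simpa [Link.conclusions_map] using hw)]
  target := by
    rintro (e | e) he
    · obtain ⟨v, hv, hu⟩ := h.target e (by simpa using he)
      refine ⟨Sum.inl v, by simpa [Link.premises_map] using hv, ?_⟩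
      rintro (w | w) hw
      · rw [hu w (by simpa [Link.premises_map] using hw)]
      · simp [Link.premises_map] at hw
    · obtain ⟨v, hv, hu⟩ := h'.target e (by simpa using he)
      refine ⟨Sum.inr v, by simpa [Link.premises_map] using hv, ?_⟩
      rintro (w | w) hw
      · simp [Link.premises_map] at hw
      · rw [hu w (by simpa [Link.premises_map] using hw)]
  no_target := by
    rintro (e | e) he (v | v)
    · simpa [Link.premises_map] using h.no_target e (by simpa using he) v
    · simp [Link.premises_map]
    · simp [Link.premises_map]
    · simpa [Link.premises_map] using h'.no_target e (by simpa using he) v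
  nodup := List.nodup_append'.2 ⟨h.nodup.map Sum.inl_injective, h'.nodup.map Sum.inr_injective,
    by simp [List.disjoint_left]⟩
  nodup_premises := by
    rintro (v | v)
    · simpa [Link.premises_map] using (h.nodup_premises v).map Sum.inl_injective
    · simpa [Link.premises_map] using (h'.nodup_premises v).map Sum.inr_injective
  nodup_conclusions := by
    rintro (v | v)
    · simpa [Link.conclusions_map] using (h.nodup_conclusions v).map Sum.inl_injective
    · simpa [Link.conclusions_map] using (h'.nodup_conclusions v).map Sum.inr_injective
  wellLabelled := by
    rintro (v | v)
    · exact Link.WellLabelled.map (fun _ => rfl) (h.wellLabelled v)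
    · exact Link.WellLabelled.map (fun _ => rfl) (h'.wellLabelled v)

theorem addCut (h : IsLawful label node (a :: b :: c)) (hab : label b = (label a).neg) :
    IsLawful label (Sum.elim node (fun _ : Unit => Link.cut a b)) c where
  finite_V := by have := h.finite_V; infer_instance
  finite_E := h.finite_E
  source := by
    intro e
    obtain ⟨v, hv, hu⟩ := h.source e
    refine ⟨Sum.inl v, hv, ?_⟩
    rintro (w | w) hw
    · rw [hu w hw]
    · simp [Link.conclusions] at hw
  target := by
    intro e he
    by_cases hab : e = a ∨ e = b
    · refine ⟨Sum.inr (), by simpa [Link.premises] using hab, ?_⟩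
      rintro (v | ⟨⟩) hv
      · exact absurd hv (h.no_target e (by simp; tauto) v)
      · rfl
    · obtain ⟨v, hv, hu⟩ := h.target e (by simp; tauto)
      refine ⟨Sum.inl v, hv, ?_⟩
      rintro (w | w) hw
      · rw [hu w hw]
      · exact absurd (by simpa [Link.premises] using hw) hab
  no_target := by
    have hn := h.nodup
    simp only [List.nodup_cons, List.mem_cons, not_or] at hn
    rintro e he (v | v) hv
    · exact h.no_target e (by simp [he]) v hv
    · simp only [Sum.elim_inr, Link.premises, List.mem_cons, List.not_mem_nil, or_false] at hv
      rcases hv with rfl | rfl <;> tauto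
  nodup := (List.nodup_cons.1 (List.nodup_cons.1 h.nodup).2).2
  nodup_premises := by
    have hn := h.nodup
    simp only [List.nodup_cons, List.mem_cons, not_or] at hn
    rintro (v | v)
    · exact h.nodup_premises v
    · simpa [Link.premises] using hn.1.1
  nodup_conclusions := by
    rintro (v | v)
    · exact h.nodup_conclusions v
    · simp [Link.conclusions]
  wellLabelled := by
    rintro (v | v)
    · exact h.wellLabelled v
    · exact hab

theorem addBinary (h : IsLawful label node (a :: b :: c)) (C : Formula 𝕏)
    (l : Link (E ⊕ Unit)) (hp : l.premises = [Sum.inl a, Sum.inl b])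
    (hc : l.conclusions = [Sum.inr ()]) (hl : l.WellLabelled (Sum.elim label fun _ => C)) :
    IsLawful (Sum.elim label fun _ => C)
      (Sum.elim (fun v => (node v).map Sum.inl) (fun _ : Unit => l))
      (Sum.inr () :: c.map Sum.inl) where
  finite_V := by have := h.finite_V; infer_instance
  finite_E := by have := h.finite_E; infer_instance
  source := by
    rintro (e | e)
    · obtain ⟨v, hv, hu⟩ := h.source e
      refine ⟨Sum.inl v, by simpa [Link.conclusions_map] using hv, ?_⟩
      rintro (w | w) hw
      · rw [hu w (by simpa [Link.conclusions_map] using hw)]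
      · simp [hc] at hw
    · refine ⟨Sum.inr (), by simp [hc], ?_⟩
      rintro (w | w) hw
      · simp [Link.conclusions_map] at hw
      · rfl
  target := by
    rintro (e | e) he
    · by_cases hab : e = a ∨ e = b
      · refine ⟨Sum.inr (), by simpa [hp] using hab, ?_⟩
        rintro (v | ⟨⟩) hv
        · exact absurd (by simpa [Link.premises_map] using hv)
            (h.no_target e (by simp; tauto) v)
        · rfl
      · obtain ⟨v, hv, hu⟩ := h.target e (by simp at he; simp; tauto)
        refine ⟨Sum.inl v, by simpa [Link.premises_map] using hv, ?_⟩
        rintro (w | w) hw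
        · rw [hu w (by simpa [Link.premises_map] using hw)]
        · exact absurd (by simpa [hp] using hw) hab
    · simp at he
  no_target := by
    have hn := h.nodup
    simp only [List.nodup_cons, List.mem_cons, not_or] at hn
    rintro (e | e) he (v | v) hv
    · exact h.no_target e (by simp at he; simp [he]) v (by simpa [Link.premises_map] using hv)
    · have he' : e ∈ c := by simpa using he
      have hv' : e = a ∨ e = b := by simpa [hp] using hv
      rcases hv' with rfl | rfl <;> tauto
    · simp [Link.premises_map] at hv
    · simp [hp] at hv
  nodup := by
    have := (List.nodup_cons.1 (List.nodup_cons.1 h.nodup).2).2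
    simpa using this.map Sum.inl_injective
  nodup_premises := by
    have hn := h.nodup
    simp only [List.nodup_cons, List.mem_cons, not_or] at hn
    rintro (v | v)
    · simpa [Link.premises_map] using (h.nodup_premises v).map Sum.inl_injective
    · simpa [hp] using hn.1.1
  nodup_conclusions := by
    rintro (v | v)
    · simpa [Link.conclusions_map] using (h.nodup_conclusions v).map Sum.inl_injective
    · simp [hc]
  wellLabelled := by
    rintro (v | v)
    · exact Link.WellLabelled.map (fun _ => rfl) (h.wellLabelled v)
    · exact hl

end IsLawful

theorem SeqProof.isLawful {𝕏 : Type*} : ∀ {Γ : List (Formula 𝕏)} (p : SeqProof Γ),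
    IsLawful p.toOpenNet.label p.toOpenNet.node p.toOpenNet.conclList
  | _, .ax A => IsLawful.ax A
  | _, .exch Γ A B Δ p => p.isLawful.perm (EdgeSeq.toList_exch A B Δ Γ _).symm
  | _, .par A B Γ p =>
      (p.isLawful.addBinary (A.par B)
        (Link.par (Sum.inl p.toOpenNet.concl.head) (Sum.inl p.toOpenNet.concl.tail.head)
          (Sum.inr ())) rfl rfl
        (by simp [Link.WellLabelled, EdgeSeq.label_head])).perm
      (List.Perm.cons _ (List.Perm.of_eq (EdgeSeq.toList_map _ _ _ _).symm))
  | _, .cut A Γ Δ p q =>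
      (((p.isLawful.sum q.isLawful).perm (List.Perm.cons _ List.perm_middle)).addCut
        ((EdgeSeq.label_head q.toOpenNet.concl).trans
          (congrArg Formula.neg (EdgeSeq.label_head p.toOpenNet.concl).symm))).perm
      (List.Perm.of_eq ((EdgeSeq.toList_append _ _ _ _).trans
        (congrArg₂ _ (EdgeSeq.toList_map _ _ _ _) (EdgeSeq.toList_map _ _ _ _))).symm)
  | _, .tensor A B Γ Δ p q =>
      (((p.isLawful.sum q.isLawful).perm (List.Perm.cons _ List.perm_middle)).addBinary
        (A.tensor B) (Link.tensor (Sum.inl (Sum.inl p.toOpenNet.concl.head))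
          (Sum.inl (Sum.inr q.toOpenNet.concl.head)) (Sum.inr ())) rfl rfl
        (by simp [Link.WellLabelled, EdgeSeq.label_head])).perm
      (List.Perm.cons _ (List.Perm.of_eq ((EdgeSeq.toList_map _ _ _ _).trans
        (congrArg _ ((EdgeSeq.toList_append _ _ _ _).trans
          (congrArg₂ _ (EdgeSeq.toList_map _ _ _ _) (EdgeSeq.toList_map _ _ _ _))))).symm))

/-- The translation of a sequent calculus proof to a proof structure. -/
def SeqProof.translate {𝕏 : Type*} {Γ : List (Formula 𝕏)} (p : SeqProof Γ) :
    ProofStructure 𝕏 where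
  V := p.toOpenNet.V ⊕ {e : p.toOpenNet.E // e ∈ p.toOpenNet.conclList}
  E := p.toOpenNet.E
  finite_V := by have := p.isLawful.finite_V; have := p.isLawful.finite_E; infer_instance
  finite_E := p.isLawful.finite_E
  label := p.toOpenNet.label
  node := Sum.elim p.toOpenNet.node (fun e => Link.concl e.1)
  source := by
    intro e
    obtain ⟨v, hv, hu⟩ := p.isLawful.source e
    refine ⟨Sum.inl v, hv, ?_⟩
    rintro (w | w) hw
    · rw [hu w hw]
    · simp [Link.conclusions] at hw
  target := by
    intro e
    by_cases he : e ∈ p.toOpenNet.conclList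
    · refine ⟨Sum.inr ⟨e, he⟩, by simp [Link.premises], ?_⟩
      rintro (w | w) hw
      · exact absurd hw (p.isLawful.no_target e he w)
      · simp only [Sum.elim_inr, Link.premises, List.mem_singleton] at hw
        subst hw
        rfl
    · obtain ⟨v, hv, hu⟩ := p.isLawful.target e he
      refine ⟨Sum.inl v, hv, ?_⟩
      rintro (w | w) hw
      · rw [hu w hw]
      · simp only [Sum.elim_inr, Link.premises, List.mem_singleton] at hw
        exact absurd (hw ▸ w.2) he
  nodup_premises := by
    rintro (v | v)
    · exact p.isLawful.nodup_premises v
    · simp [Link.premises]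
  nodup_conclusions := by
    rintro (v | v)
    · exact p.isLawful.nodup_conclusions v
    · simp [Link.conclusions]
  wellLabelled := by
    rintro (v | v)
    · exact p.isLawful.wellLabelled v
    · trivial

/-- A proof net is a proof structure which is, up to renaming of vertices and edges, the translation
of a sequent calculus proof. -/
def ProofStructure.IsProofNet {𝕏 : Type*} (π : ProofStructure 𝕏) : Prop :=
  ∃ (Γ : List (Formula 𝕏)) (p : SeqProof Γ), Nonempty (p.translate.Iso π)

/-! ## The polynomial ring and the ideal of a proof structure -/

namespace ProofStructure

variable {𝕏 : Type*}

/-- The unoriented atoms of `π`: pairs of an edge and a position in the sequence of oriented atoms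
of its label. -/
@[ext]
structure Atom (π : ProofStructure 𝕏) where
  edge : π.E
  idx : Fin (π.label edge).orientedAtoms.length

/-- The sign of an atom. -/
def Atom.sign {π : ProofStructure 𝕏} (x : π.Atom) : Bool :=
  ((π.label x.edge).orientedAtoms.get x.idx).2

instance (π : ProofStructure 𝕏) : Finite π.Atom := by
  have := π.finite_E
  exact Finite.of_injective
    (fun x : π.Atom => (⟨x.edge, x.idx⟩ : Σ e, Fin (π.label e).orientedAtoms.length))
    (fun x y h => by cases x; cases y; simpa using h)

/-- The difference `x - y` is one of the generators of the ideal of the vertex `v`.  At an axiom or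
cut link the positions of `x` and `y` are opposite, because negation reverses the sequence of
atoms. -/
def IsLinkPair (π : ProofStructure 𝕏) (v : π.V) (x y : π.Atom) : Prop :=
  match π.node v with
  | .ax e e' => x.edge = e ∧ y.edge = e' ∧
      x.idx.val + y.idx.val + 1 = (π.label e).orientedAtoms.length
  | .cut e e' => x.edge = e ∧ y.edge = e' ∧
      x.idx.val + y.idx.val + 1 = (π.label e).orientedAtoms.length
  | .tensor l r c => y.edge = c ∧ ((x.edge = l ∧ y.idx.val = x.idx.val) ∨
      (x.edge = r ∧ y.idx.val = (π.label l).orientedAtoms.length + x.idx.val))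
  | .par l r c => y.edge = c ∧ ((x.edge = l ∧ y.idx.val = x.idx.val) ∨
      (x.edge = r ∧ y.idx.val = (π.label l).orientedAtoms.length + x.idx.val))
  | .concl _ => False

/-- The relation `x ∼ y`: one of `x - y`, `y - x` is one of the generators of the ideal of `π`. -/
def Sim (π : ProofStructure 𝕏) (x y : π.Atom) : Prop :=
  ∃ v, π.IsLinkPair v x y ∨ π.IsLinkPair v y x

/-- The generating set `G_π` in the polynomial ring `P_π` on the atoms of `π`. -/
def generators (k : Type*) [Field k] (π : ProofStructure 𝕏) : Set (MvPolynomial π.Atom k) :=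
  {f | ∃ v x y, π.IsLinkPair v x y ∧ f = MvPolynomial.X x - MvPolynomial.X y}

/-- The defining ideal `I_π`. -/
noncomputable def ideal (k : Type*) [Field k] (π : ProofStructure 𝕏) : Ideal (MvPolynomial π.Atom k) :=
  Ideal.span (π.generators k)

/-- The coordinate ring `P_π / I_π`. -/
abbrev CoordRing (k : Type*) [Field k] (π : ProofStructure 𝕏) : Type _ :=
  MvPolynomial π.Atom k ⧸ π.ideal k

/-- The map `k[x_i] → P_π → P_π / I_π` given by a family `x` of atoms. -/
noncomputable def toCoordRing (k : Type*) [Field k] (π : ProofStructure 𝕏) {ι : Type*}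
    (x : ι → π.Atom) : MvPolynomial ι k →ₐ[k] π.CoordRing k :=
  (Ideal.Quotient.mkₐ k (π.ideal k)).comp (MvPolynomial.rename x)

/-- The atoms on the edge `c`. -/
abbrev Boundary (π : ProofStructure 𝕏) (c : π.E) : Type := {x : π.Atom // x.edge = c}

/-- The boundary ideal: the kernel of `k[U, V] → P_π / I_π`, where `U` and `V` together are the atoms
on the edge `c`. -/
noncomputable def boundaryIdeal (k : Type*) [Field k] (π : ProofStructure 𝕏) (c : π.E) :
    Ideal (MvPolynomial (π.Boundary c) k) :=
  RingHom.ker (π.toCoordRing k (fun x : π.Boundary c => x.1))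

/-- `U_1, …, U_m` is the subsequence, in the sequence of atoms on the edge `c`, of those atoms that
have the sign `s`. -/
def IsSubseqOfSign (π : ProofStructure 𝕏) (c : π.E) {m : ℕ} (U : Fin m → π.Boundary c)
    (s : Bool) : Prop :=
  StrictMono (fun i => (U i).1.idx.val) ∧ ∀ x : π.Boundary c, x ∈ Set.range U ↔ x.1.sign = s

end ProofStructure

/-! ## Lexicographic orders and Gröbner bases -/

section Groebner

open MvPolynomial

/-- The lexicographic monomial order in which a larger variable is a larger monomial.  (In Mathlib's
`MonomialOrder.lex` the smallest variable is the largest monomial, hence the dual order.) -/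
noncomputable def lexOrder (σ : Type*) [LinearOrder σ] [Finite σ] : MonomialOrder σ :=
  @MonomialOrder.lex σ (inferInstanceAs (LinearOrder σᵒᵈ)) (inferInstanceAs (WellFoundedGT σᵒᵈ))

variable {σ k : Type*} [Field k]

/-- `G` is a Gröbner basis of the ideal `I`. -/
def IsGroebnerBasis (M : MonomialOrder σ) (G : Set (MvPolynomial σ k))
    (I : Ideal (MvPolynomial σ k)) : Prop :=
  G.Finite ∧ G ⊆ I ∧
    Ideal.span (M.leadingTerm '' G) = Ideal.span (M.leadingTerm '' (I : Set (MvPolynomial σ k)))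

/-- `LT f` divides `LT p`, for `p ≠ 0`. -/
def LTDvd (M : MonomialOrder σ) (f p : MvPolynomial σ k) : Prop :=
  f ≠ 0 ∧ M.degree f ≤ M.degree p

/-- `p - (LT p / LT f) f`. -/
noncomputable def cancelLT (M : MonomialOrder σ) (p f : MvPolynomial σ k) : MvPolynomial σ k :=
  p - monomial (M.degree p - M.degree f) (M.leadingCoeff p / M.leadingCoeff f) * f

theorem cancelLT_lt (M : MonomialOrder σ) {p f : MvPolynomial σ k} (hp : p ≠ 0)
    (h : LTDvd M f p) :
    M.toWithBotSyn (M.withBotDegree (cancelLT M p f)) < M.toWithBotSyn (M.withBotDegree p) := by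
  have hu : IsUnit (M.leadingCoeff f) := (M.leadingCoeff_ne_zero_iff.2 h.1).isUnit
  have he : cancelLT M p f = M.reduce hu p := by
    have hi : ((hu.unit⁻¹ : kˣ) : k) = (M.leadingCoeff f)⁻¹ := by
      rw [Units.val_inv_eq_inv_val, IsUnit.unit_spec]
    simp only [cancelLT, MonomialOrder.reduce]
    rw [div_eq_inv_mul, hi]
  rw [MonomialOrder.withBotDegree_lt_withBotDegree_iff]
  by_cases hd : M.degree p = 0
  · right
    refine ⟨?_, hp⟩
    have hf : M.degree f = 0 := le_antisymm (hd ▸ h.2) bot_le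
    have hlf := M.leadingCoeff_ne_zero_iff.2 h.1
    have hpC := M.eq_C_of_degree_eq_zero hd
    have hfC := M.eq_C_of_degree_eq_zero hf
    unfold cancelLT
    rw [hd, hf, tsub_zero, ← C_apply]
    conv_lhs => rw [hpC]; rhs; rhs; rw [hfC]
    rw [← hpC, ← C_mul, div_mul_cancel₀ _ hlf, ← hpC, sub_self]
  · left
    rw [he]
    exact MonomialOrder.degree_reduce_lt hu h.2 hd

open Classical in
/-- The remainder of the Euclidean division with early stopping of `p` by the sequence `G`: as long
as the leading term of `p` is divisible by the leading term of some element of `G`, the first such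
element is used to cancel it; the remainder is what is left as soon as no such element exists. -/
noncomputable def divES (M : MonomialOrder σ) (G : List (MvPolynomial σ k))
    (p : MvPolynomial σ k) : MvPolynomial σ k :=
  if hp : p = 0 then 0
  else
    match h : G.find? (fun f => decide (LTDvd M f p)) with
    | none => p
    | some f => divES M G (cancelLT M p f)
termination_by WellFounded.wrap (wellFounded_lt (α := WithBot M.syn))
  (M.toWithBotSyn (M.withBotDegree p))
decreasing_by
  exact cancelLT_lt M hp (by simpa using List.find?_some h)

/-- The `S`-polynomial. -/
noncomputable def sPoly (M : MonomialOrder σ) (g h : MvPolynomial σ k) : MvPolynomial σ k :=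
  monomial (M.degree g ⊔ M.degree h - M.degree g) (M.leadingCoeff g)⁻¹ * g -
    monomial (M.degree g ⊔ M.degree h - M.degree h) (M.leadingCoeff h)⁻¹ * h

/-- A state of Buchberger's algorithm: the sequence `G = (f_0, f_1, …)` of polynomials and the set
`B` of pairs of indices, ordered lexicographically. -/
structure BuchbergerState (σ k : Type*) [Field k] where
  G : List (MvPolynomial σ k)
  B : Finset (ℕ ×ₗ ℕ)

/-- The unordered pair `[i, j]`, as an ordered pair `(i', j')` with `i' ≤ j'`. -/
def sortedPair (i j : ℕ) : ℕ ×ₗ ℕ := toLex (min i j, max i j)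

namespace BuchbergerState

/-- The initial state, on input `F`. -/
noncomputable def init (F : List (MvPolynomial σ k)) : BuchbergerState σ k where
  G := F
  B := ((Finset.range F.length ×ˢ Finset.range F.length).filter fun p => p.1 < p.2).map
    toLex.toEmbedding

/-- The polynomial `f_i`. -/
noncomputable def poly (s : BuchbergerState σ k) (i : ℕ) : MvPolynomial σ k := s.G.getD i 0

/-- The criterion by which pairs are discarded. -/
def Criterion (M : MonomialOrder σ) (s : BuchbergerState σ k) (i j : ℕ) : Prop :=
  ∃ l < s.G.length, l ≠ i ∧ l ≠ j ∧ sortedPair i l ∉ s.B ∧ sortedPair j l ∉ s.B ∧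
    M.degree (s.poly l) ≤ M.degree (s.poly i) ⊔ M.degree (s.poly j)

open Classical in
/-- One pass through the loop of Buchberger's algorithm with early stopping; the algorithm stops
when `B` is empty. -/
noncomputable def step (M : MonomialOrder σ) (s : BuchbergerState σ k) :
    Option (BuchbergerState σ k) :=
  if hB : s.B.Nonempty then
    let i := (ofLex (s.B.min' hB)).1
    let j := (ofLex (s.B.min' hB)).2
    let S := divES M s.G (sPoly M (s.poly i) (s.poly j))
    if M.degree (s.poly i) ⊔ M.degree (s.poly j) ≠ M.degree (s.poly i) + M.degree (s.poly j) ∧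
        ¬ s.Criterion M i j ∧ S ≠ 0 then
      some
        { G := s.G ++ [(M.leadingCoeff S)⁻¹ • S]
          B := (s.B ∪ (Finset.range s.G.length).image fun l => toLex (l, s.G.length)).erase
            (toLex (i, j)) }
    else some { s with B := s.B.erase (toLex (i, j)) }
  else none

end BuchbergerState

end Groebner

/-! ## Graphs and the Falling Roofs algorithm -/

/-- An edge of a graph whose vertices are variables, encoded as the pair of its target and its
source.  Edges are ordered lexicographically: first by target, then by source. -/
abbrev Edge (α : Type*) : Type _ := α ×ₗ α

namespace Edge

variable {α : Type*}

/-- The edge from `x` to `y`. -/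
def mk (x y : α) : Edge α := toLex (y, x)

def src (e : Edge α) : α := (ofLex e).2

def tgt (e : Edge α) : α := (ofLex e).1

/-- The polynomial `Y - X` of an edge `X ⟶ Y`. -/
noncomputable def poly (k : Type*) [Field k] (e : Edge α) : MvPolynomial α k :=
  MvPolynomial.X e.tgt - MvPolynomial.X e.src

/-- The pair `(e, e')` is a roof. -/
def IsRoof [LT α] (e e' : Edge α) : Prop := e.tgt = e'.tgt ∧ e.src < e'.src

end Edge

/-- A state of the Falling Roofs algorithm: the graph `N` with its live edges and, inside the inner
loop, the edge `d`. -/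
@[ext]
structure RoofState (α : Type*) where
  edges : Finset (Edge α)
  live : Finset (Edge α)
  cur : Option (Edge α)

namespace RoofState

variable {α : Type*} [LinearOrder α]

/-- The initial state, on the graph `S`: all edges are live. -/
def init (S : Finset (Edge α)) : RoofState α := ⟨S, S, none⟩

/-- Mark `e` as dead. -/
def kill (N : RoofState α) (e : Edge α) : RoofState α := { N with live := N.live.erase e }

/-- If it does not exist, add a live edge `d`. -/
def add (N : RoofState α) (d : Edge α) : RoofState α :=
  if d ∈ N.edges then N else { N with edges := insert d N.edges, live := insert d N.live }

/-- Remove the edge `d`. -/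
def remove (N : RoofState α) (d : Edge α) : RoofState α :=
  { N with edges := N.edges.erase d, live := N.live.erase d }

open Classical in
/-- The live roofs, ordered lexicographically. -/
noncomputable def liveRoofs (N : RoofState α) : Finset (Edge α ×ₗ Edge α) :=
  ((N.live ×ˢ N.live).filter fun p => Edge.IsRoof p.1 p.2).map toLex.toEmbedding

open Classical in
/-- The edges `e''` such that `(d, e'')` is a live roof. -/
noncomputable def roofsFrom (N : RoofState α) (d : Edge α) : Finset (Edge α) :=
  N.live.filter fun e => d ∈ N.live ∧ Edge.IsRoof d e

open Classical in
/-- The edges `e''` such that `(e'', d)` is a live roof. -/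
noncomputable def roofsTo (N : RoofState α) (d : Edge α) : Finset (Edge α) :=
  N.live.filter fun e => d ∈ N.live ∧ Edge.IsRoof e d

/-- One step of the Falling Roofs algorithm.  Outside the inner loop (`cur = none`), the first live
roof `(e, e')` is replaced by the edge `d` between its lower ends, and the inner loop is entered; if
there is no live roof, the algorithm stops.  In the inner loop, as long as `d` is part of a live roof
with some edge `e''`, the edge `d` is replaced by the edge `d'` between the lower ends of that roof;
if `d` is not part of a live roof, the inner loop is left. -/
noncomputable def step (N : RoofState α) : Option (RoofState α) :=
  match N.cur with
  | none =>
    if h : N.liveRoofs.Nonempty then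
      let e := (ofLex (N.liveRoofs.min' h)).1
      let e' := (ofLex (N.liveRoofs.min' h)).2
      let d := Edge.mk e.src e'.src
      some { ((N.kill e).kill e').add d with cur := some d }
    else none
  | some d =>
    if h : (N.roofsFrom d).Nonempty then
      let e'' := (N.roofsFrom d).min' h
      let d' := Edge.mk d.src e''.src
      some { ((N.kill e'').add d').remove d with cur := some d' }
    else if h : (N.roofsTo d).Nonempty then
      let e'' := (N.roofsTo d).min' h
      let d' := Edge.mk e''.src d.src
      some { ((N.kill e'').add d').remove d with cur := some d' }
    else some { N with cur := none }

end RoofState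

namespace ProofStructure

variable {𝕏 : Type*}

/-- The graph on the atoms of `π` induced by an order, with an edge `x ⟶ y` if `x ∼ y` and
`x < y`. -/
noncomputable def graph (π : ProofStructure 𝕏) [LinearOrder π.Atom] : Finset (Edge π.Atom) :=
  have : Finite (Edge π.Atom) := inferInstanceAs (Finite (π.Atom × π.Atom))
  (Set.toFinite {e : Edge π.Atom | π.Sim e.src e.tgt ∧ e.src < e.tgt}).toFinset

end ProofStructure

/-! ## Coherence semantics of proof nets -/

/-! Every atom has exactly one partner at the vertex above its edge and, unless its edge is the
conclusion, exactly one at the vertex below. So the graph of `∼` consists of paths and cycles. Let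
positive atoms move up and negative atoms move down (`Succ`). This orients the graph consistently,
because axiom and cut links reverse both the direction of travel and the sign, while tensor and par
links preserve both. The paths start at the positive atoms of the conclusion and end at its negative
atoms.

That the structure is a proof net is needed to exclude cycles, and this is done by coherence
semantics. A compatible assignment of booleans to atoms is an experiment. By induction on the
sequent proof, two experiments whose values are strictly coherent at no conclusion are equal
(`SeqProof.isDeterministic`). Strict coherence is irreflexive, so with a single conclusion the
result determines the experiment. The indicator function of a cycle would have the same result as
the zero function (`IsProofNet.succ_acyclic`).

Hence the atoms are partitioned into paths from `U i` to `V (σ i)`, and the quotient has one free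
variable for each path. The differences `U i - V (σ i)` form a Gröbner basis, because an element of
the ideal whose leading monomial contains no `U i` lies in `k[V]`, where the map to the quotient is
injective.

For the algorithms, the invariant is that the live edges form a system of paths (`RoofInv`), at
first the paths of `∼`. A live roof is a local maximum of a path, and replacing it by its base takes
the peak out of the path (`contract`); dead edges end at points that have become isolated. Once
there is no live roof, no interior point is left on a path, since the ends of the paths lie below
all interior points, so each path is a single edge.

On the algebraic side, the base of a roof is the `S`-polynomial of its edges, and each step of the
inner loop is one cancellation of a leading term by the only available divisor
(`RoofInv.exists_reaches_none`). The edge left by the inner loop has a target of its own, so roofs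
outside the inner loop consist of original edges, for which list order and edge order agree. Thus
the pairs in `B` that are roofs are exactly the live ones (`BuchbergerInv`), and the two algorithms
run in parallel (`RoofInv.exists_reaches`). -/

namespace Formula

variable {𝕏 : Type*}

/-- Strict coherence in the coherence space interpreting a formula, where a positive atom is
interpreted by the coherence space with two coherent points.  Points of the web are represented by
the lists of their components. -/
def SCoh : Formula 𝕏 → List Bool → List Bool → Prop
  | atom _ x, a, b => x = true ∧ a ≠ b
  | tensor A B, a, b => a ≠ b ∧
      (a.take A.orientedAtoms.length = b.take A.orientedAtoms.length ∨
        A.SCoh (a.take A.orientedAtoms.length) (b.take A.orientedAtoms.length)) ∧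
      (a.drop A.orientedAtoms.length = b.drop A.orientedAtoms.length ∨
        B.SCoh (a.drop A.orientedAtoms.length) (b.drop A.orientedAtoms.length))
  | par A B, a, b =>
      A.SCoh (a.take A.orientedAtoms.length) (b.take A.orientedAtoms.length) ∨
        B.SCoh (a.drop A.orientedAtoms.length) (b.drop A.orientedAtoms.length)

theorem length_orientedAtoms_neg (A : Formula 𝕏) :
    A.neg.orientedAtoms.length = A.orientedAtoms.length := by
  simp [orientedAtoms_neg]

theorem length_orientedAtoms_pos (A : Formula 𝕏) : 0 < A.orientedAtoms.length := by
  induction A with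
  | atom X x => simp [orientedAtoms]
  | tensor A B hA hB => simp [orientedAtoms]; omega
  | par A B hA hB => simp [orientedAtoms]; omega

/-- Irreflexivity turns equality of values into failure of strict coherence, both at a cut and at
the conclusion. -/
theorem SCoh.ne {A : Formula 𝕏} {a b : List Bool} (h : A.SCoh a b) : a ≠ b := by
  induction A generalizing a b with
  | atom X x => exact h.2
  | tensor A B hA hB => exact h.1
  | par A B hA hB =>
    rintro rfl
    rcases h with h | h
    · exact hA h rfl
    · exact hB h rfl

theorem sCoh_tensor_append {A B : Formula 𝕏} {a b a' b' : List Bool}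
    (ha : a.length = A.orientedAtoms.length) (hb : b.length = A.orientedAtoms.length) :
    (A.tensor B).SCoh (a ++ a') (b ++ b') ↔
      (a ≠ b ∨ a' ≠ b') ∧ (a = b ∨ A.SCoh a b) ∧ (a' = b' ∨ B.SCoh a' b') := by
  have h : a ++ a' = b ++ b' ↔ a = b ∧ a' = b' :=
    ⟨fun h => List.append_inj h (ha.trans hb.symm), fun h => by rw [h.1, h.2]⟩
  rw [SCoh, List.take_left' ha, List.take_left' hb, List.drop_left' ha, List.drop_left' hb, Ne, h,
    not_and_or]

theorem sCoh_par_append {A B : Formula 𝕏} {a b a' b' : List Bool}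
    (ha : a.length = A.orientedAtoms.length) (hb : b.length = A.orientedAtoms.length) :
    (A.par B).SCoh (a ++ a') (b ++ b') ↔ A.SCoh a b ∨ B.SCoh a' b' := by
  rw [SCoh, List.take_left' ha, List.take_left' hb, List.drop_left' ha, List.drop_left' hb]

/-- Of two distinct points exactly one of strict coherence and strict incoherence holds. -/
theorem sCoh_neg_iff {A : Formula 𝕏} {a b : List Bool} (ha : a.length = A.orientedAtoms.length)
    (hb : b.length = A.orientedAtoms.length) (hne : a ≠ b) :
    A.neg.SCoh a.reverse b.reverse ↔ ¬ A.SCoh a b := by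
  induction A generalizing a b with
  | atom X x => cases x <;> simp [neg, SCoh, hne]
  | tensor A B hA hB =>
    rename' ha => ha₀, hb => hb₀
    obtain ⟨a, a', rfl, ha⟩ : ∃ l r, a = l ++ r ∧ l.length = A.orientedAtoms.length :=
      ⟨_, _, (List.take_append_drop A.orientedAtoms.length a).symm, by simp [ha₀, orientedAtoms]⟩
    obtain ⟨b, b', rfl, hb⟩ : ∃ l r, b = l ++ r ∧ l.length = A.orientedAtoms.length :=
      ⟨_, _, (List.take_append_drop A.orientedAtoms.length b).symm, by simp [hb₀, orientedAtoms]⟩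
    have ha' : a'.length = B.orientedAtoms.length := by
      simp only [List.length_append, orientedAtoms] at ha₀ hb₀; omega
    have hb' : b'.length = B.orientedAtoms.length := by
      simp only [List.length_append, orientedAtoms] at ha₀ hb₀; omega
    rw [neg, List.reverse_append, List.reverse_append,
      sCoh_par_append (by simp [ha', length_orientedAtoms_neg])
        (by simp [hb', length_orientedAtoms_neg]), sCoh_tensor_append ha hb]
    have h1 := hA ha hb
    have h2 := hB ha' hb'
    -- The induction hypotheses say nothing about a component on which the two points agree; there
    -- irreflexivity excludes the corresponding disjunct of the par.
    have h3 := @SCoh.ne _ A.neg a.reverse b.reverse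
    have h4 := @SCoh.ne _ B.neg a'.reverse b'.reverse
    have h5 : a ≠ b ∨ a' ≠ b' := by
      by_contra! h; exact hne (by rw [h.1, h.2])
    simp only [ne_eq, List.reverse_inj] at h3 h4 h5
    tauto
  | par A B hA hB =>
    rename' ha => ha₀, hb => hb₀
    obtain ⟨a, a', rfl, ha⟩ : ∃ l r, a = l ++ r ∧ l.length = A.orientedAtoms.length :=
      ⟨_, _, (List.take_append_drop A.orientedAtoms.length a).symm, by simp [ha₀, orientedAtoms]⟩
    obtain ⟨b, b', rfl, hb⟩ : ∃ l r, b = l ++ r ∧ l.length = A.orientedAtoms.length :=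
      ⟨_, _, (List.take_append_drop A.orientedAtoms.length b).symm, by simp [hb₀, orientedAtoms]⟩
    have ha' : a'.length = B.orientedAtoms.length := by
      simp only [List.length_append, orientedAtoms] at ha₀ hb₀; omega
    have hb' : b'.length = B.orientedAtoms.length := by
      simp only [List.length_append, orientedAtoms] at ha₀ hb₀; omega
    rw [neg, List.reverse_append, List.reverse_append,
      sCoh_tensor_append (by simp [ha', length_orientedAtoms_neg])
        (by simp [hb', length_orientedAtoms_neg]), sCoh_par_append ha hb]
    have h1 := hA ha hb
    have h2 := hB ha' hb'
    have h3 := @SCoh.ne _ A a b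
    have h4 := @SCoh.ne _ B a' b'
    have h5 : a ≠ b ∨ a' ≠ b' := by
      by_contra! h; exact hne (by rw [h.1, h.2])
    simp only [ne_eq, List.reverse_inj] at h3 h4 h5 ⊢
    clear hA hB hne ha₀ hb₀ ha hb ha' hb'
    by_cases e : a = b <;> by_cases e' : a' = b' <;> simp_all [and_comm]

end Formula

/-! ### Experiments and their coherence -/

/-- The values `f` of the edges at a vertex are compatible. -/
def Link.Holds {E : Type} (f : E → List Bool) : Link E → Prop
  | ax e e' => f e' = (f e).reverse
  | cut e e' => f e' = (f e).reverse
  | tensor l r c => f c = f l ++ f r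
  | par l r c => f c = f l ++ f r
  | concl _ => True

theorem Link.holds_map {E E' : Type} (g : E → E') (f : E' → List Bool) (l : Link E) :
    (l.map g).Holds f ↔ l.Holds (f ∘ g) := by
  cases l <;> rfl

/-- Reversal is an involution, so an isomorphism may exchange the two edges of an axiom or cut link.
-/
theorem Link.holds_swap {E : Type} (f : E → List Bool) (l : Link E) :
    l.swap.Holds f ↔ l.Holds f := by
  have h : ∀ a b : List Bool, a = b.reverse ↔ b = a.reverse := fun a b => by
    rw [← List.reverse_eq_iff, eq_comm]
  cases l <;> first | exact h _ _ | exact Iff.rfl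

/-- An experiment assigns to each edge a point of the web of its label, compatibly at each
vertex. -/
structure IsExperiment {𝕏 : Type*} {V E : Type} (label : E → Formula 𝕏) (node : V → Link E)
    (f : E → List Bool) : Prop where
  length : ∀ e, (f e).length = (label e).orientedAtoms.length
  holds : ∀ v, (node v).Holds f

/-- The results of two different experiments are strictly coherent, where the edges `c` are the
conclusions. -/
def IsDeterministic {𝕏 : Type*} {V E : Type} (label : E → Formula 𝕏) (node : V → Link E)
    (c : List E) : Prop :=
  ∀ f g : E → List Bool, IsExperiment label node f → IsExperiment label node g →
    (∀ e ∈ c, ¬ (label e).SCoh (f e) (g e)) → ∀ e, f e = g e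

namespace IsDeterministic

variable {𝕏 : Type*} {V V' E E' : Type} {label : E → Formula 𝕏} {node : V → Link E}
  {label' : E' → Formula 𝕏} {node' : V' → Link E'} {a b : E} {a' : E'} {c d : List E}
  {c' : List E'}

theorem perm (h : IsDeterministic label node c) (hp : c.Perm d) : IsDeterministic label node d :=
  fun f g hf hg hc => h f g hf hg fun e he => hc e (hp.mem_iff.1 he)

/-- By duality, distinct points are strictly coherent on exactly one of the two edges, so strict
coherence cannot fail on both. -/
theorem ax (A : Formula 𝕏) : IsDeterministic (fun b => if b then A else A.neg)
    (fun _ : Unit => Link.ax true false) [false, true] := by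
  intro f g hf hg h
  have hf' : f false = (f true).reverse := hf.holds ()
  have hg' : g false = (g true).reverse := hg.holds ()
  have key : f true = g true := by
    by_contra hne
    refine h false (by simp) ?_
    rw [hf', hg']
    exact (Formula.sCoh_neg_iff (hf.length true) (hg.length true) hne).2 (h true (by simp))
  rintro (_ | _)
  · rw [hf', hg', key]
  · exact key

/-- Strict coherence fails at a par exactly when it fails at both premises, so the hypothesis passes
to the net above the link. -/
theorem addPar (h : IsDeterministic label node (a :: b :: c)) {C : Formula 𝕏}
    (hC : C = (label a).par (label b)) :
    IsDeterministic (Sum.elim label fun _ => C)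
      (Sum.elim (fun v => (node v).map Sum.inl)
        (fun _ : Unit => Link.par (Sum.inl a) (Sum.inl b) (Sum.inr ())))
      (Sum.inr () :: c.map Sum.inl) := by
  intro f g hf hg hc
  have hf' : IsExperiment label node (fun e => f (Sum.inl e)) :=
    ⟨fun e => hf.length (Sum.inl e), fun v => (Link.holds_map Sum.inl _ _).1
      (hf.holds (Sum.inl v))⟩
  have hg' : IsExperiment label node (fun e => g (Sum.inl e)) :=
    ⟨fun e => hg.length (Sum.inl e), fun v => (Link.holds_map Sum.inl _ _).1
      (hg.holds (Sum.inl v))⟩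
  have hfc : f (Sum.inr ()) = f (Sum.inl a) ++ f (Sum.inl b) := hf.holds (Sum.inr ())
  have hgc : g (Sum.inr ()) = g (Sum.inl a) ++ g (Sum.inl b) := hg.holds (Sum.inr ())
  have h0 := hc (Sum.inr ()) List.mem_cons_self
  rw [hfc, hgc, Sum.elim_inr, hC, Formula.sCoh_par_append (hf'.length a) (hg'.length a), not_or] at h0
  have key := h _ _ hf' hg' (by
    intro e he
    rcases List.mem_cons.1 he with rfl | he
    · exact h0.1
    rcases List.mem_cons.1 he with rfl | he
    · exact h0.2
    · exact hc (Sum.inl e) (List.mem_cons_of_mem _ (List.mem_map_of_mem he)))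
  rintro (e | e)
  · exact key e
  · exact hfc.trans ((congrArg₂ _ (key _) (key _)).trans hgc.symm)

/-- Two different experiments whose results are not strictly coherent at the conclusions `c` have
strictly coherent results at the remaining conclusion `a`. -/
theorem eq_or_sCoh (h : IsDeterministic label node (a :: c)) {f g : E → List Bool}
    (hf : IsExperiment label node f) (hg : IsExperiment label node g)
    (hc : ∀ e ∈ c, ¬ (label e).SCoh (f e) (g e)) :
    (∀ e, f e = g e) ∨ (label a).SCoh (f a) (g a) := by
  by_cases ha : (label a).SCoh (f a) (g a)
  · exact Or.inr ha
  · refine Or.inl (h f g hf hg fun e he => ?_)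
    rcases List.mem_cons.1 he with rfl | he
    · exact ha
    · exact hc e he

/-- By `eq_or_sCoh`, each net carries either equal experiments or strictly coherent values at its
premise of the tensor. As soon as one of them is of the second kind, the new conclusion is strictly
coherent, which is excluded. -/
theorem addTensor (h : IsDeterministic label node (a :: c))
    (h' : IsDeterministic label' node' (a' :: c')) {C : Formula 𝕏}
    (hC : C = (label a).tensor (label' a')) :
    IsDeterministic (Sum.elim (Sum.elim label label') fun _ => C)
      (Sum.elim (fun v => ((Sum.elim (fun v => (node v).map Sum.inl)
          (fun v => (node' v).map Sum.inr) : V ⊕ V' → Link (E ⊕ E')) v).map Sum.inl)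
        (fun _ : Unit => Link.tensor (Sum.inl (Sum.inl a)) (Sum.inl (Sum.inr a')) (Sum.inr ())))
      (Sum.inr () :: (c.map Sum.inl ++ c'.map Sum.inr).map Sum.inl) := by
  intro f g hf hg hc
  have hf1 : IsExperiment label node (fun e => f (Sum.inl (Sum.inl e))) :=
    ⟨fun e => hf.length (Sum.inl (Sum.inl e)), fun v => (Link.holds_map Sum.inl _ _).1
      ((Link.holds_map Sum.inl _ _).1 (hf.holds (Sum.inl (Sum.inl v))))⟩
  have hg1 : IsExperiment label node (fun e => g (Sum.inl (Sum.inl e))) :=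
    ⟨fun e => hg.length (Sum.inl (Sum.inl e)), fun v => (Link.holds_map Sum.inl _ _).1
      ((Link.holds_map Sum.inl _ _).1 (hg.holds (Sum.inl (Sum.inl v))))⟩
  have hf2 : IsExperiment label' node' (fun e => f (Sum.inl (Sum.inr e))) :=
    ⟨fun e => hf.length (Sum.inl (Sum.inr e)), fun v => (Link.holds_map Sum.inr _ _).1
      ((Link.holds_map Sum.inl _ _).1 (hf.holds (Sum.inl (Sum.inr v))))⟩
  have hg2 : IsExperiment label' node' (fun e => g (Sum.inl (Sum.inr e))) :=
    ⟨fun e => hg.length (Sum.inl (Sum.inr e)), fun v => (Link.holds_map Sum.inr _ _).1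
      ((Link.holds_map Sum.inl _ _).1 (hg.holds (Sum.inl (Sum.inr v))))⟩
  have hfc : f (Sum.inr ()) = f (Sum.inl (Sum.inl a)) ++ f (Sum.inl (Sum.inr a')) :=
    hf.holds (Sum.inr ())
  have hgc : g (Sum.inr ()) = g (Sum.inl (Sum.inl a)) ++ g (Sum.inl (Sum.inr a')) :=
    hg.holds (Sum.inr ())
  have h0 := hc (Sum.inr ()) List.mem_cons_self
  rw [hfc, hgc, Sum.elim_inr, hC, Formula.sCoh_tensor_append (hf1.length a) (hg1.length a)] at h0
  have k1 := h.eq_or_sCoh hf1 hg1 fun e he => hc (Sum.inl (Sum.inl e)) (by simpa using he)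
  have k2 := h'.eq_or_sCoh hf2 hg2 fun e he => hc (Sum.inl (Sum.inr e)) (by simpa using he)
  have key : (∀ e, f (Sum.inl (Sum.inl e)) = g (Sum.inl (Sum.inl e))) ∧
      ∀ e, f (Sum.inl (Sum.inr e)) = g (Sum.inl (Sum.inr e)) := by
    rcases k1 with k1 | k1
    · rcases k2 with k2 | k2
      · exact ⟨k1, k2⟩
      · exact absurd ⟨Or.inr k2.ne, Or.inl (k1 a), Or.inr k2⟩ h0
    · rcases k2 with k2 | k2
      · exact absurd ⟨Or.inl k1.ne, Or.inr k1, Or.inl (k2 a')⟩ h0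
      · exact absurd ⟨Or.inl k1.ne, Or.inr k1, Or.inr k2⟩ h0
  rintro ((e | e) | e)
  · exact key.1 e
  · exact key.2 e
  · exact hfc.trans ((congrArg₂ _ (key.1 _) (key.2 _)).trans hgc.symm)

/-- As for the tensor, each side is either equal everywhere or strictly coherent at its cut formula.
The mixed cases contradict irreflexivity, since the value on one edge of the cut determines the
value on the other; strict coherence on both sides contradicts duality. -/
theorem addCut (h : IsDeterministic label node (a :: c))
    (h' : IsDeterministic label' node' (a' :: c')) (ha : label' a' = (label a).neg) :
    IsDeterministic (Sum.elim label label')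
      (Sum.elim (Sum.elim (fun v => (node v).map Sum.inl) (fun v => (node' v).map Sum.inr) :
        V ⊕ V' → Link (E ⊕ E')) (fun _ : Unit => Link.cut (Sum.inl a) (Sum.inr a')))
      (c.map Sum.inl ++ c'.map Sum.inr) := by
  intro f g hf hg hc
  have hf1 : IsExperiment label node (fun e => f (Sum.inl e)) :=
    ⟨fun e => hf.length (Sum.inl e), fun v => (Link.holds_map Sum.inl _ _).1
      (hf.holds (Sum.inl (Sum.inl v)))⟩
  have hg1 : IsExperiment label node (fun e => g (Sum.inl e)) :=
    ⟨fun e => hg.length (Sum.inl e), fun v => (Link.holds_map Sum.inl _ _).1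
      (hg.holds (Sum.inl (Sum.inl v)))⟩
  have hf2 : IsExperiment label' node' (fun e => f (Sum.inr e)) :=
    ⟨fun e => hf.length (Sum.inr e), fun v => (Link.holds_map Sum.inr _ _).1
      (hf.holds (Sum.inl (Sum.inr v)))⟩
  have hg2 : IsExperiment label' node' (fun e => g (Sum.inr e)) :=
    ⟨fun e => hg.length (Sum.inr e), fun v => (Link.holds_map Sum.inr _ _).1
      (hg.holds (Sum.inl (Sum.inr v)))⟩
  have hfc : f (Sum.inr a') = (f (Sum.inl a)).reverse := hf.holds (Sum.inr ())
  have hgc : g (Sum.inr a') = (g (Sum.inl a)).reverse := hg.holds (Sum.inr ())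
  have k1 := h.eq_or_sCoh hf1 hg1 fun e he => hc (Sum.inl e) (by simpa using he)
  have k2 := h'.eq_or_sCoh hf2 hg2 fun e he => hc (Sum.inr e) (by simpa using he)
  rw [hfc, hgc, ha] at k2
  have key : (∀ e, f (Sum.inl e) = g (Sum.inl e)) ∧ ∀ e, f (Sum.inr e) = g (Sum.inr e) := by
    rcases k1 with k1 | k1
    · rcases k2 with k2 | k2
      · exact ⟨k1, k2⟩
      · exact absurd (congrArg List.reverse (k1 a)) k2.ne
    · rcases k2 with k2 | k2
      · have := k2 a'
        rw [hfc, hgc, List.reverse_inj] at this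
        exact absurd this k1.ne
      · exact absurd k1 ((Formula.sCoh_neg_iff (hf1.length a) (hg1.length a) k1.ne).1 k2)
  rintro (e | e)
  · exact key.1 e
  · exact key.2 e

end IsDeterministic

/-- This is the induction over the rules of the sequent calculus. Beyond the closure properties
above, it only rearranges the lists of conclusions. -/
theorem SeqProof.isDeterministic {𝕏 : Type*} : ∀ {Γ : List (Formula 𝕏)} (p : SeqProof Γ),
    IsDeterministic p.toOpenNet.label p.toOpenNet.node p.toOpenNet.conclList
  | _, .ax A => IsDeterministic.ax A
  | _, .exch Γ A B Δ p => p.isDeterministic.perm (EdgeSeq.toList_exch A B Δ Γ _).symm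
  | _, .par A B Γ p => by
      have h := (show IsDeterministic _ _ (p.toOpenNet.concl.head :: p.toOpenNet.concl.tail.head ::
        EdgeSeq.toList Γ p.toOpenNet.concl.tail.tail) from p.isDeterministic).addPar
        (congrArg₂ Formula.par (EdgeSeq.label_head p.toOpenNet.concl)
          (EdgeSeq.label_head p.toOpenNet.concl.tail)).symm
      exact h.perm (List.Perm.cons _ (List.Perm.of_eq (EdgeSeq.toList_map _ _ _ _).symm))
  | _, .cut A Γ Δ p q =>
      ((show IsDeterministic _ _ (p.toOpenNet.concl.head :: EdgeSeq.toList Γ p.toOpenNet.concl.tail)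
          from p.isDeterministic).addCut
        (show IsDeterministic _ _ (q.toOpenNet.concl.head :: EdgeSeq.toList Δ q.toOpenNet.concl.tail)
          from q.isDeterministic) ((EdgeSeq.label_head q.toOpenNet.concl).trans
          (congrArg Formula.neg (EdgeSeq.label_head p.toOpenNet.concl).symm))).perm
      (List.Perm.of_eq ((EdgeSeq.toList_append _ _ _ _).trans
        (congrArg₂ _ (EdgeSeq.toList_map _ _ _ _) (EdgeSeq.toList_map _ _ _ _))).symm)
  | _, .tensor A B Γ Δ p q => by
      have h := (show IsDeterministic _ _ (p.toOpenNet.concl.head ::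
          EdgeSeq.toList Γ p.toOpenNet.concl.tail) from p.isDeterministic).addTensor
        (show IsDeterministic _ _ (q.toOpenNet.concl.head :: EdgeSeq.toList Δ q.toOpenNet.concl.tail)
          from q.isDeterministic)
        (congrArg₂ Formula.tensor (EdgeSeq.label_head p.toOpenNet.concl)
          (EdgeSeq.label_head q.toOpenNet.concl)).symm
      exact h.perm (List.Perm.cons _ (List.Perm.of_eq ((EdgeSeq.toList_map _ _ _ _).trans
        (congrArg _ ((EdgeSeq.toList_append _ _ _ _).trans
          (congrArg₂ _ (EdgeSeq.toList_map _ _ _ _) (EdgeSeq.toList_map _ _ _ _))))).symm))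

namespace ProofStructure

variable {𝕏 : Type*}

/-- An experiment on a proof net is determined by its result. -/
theorem IsProofNet.experiment_ext {π : ProofStructure 𝕏} (hπ : π.IsProofNet) {c : π.E}
    (hc : π.HasSingleConclusion c) {f g : π.E → List Bool} (hf : IsExperiment π.label π.node f)
    (hg : IsExperiment π.label π.node g) (h : f c = g c) : f = g := by
  obtain ⟨Γ, p, ⟨φ⟩⟩ := hπ
  have key : ∀ f : π.E → List Bool, IsExperiment π.label π.node f →
      IsExperiment p.toOpenNet.label p.toOpenNet.node (fun e => f (φ.edge e)) := by
    intro f hf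
    refine ⟨fun e => (hf.length _).trans (congrArg (fun A => A.orientedAtoms.length) (φ.label_eq e)), fun v => ?_⟩
    refine (Link.holds_map φ.edge f _).1 ?_
    have hv := hf.holds (φ.vert (Sum.inl v))
    rcases φ.node_eq (Sum.inl v) with h | h <;> rw [h] at hv
    · exact hv
    · exact (Link.holds_swap _ _).1 hv
  -- Every conclusion of the translated proof corresponds to `c`, where the two values agree and
  -- therefore are not strictly coherent.
  have := p.isDeterministic _ _ (key f hf) (key g hg) (by
    intro e he
    have : φ.edge e = c := by
      rw [← hc]
      refine ⟨φ.vert (Sum.inr ⟨e, he⟩), ?_⟩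
      rcases φ.node_eq (Sum.inr ⟨e, he⟩) with h | h <;> rw [h] <;> rfl
    simp only [this, h]
    exact fun h => h.ne rfl)
  funext e
  have he := this (φ.edge.symm e)
  have hs : φ.edge (φ.edge.symm e) = e := φ.edge.apply_symm_apply e
  simpa only [hs] using he

end ProofStructure

/-! ### Orientation and acyclicity of the relation `∼` -/

namespace ProofStructure

variable {𝕏 : Type*} {π : ProofStructure 𝕏}

theorem isLinkPair_ax {v : π.V} {e e' : π.E} (hv : π.node v = .ax e e') (x y : π.Atom) :
    π.IsLinkPair v x y ↔ x.edge = e ∧ y.edge = e' ∧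
      x.idx.val + y.idx.val + 1 = (π.label e).orientedAtoms.length := by
  simp only [IsLinkPair, hv]

theorem isLinkPair_cut {v : π.V} {e e' : π.E} (hv : π.node v = .cut e e') (x y : π.Atom) :
    π.IsLinkPair v x y ↔ x.edge = e ∧ y.edge = e' ∧
      x.idx.val + y.idx.val + 1 = (π.label e).orientedAtoms.length := by
  simp only [IsLinkPair, hv]

theorem isLinkPair_binary {v : π.V} {l r c : π.E}
    (hv : π.node v = .tensor l r c ∨ π.node v = .par l r c) (x y : π.Atom) :
    π.IsLinkPair v x y ↔ y.edge = c ∧ ((x.edge = l ∧ y.idx.val = x.idx.val) ∨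
      (x.edge = r ∧ y.idx.val = (π.label l).orientedAtoms.length + x.idx.val)) := by
  rcases hv with hv | hv <;> simp only [IsLinkPair, hv]

theorem not_isLinkPair_concl {v : π.V} {e : π.E} (hv : π.node v = .concl e) (x y : π.Atom) :
    ¬ π.IsLinkPair v x y := by
  simp only [IsLinkPair, hv, not_false_eq_true]

theorem orientedAtoms_binary {v : π.V} {l r c : π.E}
    (hv : π.node v = .tensor l r c ∨ π.node v = .par l r c) :
    (π.label c).orientedAtoms = (π.label l).orientedAtoms ++ (π.label r).orientedAtoms := by
  have := π.wellLabelled v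
  rcases hv with hv | hv <;> rw [hv] at this <;> rw [show π.label c = _ from this] <;> rfl

theorem orientedAtoms_dual {v : π.V} {e e' : π.E}
    (hv : π.node v = .ax e e' ∨ π.node v = .cut e e') :
    (π.label e').orientedAtoms =
      ((π.label e).orientedAtoms.map fun p => (p.1, !p.2)).reverse := by
  have := π.wellLabelled v
  rcases hv with hv | hv <;> rw [hv] at this <;>
    rw [show π.label e' = _ from this, Formula.orientedAtoms_neg]

/-- The conclusion has as many atoms as both premises together, and no formula is without atoms. -/
theorem binary_ne {v : π.V} {l r c : π.E}
    (hv : π.node v = .tensor l r c ∨ π.node v = .par l r c) : c ≠ l ∧ c ≠ r := by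
  have h := congrArg List.length (orientedAtoms_binary hv)
  have hl := (π.label l).length_orientedAtoms_pos
  have hr := (π.label r).length_orientedAtoms_pos
  rw [List.length_append] at h
  constructor <;> rintro rfl <;> omega

theorem dual_ne {v : π.V} {e e' : π.E}
    (hv : π.node v = .ax e e' ∨ π.node v = .cut e e') : e ≠ e' := by
  rcases hv with hv | hv
  · simpa [hv, Link.conclusions] using π.nodup_conclusions v
  · simpa [hv, Link.premises] using π.nodup_premises v

theorem Atom.ext_val {x y : π.Atom} (h : x.edge = y.edge) (hi : x.idx.val = y.idx.val) :
    x = y := by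
  cases x with | mk e i =>
  cases y with | mk e' j =>
  obtain rfl : e = e' := h
  obtain rfl : i = j := Fin.ext hi
  rfl

theorem Atom.idx_lt (x : π.Atom) {e : π.E} (h : x.edge = e) :
    x.idx.val < (π.label e).orientedAtoms.length := by
  subst h
  exact x.idx.2

theorem Atom.getElem?_eq_sign (x : π.Atom) {e : π.E} (h : x.edge = e) :
    ((π.label e).orientedAtoms.map Prod.snd)[x.idx.val]? = some x.sign := by
  subst h
  simp [Atom.sign]

theorem sign_dual {v : π.V} {e e' : π.E} (hv : π.node v = .ax e e' ∨ π.node v = .cut e e')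
    {x y : π.Atom} (hx : x.edge = e) (hy : y.edge = e')
    (h : x.idx.val + y.idx.val + 1 = (π.label e).orientedAtoms.length) : y.sign = !x.sign := by
  have h1 := x.getElem?_eq_sign hx
  have h2 := y.getElem?_eq_sign hy
  have hy' := y.idx_lt hy
  have hlen : (π.label e').orientedAtoms.length = (π.label e).orientedAtoms.length := by
    simpa using congrArg List.length (orientedAtoms_dual hv)
  rw [orientedAtoms_dual hv, List.map_reverse, List.map_map,
    List.getElem?_reverse (by simp; omega)] at h2
  simp only [List.length_map, List.getElem?_map] at h1 h2
  rw [show (π.label e).orientedAtoms.length - 1 - y.idx.val = x.idx.val by omega] at h2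
  rw [Option.map_eq_some_iff] at h1 h2
  obtain ⟨p, hp, hp'⟩ := h1
  obtain ⟨q, hq, hq'⟩ := h2
  rw [hp] at hq
  obtain rfl := Option.some.inj hq
  rw [← hp', ← hq']
  rfl

theorem sign_binary {v : π.V} {l r c : π.E}
    (hv : π.node v = .tensor l r c ∨ π.node v = .par l r c) {x y : π.Atom}
    (h : π.IsLinkPair v x y) : y.sign = x.sign := by
  obtain ⟨hy, h⟩ := (isLinkPair_binary hv x y).1 h
  have h2 := y.getElem?_eq_sign hy
  rw [orientedAtoms_binary hv, List.map_append] at h2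
  rcases h with ⟨hx, h⟩ | ⟨hx, h⟩
  · have h1 := x.getElem?_eq_sign hx
    have hi := x.idx_lt hx
    rw [h, List.getElem?_append_left (by rw [List.length_map]; omega), h1] at h2
    exact (Option.some.inj h2).symm
  · have h1 := x.getElem?_eq_sign hx
    rw [h, List.getElem?_append_right (by simp), List.length_map, Nat.add_sub_cancel_left,
      h1] at h2
    exact (Option.some.inj h2).symm

/-- `y` is the partner of `x` at the vertex of which the edge of `x` is a conclusion. -/
def Up (π : ProofStructure 𝕏) (x y : π.Atom) : Prop :=
  ∃ v, x.edge ∈ (π.node v).conclusions ∧ (π.IsLinkPair v x y ∨ π.IsLinkPair v y x)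

/-- `y` is the partner of `x` at the vertex of which the edge of `x` is a premise. -/
def Down (π : ProofStructure 𝕏) (x y : π.Atom) : Prop :=
  ∃ v, x.edge ∈ (π.node v).premises ∧ (π.IsLinkPair v x y ∨ π.IsLinkPair v y x)

/-- An axiom link lies above both of its edges, a cut link below both, and a logical link below its
premises and above its conclusion. -/
theorem sim_iff_up_or_down {x y : π.Atom} : π.Sim x y ↔ π.Up x y ∨ π.Down x y := by
  constructor
  · rintro ⟨v, h⟩
    rcases hv : π.node v with ⟨e, e'⟩ | ⟨e, e'⟩ | ⟨l, r, c⟩ | ⟨l, r, c⟩ | e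
    · refine Or.inl ⟨v, ?_, h⟩
      rw [isLinkPair_ax hv, isLinkPair_ax hv] at h
      rw [hv]; simp only [Link.conclusions, List.mem_cons]; tauto
    · refine Or.inr ⟨v, ?_, h⟩
      rw [isLinkPair_cut hv, isLinkPair_cut hv] at h
      rw [hv]; simp only [Link.premises, List.mem_cons]; tauto
    · rcases h with h | h
      · refine Or.inr ⟨v, ?_, Or.inl h⟩
        rw [isLinkPair_binary (Or.inl hv)] at h
        rw [hv]; simp only [Link.premises, List.mem_cons]; tauto
      · refine Or.inl ⟨v, ?_, Or.inr h⟩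
        rw [isLinkPair_binary (Or.inl hv)] at h
        rw [hv]; simp only [Link.conclusions, List.mem_cons]; tauto
    · rcases h with h | h
      · refine Or.inr ⟨v, ?_, Or.inl h⟩
        rw [isLinkPair_binary (Or.inr hv)] at h
        rw [hv]; simp only [Link.premises, List.mem_cons]; tauto
      · refine Or.inl ⟨v, ?_, Or.inr h⟩
        rw [isLinkPair_binary (Or.inr hv)] at h
        rw [hv]; simp only [Link.conclusions, List.mem_cons]; tauto
    · simp [not_isLinkPair_concl hv] at h
  · rintro (⟨v, -, h⟩ | ⟨v, -, h⟩) <;> exact ⟨v, h⟩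

/-- The vertex above an atom, with the partner of that atom, is an axiom link or a logical link. -/
theorem Up.cases {x y : π.Atom} (h : π.Up x y) :
    (∃ v e e', π.node v = .ax e e' ∧
      ((x.edge = e ∧ y.edge = e') ∨ (x.edge = e' ∧ y.edge = e)) ∧
      x.idx.val + y.idx.val + 1 = (π.label e).orientedAtoms.length) ∨
    ∃ v l r c, (π.node v = .tensor l r c ∨ π.node v = .par l r c) ∧ x.edge = c ∧
      π.IsLinkPair v y x := by
  obtain ⟨v, hx, h⟩ := h
  rcases hv : π.node v with ⟨e, e'⟩ | ⟨e, e'⟩ | ⟨l, r, c⟩ | ⟨l, r, c⟩ | e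
  · left
    refine ⟨v, e, e', hv, ?_⟩
    rw [isLinkPair_ax hv, isLinkPair_ax hv] at h
    rcases h with h | h
    · exact ⟨Or.inl ⟨h.1, h.2.1⟩, h.2.2⟩
    · exact ⟨Or.inr ⟨h.2.1, h.1⟩, by omega⟩
  · simp [hv, Link.conclusions] at hx
  · right
    have hx' : x.edge = c := by simpa [hv, Link.conclusions] using hx
    refine ⟨v, l, r, c, Or.inl hv, hx', h.resolve_left fun h => ?_⟩
    have h2 := binary_ne (Or.inl hv)
    rw [isLinkPair_binary (Or.inl hv)] at h
    rcases h with ⟨-, ⟨h, -⟩ | ⟨h, -⟩⟩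
    · exact h2.1 (hx'.symm.trans h)
    · exact h2.2 (hx'.symm.trans h)
  · right
    have hx' : x.edge = c := by simpa [hv, Link.conclusions] using hx
    refine ⟨v, l, r, c, Or.inr hv, hx', h.resolve_left fun h => ?_⟩
    have h2 := binary_ne (Or.inr hv)
    rw [isLinkPair_binary (Or.inr hv)] at h
    rcases h with ⟨-, ⟨h, -⟩ | ⟨h, -⟩⟩
    · exact h2.1 (hx'.symm.trans h)
    · exact h2.2 (hx'.symm.trans h)
  · simp [hv, Link.conclusions] at hx

theorem Down.cases {x y : π.Atom} (h : π.Down x y) :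
    (∃ v e e', π.node v = .cut e e' ∧
      ((x.edge = e ∧ y.edge = e') ∨ (x.edge = e' ∧ y.edge = e)) ∧
      x.idx.val + y.idx.val + 1 = (π.label e).orientedAtoms.length) ∨
    ∃ v l r c, (π.node v = .tensor l r c ∨ π.node v = .par l r c) ∧ (x.edge = l ∨ x.edge = r) ∧
      π.IsLinkPair v x y := by
  obtain ⟨v, hx, h⟩ := h
  rcases hv : π.node v with ⟨e, e'⟩ | ⟨e, e'⟩ | ⟨l, r, c⟩ | ⟨l, r, c⟩ | e
  · simp [hv, Link.premises] at hx
  · left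
    refine ⟨v, e, e', hv, ?_⟩
    rw [isLinkPair_cut hv, isLinkPair_cut hv] at h
    rcases h with h | h
    · exact ⟨Or.inl ⟨h.1, h.2.1⟩, h.2.2⟩
    · exact ⟨Or.inr ⟨h.2.1, h.1⟩, by omega⟩
  · right
    have hx' : x.edge = l ∨ x.edge = r := by simpa [hv, Link.premises] using hx
    refine ⟨v, l, r, c, Or.inl hv, hx', h.resolve_right fun h => ?_⟩
    have h2 := binary_ne (Or.inl hv)
    rw [isLinkPair_binary (Or.inl hv)] at h
    obtain ⟨h, -⟩ := h
    rw [h] at hx'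
    tauto
  · right
    have hx' : x.edge = l ∨ x.edge = r := by simpa [hv, Link.premises] using hx
    refine ⟨v, l, r, c, Or.inr hv, hx', h.resolve_right fun h => ?_⟩
    have h2 := binary_ne (Or.inr hv)
    rw [isLinkPair_binary (Or.inr hv)] at h
    obtain ⟨h, -⟩ := h
    rw [h] at hx'
    tauto
  · simp [not_isLinkPair_concl hv] at h

/-- At an axiom link the way up turns into a way down and the sign flips; at a logical link both
direction and sign are kept. This is why the sign of an atom can prescribe its direction in `Succ`.
-/
theorem Up.symm {x y : π.Atom} (h : π.Up x y) :
    (y.sign = !x.sign ∧ π.Up y x) ∨ (y.sign = x.sign ∧ π.Down y x) := by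
  rcases h.cases with ⟨v, e, e', hv, h1, h2⟩ | ⟨v, l, r, c, hv, -, h2⟩
  · left
    rcases h1 with ⟨h1, h1'⟩ | ⟨h1, h1'⟩
    · exact ⟨sign_dual (Or.inl hv) h1 h1' h2, v, by simp [hv, Link.conclusions, h1'],
        Or.inr ((isLinkPair_ax hv _ _).2 ⟨h1, h1', h2⟩)⟩
    · refine ⟨?_, v, by simp [hv, Link.conclusions, h1'],
        Or.inl ((isLinkPair_ax hv _ _).2 ⟨h1', h1, by omega⟩)⟩
      rw [sign_dual (Or.inl hv) h1' h1 (by omega), Bool.not_not]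
  · right
    refine ⟨(sign_binary hv h2).symm, v, ?_, Or.inl h2⟩
    have := (isLinkPair_binary hv _ _).1 h2
    rcases hv with hv | hv <;> rw [hv] <;> simp only [Link.premises, List.mem_cons] <;> tauto

theorem Down.symm {x y : π.Atom} (h : π.Down x y) :
    (y.sign = !x.sign ∧ π.Down y x) ∨ (y.sign = x.sign ∧ π.Up y x) := by
  rcases h.cases with ⟨v, e, e', hv, h1, h2⟩ | ⟨v, l, r, c, hv, -, h2⟩
  · left
    rcases h1 with ⟨h1, h1'⟩ | ⟨h1, h1'⟩
    · exact ⟨sign_dual (Or.inr hv) h1 h1' h2, v, by simp [hv, Link.premises, h1'],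
        Or.inr ((isLinkPair_cut hv _ _).2 ⟨h1, h1', h2⟩)⟩
    · refine ⟨?_, v, by simp [hv, Link.premises, h1'],
        Or.inl ((isLinkPair_cut hv _ _).2 ⟨h1', h1, by omega⟩)⟩
      rw [sign_dual (Or.inr hv) h1' h1 (by omega), Bool.not_not]
  · right
    refine ⟨sign_binary hv h2, v, ?_, Or.inr h2⟩
    have := (isLinkPair_binary hv _ _).1 h2
    rcases hv with hv | hv <;> rw [hv] <;> simp only [Link.conclusions, List.mem_cons] <;> tauto

theorem source_unique {e : π.E} {v w : π.V} (hv : e ∈ (π.node v).conclusions)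
    (hw : e ∈ (π.node w).conclusions) : v = w :=
  (π.source e).unique hv hw

theorem target_unique {e : π.E} {v w : π.V} (hv : e ∈ (π.node v).premises)
    (hw : e ∈ (π.node w).premises) : v = w :=
  (π.target e).unique hv hw

/-- An edge has only one source, and there the position determines the partner: by reflection at an
axiom link, and at a logical link because the atoms of the left premise precede those of the right
one. -/
theorem Up.unique {x y z : π.Atom} (h : π.Up x y) (h' : π.Up x z) : y = z := by
  rcases h.cases with ⟨v, e, e', hv, h1, h2⟩ | ⟨v, l, r, c, hv, h1, h2⟩
  · have hxv : x.edge ∈ (π.node v).conclusions := by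
      simp only [hv, Link.conclusions, List.mem_cons]; tauto
    have hne := dual_ne (Or.inl hv)
    obtain ⟨w, hxw, h3⟩ := h'
    obtain rfl := source_unique hxv hxw
    rw [isLinkPair_ax hv, isLinkPair_ax hv] at h3
    refine Atom.ext_val ?_ (by omega)
    grind
  · have hxv : x.edge ∈ (π.node v).conclusions := by
      rcases hv with hv | hv <;> simp only [hv, Link.conclusions, List.mem_cons] <;> tauto
    rcases h'.cases with ⟨w, e, e', hw, h3, h4⟩ | ⟨w, l', r', c', hw, h3, h4⟩
    · have hxw : x.edge ∈ (π.node w).conclusions := by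
        simp only [hw, Link.conclusions, List.mem_cons]; tauto
      obtain rfl := source_unique hxv hxw
      rw [hw] at hv; simp at hv
    · have hxw : x.edge ∈ (π.node w).conclusions := by
        rcases hw with hw | hw <;> simp only [hw, Link.conclusions, List.mem_cons] <;> tauto
      obtain rfl := source_unique hxv hxw
      rw [isLinkPair_binary hv] at h2 h4
      rcases h2 with ⟨-, ⟨h2, h2'⟩ | ⟨h2, h2'⟩⟩ <;> rcases h4 with ⟨-, ⟨h4, h4'⟩ | ⟨h4, h4'⟩⟩
      · exact Atom.ext_val (h2.trans h4.symm) (by omega)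
      · have := y.idx_lt h2; omega
      · have := z.idx_lt h4; omega
      · exact Atom.ext_val (h2.trans h4.symm) (by omega)

theorem Down.unique {x y z : π.Atom} (h : π.Down x y) (h' : π.Down x z) : y = z := by
  rcases h.cases with ⟨v, e, e', hv, h1, h2⟩ | ⟨v, l, r, c, hv, h1, h2⟩
  · have hxv : x.edge ∈ (π.node v).premises := by
      simp only [hv, Link.premises, List.mem_cons]; tauto
    have hne := dual_ne (Or.inr hv)
    obtain ⟨w, hxw, h3⟩ := h'
    obtain rfl := target_unique hxv hxw
    rw [isLinkPair_cut hv, isLinkPair_cut hv] at h3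
    refine Atom.ext_val ?_ (by omega)
    grind
  · have hxv : x.edge ∈ (π.node v).premises := by
      rcases hv with hv | hv <;> simp only [hv, Link.premises, List.mem_cons] <;> tauto
    rcases h'.cases with ⟨w, e, e', hw, h3, h4⟩ | ⟨w, l', r', c', hw, h3, h4⟩
    · have hxw : x.edge ∈ (π.node w).premises := by
        simp only [hw, Link.premises, List.mem_cons]; tauto
      obtain rfl := target_unique hxv hxw
      rw [hw] at hv; simp at hv
    · have hxw : x.edge ∈ (π.node w).premises := by
        rcases hw with hw | hw <;> simp only [hw, Link.premises, List.mem_cons] <;> tauto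
      obtain rfl := target_unique hxv hxw
      rw [isLinkPair_binary hv] at h2 h4
      -- If both premises were the same edge, an atom would have two partners below.
      have hlr : l ≠ r := by
        have := π.nodup_premises v
        rcases hv with hv | hv <;> simpa [hv, Link.premises] using this
      refine Atom.ext_val (h2.1.trans h4.1.symm) ?_
      grind

/-- The source of an edge is an axiom or a logical link, and these pair every atom of their
conclusions. -/
theorem exists_up (x : π.Atom) : ∃ y, π.Up x y := by
  obtain ⟨v, hx, -⟩ := π.source x.edge
  have binary : ∀ l r c, (π.node v = .tensor l r c ∨ π.node v = .par l r c) →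
      ∃ y, π.Up x y := by
    intro l r c hv
    have hx' : x.edge = c := by
      rcases hv with hv | hv <;> simpa [hv, Link.conclusions] using hx
    have hlen := congrArg List.length (orientedAtoms_binary hv)
    rw [List.length_append] at hlen
    have hi := x.idx_lt hx'
    by_cases hlt : x.idx.val < (π.label l).orientedAtoms.length
    · exact ⟨⟨l, x.idx.val, hlt⟩, v, hx,
        Or.inr ((isLinkPair_binary hv _ _).2 ⟨hx', Or.inl ⟨rfl, rfl⟩⟩)⟩
    · exact ⟨⟨r, x.idx.val - (π.label l).orientedAtoms.length, by omega⟩, v, hx,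
        Or.inr ((isLinkPair_binary hv _ _).2 ⟨hx', Or.inr ⟨rfl, by dsimp only; omega⟩⟩)⟩
  rcases hv : π.node v with ⟨e, e'⟩ | ⟨e, e'⟩ | ⟨l, r, c⟩ | ⟨l, r, c⟩ | e
  · have hlen : (π.label e').orientedAtoms.length = (π.label e).orientedAtoms.length := by
      simpa using congrArg List.length (orientedAtoms_dual (Or.inl hv))
    have hx' : x.edge = e ∨ x.edge = e' := by simpa [hv, Link.conclusions] using hx
    rcases hx' with hx' | hx'
    · have hi := x.idx_lt hx'
      exact ⟨⟨e', (π.label e).orientedAtoms.length - 1 - x.idx.val, by omega⟩, v, hx,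
        Or.inl ((isLinkPair_ax hv _ _).2 ⟨hx', rfl, by dsimp only; omega⟩)⟩
    · have hi := x.idx_lt hx'
      exact ⟨⟨e, (π.label e).orientedAtoms.length - 1 - x.idx.val, by omega⟩, v, hx,
        Or.inr ((isLinkPair_ax hv _ _).2 ⟨rfl, hx', by dsimp only; omega⟩)⟩
  · simp [hv, Link.conclusions] at hx
  · exact binary l r c (Or.inl hv)
  · exact binary l r c (Or.inr hv)
  · simp [hv, Link.conclusions] at hx

/-- The target of an edge pairs all atoms of its premises unless it is a conclusion vertex, which
happens only for `c`. -/
theorem exists_down_iff {c : π.E} (hc : π.HasSingleConclusion c) (x : π.Atom) :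
    (∃ y, π.Down x y) ↔ x.edge ≠ c := by
  obtain ⟨v, hx, -⟩ := π.target x.edge
  have ne : (∀ e, π.node v ≠ .concl e) → x.edge ≠ c := by
    intro h he
    obtain ⟨w, hw⟩ := (hc x.edge).2 he
    obtain rfl := target_unique hx (show x.edge ∈ (π.node w).premises by simp [hw, Link.premises])
    exact h _ hw
  have binary : ∀ l r d, (π.node v = .tensor l r d ∨ π.node v = .par l r d) →
      ((∃ y, π.Down x y) ↔ x.edge ≠ c) := by
    intro l r d hv
    refine iff_of_true ?_ (ne ?_)
    · have hx' : x.edge = l ∨ x.edge = r := by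
        rcases hv with hv | hv <;> simpa [hv, Link.premises] using hx
      have hlen := congrArg List.length (orientedAtoms_binary hv)
      rw [List.length_append] at hlen
      rcases hx' with hx' | hx' <;> have hi := x.idx_lt hx'
      · exact ⟨⟨d, x.idx.val, by omega⟩, v, hx,
          Or.inl ((isLinkPair_binary hv _ _).2 ⟨rfl, Or.inl ⟨hx', rfl⟩⟩)⟩
      · exact ⟨⟨d, (π.label l).orientedAtoms.length + x.idx.val, by omega⟩, v, hx,
          Or.inl ((isLinkPair_binary hv _ _).2 ⟨rfl, Or.inr ⟨hx', rfl⟩⟩)⟩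
    · rcases hv with hv | hv <;> simp [hv]
  rcases hv : π.node v with ⟨e, e'⟩ | ⟨e, e'⟩ | ⟨l, r, d⟩ | ⟨l, r, d⟩ | e
  · simp [hv, Link.premises] at hx
  · refine iff_of_true ?_ (ne (by simp [hv]))
    have hlen : (π.label e').orientedAtoms.length = (π.label e).orientedAtoms.length := by
      simpa using congrArg List.length (orientedAtoms_dual (Or.inr hv))
    have hx' : x.edge = e ∨ x.edge = e' := by simpa [hv, Link.premises] using hx
    rcases hx' with hx' | hx'
    · have hi := x.idx_lt hx'
      exact ⟨⟨e', (π.label e).orientedAtoms.length - 1 - x.idx.val, by omega⟩, v, hx,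
        Or.inl ((isLinkPair_cut hv _ _).2 ⟨hx', rfl, by dsimp only; omega⟩)⟩
    · have hi := x.idx_lt hx'
      exact ⟨⟨e, (π.label e).orientedAtoms.length - 1 - x.idx.val, by omega⟩, v, hx,
        Or.inr ((isLinkPair_cut hv _ _).2 ⟨rfl, hx', by dsimp only; omega⟩)⟩
  · exact binary l r d (Or.inl hv)
  · exact binary l r d (Or.inr hv)
  · have hx' : x.edge = e := by simpa [hv, Link.premises] using hx
    refine iff_of_false ?_ (not_not.2 ((hc x.edge).1 ⟨v, hx' ▸ hv⟩))
    rintro ⟨y, w, hw, h⟩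
    obtain rfl := target_unique hx hw
    simp [not_isLinkPair_concl hv] at h

/-- The orientation of the relation `∼` in which positive atoms point upwards and negative atoms
point downwards. -/
def Succ (π : ProofStructure 𝕏) (x y : π.Atom) : Prop :=
  (x.sign = true ∧ π.Up x y) ∨ (x.sign = false ∧ π.Down x y)

/-- Read backwards, the signs exchange their roles: the predecessor of a positive atom is found
below, that of a negative atom above. Statements on predecessors thus reduce to `Up` and `Down` as
well. -/
theorem succ_iff {x y : π.Atom} :
    π.Succ x y ↔ (y.sign = false ∧ π.Up y x) ∨ (y.sign = true ∧ π.Down y x) := by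
  constructor
  · rintro (⟨hx, h⟩ | ⟨hx, h⟩)
    · rcases h.symm with ⟨hy, h⟩ | ⟨hy, h⟩ <;> simp_all
    · rcases h.symm with ⟨hy, h⟩ | ⟨hy, h⟩ <;> simp_all
  · rintro (⟨hx, h⟩ | ⟨hx, h⟩)
    · rcases h.symm with ⟨hy, h⟩ | ⟨hy, h⟩ <;> simp_all [Succ]
    · rcases h.symm with ⟨hy, h⟩ | ⟨hy, h⟩ <;> simp_all [Succ]

theorem Succ.unique {x y z : π.Atom} (h : π.Succ x y) (h' : π.Succ x z) : y = z := by
  rcases h with ⟨hx, h⟩ | ⟨hx, h⟩ <;> rcases h' with ⟨hx', h'⟩ | ⟨hx', h'⟩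
  · exact h.unique h'
  · simp_all
  · simp_all
  · exact h.unique h'

theorem Succ.unique' {x y z : π.Atom} (h : π.Succ x z) (h' : π.Succ y z) : x = y := by
  rw [succ_iff] at h h'
  rcases h with ⟨hx, h⟩ | ⟨hx, h⟩ <;> rcases h' with ⟨hx', h'⟩ | ⟨hx', h'⟩
  · exact h.unique h'
  · simp_all
  · simp_all
  · exact h.unique h'

theorem sim_iff_succ {x y : π.Atom} : π.Sim x y ↔ π.Succ x y ∨ π.Succ y x := by
  rw [sim_iff_up_or_down, Succ, succ_iff]
  cases x.sign <;> simp [or_comm]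

/-- A partner above always exists, so a successor can be missing only for a negative atom that
cannot go down. -/
theorem exists_succ_iff {c : π.E} (hc : π.HasSingleConclusion c) (x : π.Atom) :
    (∃ y, π.Succ x y) ↔ ¬ (x.edge = c ∧ x.sign = false) := by
  have h1 := exists_up x
  have h2 := exists_down_iff hc x
  cases hx : x.sign <;> simp_all [Succ]

theorem exists_pred_iff {c : π.E} (hc : π.HasSingleConclusion c) (x : π.Atom) :
    (∃ y, π.Succ y x) ↔ ¬ (x.edge = c ∧ x.sign = true) := by
  have h1 := exists_up x
  have h2 := exists_down_iff hc x
  cases hx : x.sign <;> simp_all [succ_iff]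

/-- The family of values given by a function on atoms that is compatible with `∼` is an
experiment. -/
theorem isExperiment_ofFn {h : π.Atom → Bool} (hh : ∀ x y, π.Sim x y → h x = h y) :
    IsExperiment π.label π.node fun e => List.ofFn fun i => h ⟨e, i⟩ := by
  refine ⟨fun e => by simp, fun v => ?_⟩
  have dual : ∀ e e', (π.node v = .ax e e' ∨ π.node v = .cut e e') →
      (List.ofFn fun i => h ⟨e', i⟩) = (List.ofFn fun i => h ⟨e, i⟩).reverse := by
    intro e e' hv
    have hlen : (π.label e').orientedAtoms.length = (π.label e).orientedAtoms.length := by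
      simpa using congrArg List.length (orientedAtoms_dual hv)
    refine List.ext_getElem (by simpa using hlen) fun i hi hi' => ?_
    simp only [List.length_ofFn, List.length_reverse] at hi hi'
    simp only [List.getElem_ofFn, List.getElem_reverse, List.length_ofFn]
    refine (hh _ _ ⟨v, Or.inl ?_⟩).symm
    rcases hv with hv | hv
    · exact (isLinkPair_ax hv _ _).2 ⟨rfl, rfl, by dsimp only; omega⟩
    · exact (isLinkPair_cut hv _ _).2 ⟨rfl, rfl, by dsimp only; omega⟩
  have binary : ∀ l r c, (π.node v = .tensor l r c ∨ π.node v = .par l r c) →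
      (List.ofFn fun i => h ⟨c, i⟩) =
        (List.ofFn fun i => h ⟨l, i⟩) ++ List.ofFn fun i => h ⟨r, i⟩ := by
    intro l r c hv
    have hlen := congrArg List.length (orientedAtoms_binary hv)
    rw [List.length_append] at hlen
    refine List.ext_getElem (by simpa using hlen) fun i hi hi' => ?_
    simp only [List.length_ofFn] at hi
    rw [List.getElem_append]
    simp only [List.getElem_ofFn, List.length_ofFn]
    split_ifs with hlt
    · exact (hh ⟨l, i, hlt⟩ ⟨c, i, hi⟩ ⟨v, Or.inl ((isLinkPair_binary hv _ _).2
        ⟨rfl, Or.inl ⟨rfl, rfl⟩⟩)⟩).symm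
    · refine (hh _ _ ⟨v, Or.inl ((isLinkPair_binary hv _ _).2 ⟨rfl, Or.inr ⟨rfl, ?_⟩⟩)⟩).symm
      dsimp only; omega
  rcases hv : π.node v with ⟨e, e'⟩ | ⟨e, e'⟩ | ⟨l, r, c⟩ | ⟨l, r, c⟩ | e
  · exact dual e e' (Or.inl hv)
  · exact dual e e' (Or.inr hv)
  · exact binary l r c (Or.inl hv)
  · exact binary l r c (Or.inr hv)
  · trivial

/-- A function on the atoms of a proof net that is compatible with `∼` is determined by its values
on the atoms of the conclusion. -/
theorem IsProofNet.eq_of_sim_invariant (hπ : π.IsProofNet) {c : π.E}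
    (hc : π.HasSingleConclusion c) {h h' : π.Atom → Bool} (hh : ∀ x y, π.Sim x y → h x = h y)
    (hh' : ∀ x y, π.Sim x y → h' x = h' y) (heq : ∀ x, x.edge = c → h x = h' x) : h = h' := by
  have := hπ.experiment_ext hc (isExperiment_ofFn hh) (isExperiment_ofFn hh') (by
    simp only [List.ofFn_inj]
    exact funext fun i => heq _ rfl)
  funext x
  have := congrFun this x.edge
  rw [List.ofFn_inj] at this
  exact congrFun this x.idx

/-- The relation `Succ` has no cycles. -/
theorem IsProofNet.succ_acyclic (hπ : π.IsProofNet) {c : π.E} (hc : π.HasSingleConclusion c)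
    (x : π.Atom) : ¬ Relation.TransGen π.Succ x x := by
  intro hx
  classical
  -- The set of atoms reachable from `x` is the cycle. It is closed under predecessors too, because
  -- `Succ` is injective and `x` itself has a predecessor in it.
  have hfwd : ∀ y z, π.Succ y z → Relation.ReflTransGen π.Succ x y →
      Relation.ReflTransGen π.Succ x z := fun y z h hy => hy.tail h
  have hbwd : ∀ y z, π.Succ y z → Relation.ReflTransGen π.Succ x z →
      Relation.ReflTransGen π.Succ x y := by
    intro y z h hz
    have hz' : Relation.TransGen π.Succ x z := by
      rcases Relation.reflTransGen_iff_eq_or_transGen.1 hz with rfl | hz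
      · exact hx
      · exact hz
    obtain ⟨w, hw, hwz⟩ := Relation.TransGen.tail'_iff.1 hz'
    rwa [h.unique' hwz]
  -- The indicator function of the cycle and the zero function are both compatible with `∼`. They
  -- agree on `c`, because an atom on the cycle has a predecessor and a successor while an atom of
  -- `c` lacks one of them. So they are equal, which is false at `x`.
  have key := hπ.eq_of_sim_invariant hc
    (h := fun y => decide (Relation.ReflTransGen π.Succ x y)) (h' := fun _ => false)
    (by
      intro y z h
      rw [decide_eq_decide]
      rcases sim_iff_succ.1 h with h | h
      · exact ⟨hfwd y z h, hbwd y z h⟩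
      · exact ⟨hbwd z y h, hfwd z y h⟩)
    (fun _ _ _ => rfl)
    (by
      intro y hy
      rw [decide_eq_false_iff_not]
      intro hxy
      have hxy' : Relation.TransGen π.Succ x y := by
        rcases Relation.reflTransGen_iff_eq_or_transGen.1 hxy with rfl | h
        · exact hx
        · exact h
      obtain ⟨w, -, hw⟩ := Relation.TransGen.tail'_iff.1 hxy'
      have hyx : Relation.TransGen π.Succ y x := by
        clear hxy' hw hy
        induction hxy with
        | refl => exact hx
        | tail _ h ih =>
          obtain ⟨z, hz, hzx⟩ := Relation.TransGen.head'_iff.1 ih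
          rw [h.unique hz]
          exact Relation.TransGen.trans_right hzx hx
      obtain ⟨z, hz, -⟩ := Relation.TransGen.head'_iff.1 hyx
      have h1 := (exists_pred_iff hc y).1 ⟨w, hw⟩
      have h2 := (exists_succ_iff hc y).1 ⟨z, hz⟩
      cases hs : y.sign <;> simp_all)
  have := congrFun key x
  simp at this
  exact this Relation.ReflTransGen.refl

end ProofStructure

/-! ## Acyclic partial injections -/

/-- In an acyclic partial injection on a finite type, each point is reachable from a unique point
without predecessor. -/
theorem Relation.existsUnique_root {α : Type*} [Finite α] {R : α → α → Prop}
    (hR : ∀ x y z, R x z → R y z → x = y) (hac : ∀ x, ¬ Relation.TransGen R x x) (x : α) :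
    ∃! u, (∀ y, ¬ R y u) ∧ Relation.ReflTransGen R u x := by
  have : Std.Irrefl (Relation.TransGen R) := ⟨hac⟩
  have : IsTrans α (Relation.TransGen R) := ⟨fun _ _ _ => Relation.TransGen.trans⟩
  refine existsUnique_of_exists_of_unique ?_ ?_
  · induction x using (Finite.wellFounded_of_trans_of_irrefl (Relation.TransGen R)).induction with
    | _ x ih =>
    by_cases h : ∃ y, R y x
    · obtain ⟨y, hy⟩ := h
      obtain ⟨u, hu, huy⟩ := ih y (Relation.TransGen.single hy)
      exact ⟨u, hu, huy.tail hy⟩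
    · exact ⟨x, not_exists.1 h, Relation.ReflTransGen.refl⟩
  · have key : ∀ u u' : α, (∀ y, ¬ R y u) → Relation.ReflTransGen R u' u → u' = u := by
      intro u u' hu h
      rcases Relation.ReflTransGen.cases_tail h with h | ⟨z, -, hz⟩
      · exact h.symm
      · exact absurd hz (hu z)
    rintro u u' ⟨hu, hux⟩ ⟨hu', hux'⟩
    -- Backwards the relation is a partial function, so of two backward walks from `x` one continues
    -- the other; but a walk cannot be continued beyond a root.
    rcases Relation.ReflTransGen.total_of_right_unique (r := Function.swap R)
      (fun _ _ _ h h' => hR _ _ _ h h') (Relation.reflTransGen_swap.2 hux)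
      (Relation.reflTransGen_swap.2 hux') with h | h
    · exact (key _ _ hu (Relation.reflTransGen_swap.1 h)).symm
    · exact key _ _ hu' (Relation.reflTransGen_swap.1 h)

/-- The paths of an acyclic partial injection match the points without predecessor with the points
without successor. -/
theorem Relation.exists_equiv_ends {α : Type*} [Finite α] {R : α → α → Prop}
    (hR : ∀ x y z, R x z → R y z → x = y) (hR' : ∀ x y z, R x y → R x z → y = z)
    (hac : ∀ x, ¬ Relation.TransGen R x x) {P Q : α → Prop} (hP : ∀ x, P x ↔ ∀ y, ¬ R y x)
    (hQ : ∀ x, Q x ↔ ∀ y, ¬ R x y) :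
    ∃ e : {x // P x} ≃ {x // Q x}, ∀ u, Relation.ReflTransGen R u.1 (e u).1 := by
  have hroot := Relation.existsUnique_root hR hac
  have htail := Relation.existsUnique_root (R := Function.swap R) (fun x y z h h' => hR' _ _ _ h h')
    (fun x h => hac x (Relation.transGen_swap.1 h))
  simp only [Relation.reflTransGen_swap, ← hP] at hroot htail
  choose f hf using fun x => (htail x).exists
  have hf1 : ∀ x, Q (f x) := fun x => (hQ _).2 (hf x).1
  refine ⟨Equiv.ofBijective (fun u => ⟨f u.1, hf1 u.1⟩) ⟨?_, ?_⟩, fun u => (hf u.1).2⟩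
  · intro u u' h
    have h' : f u.1 = f u'.1 := congrArg Subtype.val h
    exact Subtype.ext ((hroot (f u.1)).unique ⟨u.2, (hf u.1).2⟩ ⟨u'.2, h' ▸ (hf u'.1).2⟩)
  · intro v
    obtain ⟨u, hu, huv⟩ := (hroot v.1).exists
    exact ⟨⟨u, hu⟩, Subtype.ext ((htail u).unique (hf u) ⟨(hQ _).1 v.2, huv⟩)⟩

/-! ### The permutation given by the paths -/

namespace ProofStructure

variable {𝕏 : Type*} {π : ProofStructure 𝕏}

theorem exists_isSubseqOfSign (c : π.E) (s : Bool) :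
    ∃ (m : ℕ) (U : Fin m → π.Boundary c), π.IsSubseqOfSign c U s := by
  classical
  let S : Finset (Fin (π.label c).orientedAtoms.length) :=
    Finset.univ.filter fun i => Atom.sign (π := π) ⟨c, i⟩ = s
  refine ⟨S.card, fun i => ⟨⟨c, S.orderEmbOfFin rfl i⟩, rfl⟩, fun i j h => ?_, ?_⟩
  · exact (S.orderEmbOfFin rfl).strictMono h
  · rintro ⟨⟨e, i⟩, rfl⟩
    have hr := Set.ext_iff.1 (S.range_orderEmbOfFin rfl) i
    rw [Finset.mem_coe, Finset.mem_filter] at hr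
    simp only [Finset.mem_univ, true_and] at hr
    rw [← hr]
    constructor
    · rintro ⟨j, hj⟩
      refine ⟨j, ?_⟩
      have := congrArg (fun x : π.Boundary e => x.1) hj
      rw [Atom.mk.injEq] at this
      simpa using this
    · rintro ⟨j, hj⟩
      exact ⟨j, Subtype.ext (Atom.ext_val rfl (congrArg Fin.val hj))⟩

theorem IsSubseqOfSign.injective {c : π.E} {m : ℕ} {U : Fin m → π.Boundary c} {s : Bool}
    (h : π.IsSubseqOfSign c U s) : Function.Injective U := fun _ _ hij =>
  h.1.injective (congrArg (fun x : π.Boundary c => x.1.idx.val) hij)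

/-- The atoms of the conclusion of sign `s`. -/
noncomputable def IsSubseqOfSign.equiv {c : π.E} {m : ℕ} {U : Fin m → π.Boundary c} {s : Bool}
    (h : π.IsSubseqOfSign c U s) : Fin m ≃ {x : π.Atom // x.edge = c ∧ x.sign = s} :=
  Equiv.ofBijective (fun i => ⟨(U i).1, (U i).2, (h.2 _).1 ⟨i, rfl⟩⟩)
    ⟨fun i j hij => h.injective (Subtype.ext (by simpa using hij)), fun x => by
      obtain ⟨i, hi⟩ := (h.2 ⟨x.1, x.2.1⟩).2 x.2.2
      exact ⟨i, Subtype.ext (congrArg (fun x : π.Boundary c => x.1) hi)⟩⟩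

/-- The atoms of the conclusion of a proof net are matched by the paths of `∼`. -/
theorem IsProofNet.exists_matching (hπ : π.IsProofNet) {c : π.E} (hc : π.HasSingleConclusion c) :
    ∃ (m : ℕ) (U V : Fin m → π.Boundary c) (σ : Equiv.Perm (Fin m)),
      π.IsSubseqOfSign c U true ∧ π.IsSubseqOfSign c V false ∧
      ∀ i, Relation.ReflTransGen π.Succ (U i).1 (V (σ i)).1 := by
  obtain ⟨m, U, hU⟩ := exists_isSubseqOfSign c true
  obtain ⟨m', V, hV⟩ := exists_isSubseqOfSign c false
  obtain ⟨e, he⟩ := Relation.exists_equiv_ends (R := π.Succ)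
    (P := fun x => x.edge = c ∧ x.sign = true) (Q := fun x => x.edge = c ∧ x.sign = false)
    (fun _ _ _ h h' => h.unique' h') (fun _ _ _ h h' => h.unique h') (hπ.succ_acyclic hc)
    (fun x => by rw [← not_exists, exists_pred_iff hc, not_not])
    (fun x => by rw [← not_exists, exists_succ_iff hc, not_not])
  let σ := (hU.equiv.trans e).trans hV.equiv.symm
  -- The bijection along the paths shows that there are as many positive as negative atoms.
  obtain rfl : m = m' := by simpa using Fintype.card_congr σ
  refine ⟨m, U, V, σ, hU, hV, fun i => ?_⟩
  have h1 := he (hU.equiv i)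
  rwa [show e (hU.equiv i) = hV.equiv (σ i) by simp [σ]] at h1

/-- The number of the path of `∼` on which an atom lies. -/
theorem IsProofNet.exists_component (hπ : π.IsProofNet) {c : π.E} (hc : π.HasSingleConclusion c)
    {m : ℕ} {U : Fin m → π.Boundary c} (hU : π.IsSubseqOfSign c U true) :
    ∃ p : π.Atom → Fin m, (∀ i x, Relation.ReflTransGen π.Succ (U i).1 x → p x = i) ∧
      (∀ x, Relation.ReflTransGen π.Succ (U (p x)).1 x) ∧ ∀ x y, π.Succ x y → p x = p y := by
  have hroot := Relation.existsUnique_root (R := π.Succ)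
    (fun _ _ _ h h' => h.unique' h') (hπ.succ_acyclic hc)
  simp only [← not_exists, exists_pred_iff hc, not_not] at hroot
  have hex : ∀ x, ∃ i, Relation.ReflTransGen π.Succ (U i).1 x := by
    intro x
    obtain ⟨u, ⟨hu, hu'⟩, hux⟩ := (hroot x).exists
    obtain ⟨i, hi⟩ := (hU.2 ⟨u, hu⟩).2 hu'
    exact ⟨i, by rwa [hi]⟩
  choose p hp using hex
  have hend : ∀ i, (U i).1.edge = c ∧ (U i).1.sign = true := fun i =>
    ⟨(U i).2, (hU.2 _).1 ⟨i, rfl⟩⟩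
  have hun : ∀ i x, Relation.ReflTransGen π.Succ (U i).1 x → p x = i := fun i x h =>
    hU.injective (Subtype.ext ((hroot x).unique (And.intro (hend _) (hp x))
      (And.intro (hend i) h)))
  exact ⟨p, hun, hp, fun x y h => (hun _ _ ((hp x).tail h)).symm⟩

/-! ### The coordinate ring -/

section CoordRing

variable {k : Type*} [Field k]

theorem toCoordRing_X {ι : Type*} (x : ι → π.Atom) (i : ι) :
    π.toCoordRing k x (MvPolynomial.X i) = Ideal.Quotient.mk _ (MvPolynomial.X (x i)) := by
  simp [toCoordRing]

theorem mk_X_eq_of_sim {x y : π.Atom} (h : π.Sim x y) :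
    Ideal.Quotient.mk (π.ideal k) (MvPolynomial.X x) =
      Ideal.Quotient.mk (π.ideal k) (MvPolynomial.X y) := by
  obtain ⟨v, h | h⟩ := h
  · exact Ideal.Quotient.eq.2 (Ideal.subset_span ⟨v, x, y, h, rfl⟩)
  · exact Eq.symm (Ideal.Quotient.eq.2 (Ideal.subset_span ⟨v, y, x, h, rfl⟩))

theorem mk_X_eq_of_reflTransGen {x y : π.Atom} (h : Relation.ReflTransGen π.Succ x y) :
    Ideal.Quotient.mk (π.ideal k) (MvPolynomial.X x) =
      Ideal.Quotient.mk (π.ideal k) (MvPolynomial.X y) := by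
  induction h with
  | refl => rfl
  | tail _ h ih => exact ih.trans (mk_X_eq_of_sim (sim_iff_succ.2 (Or.inl h)))

/-- A system of representatives of the components of `∼` gives coordinates. -/
theorem bijective_toCoordRing {ι : Type*} {x : ι → π.Atom} {p : π.Atom → ι}
    (hpx : ∀ i, p (x i) = i) (hp : ∀ a b, π.Sim a b → p a = p b)
    (hx : ∀ a, Ideal.Quotient.mk (π.ideal k) (MvPolynomial.X (x (p a))) =
      Ideal.Quotient.mk (π.ideal k) (MvPolynomial.X a)) :
    Function.Bijective (π.toCoordRing k x) := by
  constructor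
  -- Renaming each atom to its component annihilates the generators, so it descends to the quotient
  -- and gives a left inverse.
  · have hker : ∀ f ∈ π.ideal k, MvPolynomial.rename (R := k) p f = 0 := by
      intro f hf
      suffices h : π.ideal k ≤ RingHom.ker (MvPolynomial.rename (R := k) p) from h hf
      refine Ideal.span_le.2 ?_
      rintro _ ⟨v, a, b, h, rfl⟩
      simp [RingHom.mem_ker, hp a b ⟨v, Or.inl h⟩]
    refine Function.LeftInverse.injective (g := Ideal.Quotient.liftₐ (π.ideal k)
      (MvPolynomial.rename (R := k) p) hker) fun f => ?_
    have : (MvPolynomial.rename (R := k) p) (MvPolynomial.rename x f) = f := by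
      rw [MvPolynomial.rename_rename, show p ∘ x = id from funext hpx, MvPolynomial.rename_id_apply]
    exact this
  · intro y
    obtain ⟨f, rfl⟩ := Ideal.Quotient.mk_surjective y
    refine ⟨MvPolynomial.rename p f, ?_⟩
    -- In the quotient each atom equals the representative of its component, so the projection from
    -- `P_π` factors through the renaming by `p`.
    have h : ((π.toCoordRing k x).comp (MvPolynomial.rename p)) =
        Ideal.Quotient.mkₐ k (π.ideal k) := by
      refine MvPolynomial.algHom_ext fun a => ?_
      rw [AlgHom.comp_apply, MvPolynomial.rename_X, toCoordRing_X]
      exact hx a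
    exact DFunLike.congr_fun h f

end CoordRing

end ProofStructure

/-! ### Lexicographic orders -/

section LexOrder

variable {σ : Type*} [LinearOrder σ] [Finite σ]

/-- Because of the dual order in `lexOrder`, the deciding variable is the largest one at which the
exponents differ. -/
theorem lexOrder_lt_iff {a b : σ →₀ ℕ} : (lexOrder σ).toSyn a < (lexOrder σ).toSyn b ↔
    ∃ j, (∀ i, j < i → a i = b i) ∧ a j < b j :=
  Iff.rfl

theorem lexOrder_single_lt {x y : σ} (h : x < y) :
    (lexOrder σ).toSyn (Finsupp.single x 1) < (lexOrder σ).toSyn (Finsupp.single y 1) := by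
  classical
  refine lexOrder_lt_iff.2 ⟨y, fun i hi => ?_, ?_⟩
  · simp [hi.ne, (h.trans hi).ne]
  · simp [h.ne]

variable {k : Type*} [Field k]

open MvPolynomial

theorem lexOrder_toSyn_degree_X_lt {x y : σ} (h : x < y) :
    (lexOrder σ).toSyn ((lexOrder σ).degree (X x : MvPolynomial σ k)) <
      (lexOrder σ).toSyn ((lexOrder σ).degree (X y : MvPolynomial σ k)) := by
  simpa only [MonomialOrder.degree_X] using lexOrder_single_lt h

theorem degree_X_sub_X {x y : σ} (h : x < y) :
    (lexOrder σ).degree (X y - X x : MvPolynomial σ k) = Finsupp.single y 1 := by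
  rw [MonomialOrder.degree_sub_of_lt (lexOrder_toSyn_degree_X_lt h), MonomialOrder.degree_X]

theorem leadingCoeff_X_sub_X {x y : σ} (h : x < y) :
    (lexOrder σ).leadingCoeff (X y - X x : MvPolynomial σ k) = 1 := by
  rw [MonomialOrder.leadingCoeff_sub_of_lt (lexOrder_toSyn_degree_X_lt h),
    MonomialOrder.leadingCoeff_X]

end LexOrder

/-! ### A Gröbner basis of the boundary ideal -/

namespace ProofStructure

variable {𝕏 : Type*} {π : ProofStructure 𝕏} {k : Type*} [Field k]

open MvPolynomial in
-- This is elimination. If the leading monomial of `f` in the ideal contains some `U i`, the leading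
-- term of a generator divides it. Otherwise no monomial of `f` contains a `U i`, these variables
-- being larger than all `V j`; so `f` lies in `k[V]`, where the map to the quotient is injective,
-- and `f = 0`.
theorem isGroebnerBasis_boundary [LinearOrder π.Atom] {c : π.E} {ι ι' : Type*} [Finite ι]
    {U : ι → π.Boundary c} {V : ι' → π.Boundary c} {σ : ι → ι'}
    (hUV : ∀ x, x ∈ Set.range U ∨ x ∈ Set.range V) (hV : Function.Injective V)
    (hlt : ∀ i j, (V i).1 < (U j).1)
    (hinj : Function.Injective (π.toCoordRing k fun i => (V i).1))
    (hσ : ∀ i, Ideal.Quotient.mk (π.ideal k) (X (U i).1) =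
      Ideal.Quotient.mk (π.ideal k) (X (V (σ i)).1)) :
    IsGroebnerBasis (lexOrder (π.Boundary c)) (Set.range fun i => X (U i) - X (V (σ i)))
      (π.boundaryIdeal k c) := by
  have hsub : (Set.range fun i => X (U i) - X (V (σ i))) ⊆
      (π.boundaryIdeal k c : Set (MvPolynomial (π.Boundary c) k)) := by
    rintro _ ⟨i, rfl⟩
    simp only [SetLike.mem_coe, boundaryIdeal, RingHom.mem_ker, map_sub, toCoordRing_X, hσ,
      sub_self]
  refine ⟨Set.finite_range _, hsub, le_antisymm (Ideal.span_mono (Set.image_mono hsub)) ?_⟩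
  refine Ideal.span_le.2 ?_
  rintro _ ⟨f, hf, rfl⟩
  have hlt' : ∀ i j, V i < U j := hlt
  by_cases hd : ∃ i, (lexOrder (π.Boundary c)).degree f (U i) ≠ 0
  · obtain ⟨i, hi⟩ := hd
    have h1 : (lexOrder (π.Boundary c)).leadingTerm (X (U i) - X (V (σ i)) : MvPolynomial _ k) =
        X (U i) := by
      rw [MonomialOrder.leadingTerm, degree_X_sub_X (hlt' _ _), leadingCoeff_X_sub_X (hlt' _ _)]
      rfl
    have h2 : X (U i) ∣ (lexOrder (π.Boundary c)).leadingTerm f := by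
      rw [MonomialOrder.leadingTerm, X_dvd_monomial]
      exact Or.inr hi
    exact Ideal.mem_of_dvd _ h2 (Ideal.subset_span ⟨_, ⟨i, rfl⟩, h1⟩)
  · push Not at hd
    have hsupp : ∀ m ∈ f.support, ∀ i, m (U i) = 0 := by
      intro m hm i
      by_contra hne
      have hle := (lexOrder (π.Boundary c)).le_degree hm
      rcases hle.eq_or_lt with h | h
      · rw [(lexOrder (π.Boundary c)).toSyn.injective h] at hne
        exact hne (hd i)
      -- The deciding variable is not among the `U`, whose exponents in the leading monomial vanish.
      -- So it is some `V l`, and above it, in particular at every `U i`, the exponents agree.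
      · obtain ⟨j, hj, hj'⟩ := lexOrder_lt_iff.1 h
        rcases hUV j with ⟨l, rfl⟩ | ⟨l, rfl⟩
        · rw [hd l] at hj'
          omega
        · exact hne ((hj _ (hlt' l i)).trans (hd i))
    obtain ⟨g, rfl⟩ := exists_rename_eq_of_vars_subset_range f V hV (by
      intro x hx
      obtain ⟨m, hm, hmx⟩ := (mem_vars_iff_mem_support x).1 hx
      refine (hUV x).resolve_left ?_
      rintro ⟨i, rfl⟩
      exact (Finsupp.mem_support_iff.1 hmx) (hsupp m hm i))
    have hg : π.toCoordRing k (fun i => (V i).1) g = 0 := by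
      have : π.toCoordRing k (fun x : π.Boundary c => x.1) (rename V g) = 0 := hf
      rw [← this, toCoordRing, toCoordRing, AlgHom.comp_apply, AlgHom.comp_apply, rename_rename]
      rfl
    rw [hinj (hg.trans (map_zero _).symm)]
    simp

end ProofStructure

/-! ## Systems of paths -/

/-- The relation `R` is the successor relation of a system of paths with initial points `P` and
terminal points `Q`, together with isolated points; it is contained in the relation `T`. -/
structure IsPathSystem {α : Type*} (T : α → α → Prop) (P Q : α → Prop) (R : α → α → Prop) :
    Prop where
  rel : ∀ {x y}, R x y → T x y
  right_unique : ∀ {x y z}, R x y → R x z → y = z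
  left_unique : ∀ {x y z}, R x z → R y z → x = y
  not_left : ∀ {x y}, R x y → ¬ P y
  not_right : ∀ {x y}, R x y → ¬ Q x
  exists_succ : ∀ {x y}, R x y → ¬ Q y → ∃ z, R y z
  exists_pred : ∀ {x y}, R x y → ¬ P x → ∃ z, R z x
  exists_succ_of_left : ∀ {x}, P x → ∃ y, R x y

/-- The points `x` and `y` are neighbours. -/
def Adjacent {α : Type*} (R : α → α → Prop) (x y : α) : Prop := R x y ∨ R y x

theorem Adjacent.symm {α : Type*} {R : α → α → Prop} {x y : α} (h : Adjacent R x y) :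
    Adjacent R y x := Or.symm h

/-- Take the point `z` out of a system of paths. -/
def contract {α : Type*} (R : α → α → Prop) (z : α) (x y : α) : Prop :=
  (R x y ∧ x ≠ z ∧ y ≠ z) ∨ (R x z ∧ R z y)

namespace IsPathSystem

variable {α : Type*} {T : α → α → Prop} {P Q : α → Prop} {R : α → α → Prop}

/-- Two distinct neighbours cannot both be predecessors or both be successors, so the path passes
through `z` from one of them to the other. -/
theorem rel_of_adjacent (h : IsPathSystem T P Q R) {x y z : α} (hx : Adjacent R x z)
    (hy : Adjacent R y z) (hxy : x ≠ y) : (R x z ∧ R z y) ∨ (R y z ∧ R z x) := by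
  rcases hx with hx | hx <;> rcases hy with hy | hy
  · exact absurd (h.left_unique hx hy) hxy
  · exact Or.inl ⟨hx, hy⟩
  · exact Or.inr ⟨hy, hx⟩
  · exact absurd (h.right_unique hx hy) hxy

theorem eq_or_eq_of_adjacent (h : IsPathSystem T P Q R) {x y z w : α} (hx : Adjacent R x z)
    (hy : Adjacent R y z) (hxy : x ≠ y) (hw : Adjacent R w z) : w = x ∨ w = y := by
  by_contra! hne
  rcases h.rel_of_adjacent hx hy hxy with ⟨h1, h2⟩ | ⟨h1, h2⟩ <;> rcases hw with hw | hw
  · exact hne.1 (h.left_unique hw h1)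
  · exact hne.2 (h.right_unique hw h2)
  · exact hne.2 (h.left_unique hw h1)
  · exact hne.1 (h.right_unique hw h2)

/-- Roofs see the order of the variables but not the direction of the path; hence this symmetric
form of the contraction. -/
theorem adjacent_contract_iff (h : IsPathSystem T P Q R) {x y z : α} (hx : Adjacent R x z)
    (hy : Adjacent R y z) (hxy : x ≠ y) {a b : α} :
    Adjacent (_root_.contract R z) a b ↔
      (Adjacent R a b ∧ a ≠ z ∧ b ≠ z) ∨ (a = x ∧ b = y) ∨ (a = y ∧ b = x) := by
  have key : ∀ x y, R x z → R z y → (Adjacent (_root_.contract R z) a b ↔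
      (Adjacent R a b ∧ a ≠ z ∧ b ≠ z) ∨ (a = x ∧ b = y) ∨ (a = y ∧ b = x)) := by
    intro x y h1 h2
    constructor
    · rintro ((⟨h3, h4, h5⟩ | ⟨h3, h4⟩) | (⟨h3, h4, h5⟩ | ⟨h3, h4⟩))
      · exact Or.inl ⟨Or.inl h3, h4, h5⟩
      · exact Or.inr (Or.inl ⟨h.left_unique h3 h1, h.right_unique h4 h2⟩)
      · exact Or.inl ⟨Or.inr h3, h5, h4⟩
      · exact Or.inr (Or.inr ⟨h.right_unique h4 h2, h.left_unique h3 h1⟩)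
    · rintro (⟨h3 | h3, h4, h5⟩ | ⟨rfl, rfl⟩ | ⟨rfl, rfl⟩)
      · exact Or.inl (Or.inl ⟨h3, h4, h5⟩)
      · exact Or.inr (Or.inl ⟨h3, h5, h4⟩)
      · exact Or.inl (Or.inr ⟨h1, h2⟩)
      · exact Or.inr (Or.inr ⟨h1, h2⟩)
  rcases h.rel_of_adjacent hx hy hxy with ⟨h1, h2⟩ | ⟨h1, h2⟩
  · exact key x y h1 h2
  · rw [key y x h1 h2, or_comm (a := a = y ∧ b = x)]

variable [IsStrictOrder α T]

theorem ne (h : IsPathSystem T P Q R) {x y : α} (hxy : R x y) : x ≠ y := by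
  rintro rfl
  exact irrefl x (h.rel hxy)

/-- Taking out a point that is no end of a path joins its neighbours. Transitivity of `T` keeps the
new step inside `T`, and the ends are untouched. -/
theorem contract (h : IsPathSystem T P Q R) (z : α) (hP : ¬ P z) (hQ : ¬ Q z) :
    IsPathSystem T P Q (contract R z) where
  rel := by
    rintro x y (⟨h1, -⟩ | ⟨h1, h2⟩)
    · exact h.rel h1
    · exact _root_.trans (h.rel h1) (h.rel h2)
  right_unique := by
    rintro x y w (⟨h1, h2, h3⟩ | ⟨h1, h2⟩) (⟨h1', h2', h3'⟩ | ⟨h1', h2'⟩)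
    · exact h.right_unique h1 h1'
    · exact absurd (h.right_unique h1 h1') h3
    · exact absurd (h.right_unique h1' h1) h3'
    · exact h.right_unique h2 h2'
  left_unique := by
    rintro x y w (⟨h1, h2, h3⟩ | ⟨h1, h2⟩) (⟨h1', h2', h3'⟩ | ⟨h1', h2'⟩)
    · exact h.left_unique h1 h1'
    · exact absurd (h.left_unique h1 h2') h2
    · exact absurd (h.left_unique h1' h2) h2'
    · exact h.left_unique h1 h1'
  not_left := by
    rintro x y (⟨h1, -⟩ | ⟨-, h1⟩) <;> exact h.not_left h1
  not_right := by
    rintro x y (⟨h1, -⟩ | ⟨h1, -⟩) <;> exact h.not_right h1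
  exists_succ := by
    -- If the old successor is `z`, the new one is the successor of `z`, which exists because `z` is
    -- not terminal.
    have key : ∀ y, y ≠ z → (∃ w, R y w) → ∃ w, _root_.contract R z y w := by
      rintro y hy ⟨w, hw⟩
      by_cases hwz : w = z
      · subst hwz
        obtain ⟨v, hv⟩ := h.exists_succ hw hQ
        exact ⟨v, Or.inr ⟨hw, hv⟩⟩
      · exact ⟨w, Or.inl ⟨hw, hy, hwz⟩⟩
    rintro x y (⟨h1, -, h2⟩ | ⟨-, h1⟩) hy
    · exact key y h2 (h.exists_succ h1 hy)
    · exact key y (h.ne h1).symm (h.exists_succ h1 hy)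
  exists_pred := by
    have key : ∀ y, y ≠ z → (∃ w, R w y) → ∃ w, _root_.contract R z w y := by
      rintro y hy ⟨w, hw⟩
      by_cases hwz : w = z
      · subst hwz
        obtain ⟨v, hv⟩ := h.exists_pred hw hP
        exact ⟨v, Or.inr ⟨hv, hw⟩⟩
      · exact ⟨w, Or.inl ⟨hw, hwz, hy⟩⟩
    rintro x y (⟨h1, h2, -⟩ | ⟨h1, -⟩) hx
    · exact key x h2 (h.exists_pred h1 hx)
    · exact key x (h.ne h1) (h.exists_pred h1 hx)
  exists_succ_of_left := by
    intro x hx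
    obtain ⟨y, hy⟩ := h.exists_succ_of_left hx
    by_cases hyz : y = z
    · subst hyz
      obtain ⟨w, hw⟩ := h.exists_succ hy hQ
      exact ⟨w, Or.inr ⟨hy, hw⟩⟩
    · exact ⟨y, Or.inl ⟨hy, fun hxz => hP (hxz ▸ hx), hyz⟩⟩

/-- Otherwise some point would have two successors, or the path would close up, contrary to `T`
being a strict order. It follows that the base of a live roof is not already a live edge. -/
theorem not_adjacent (h : IsPathSystem T P Q R) {x y z : α} (hx : Adjacent R x z)
    (hy : Adjacent R y z) (hxy : x ≠ y) : ¬ Adjacent R x y := by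
  have key : ∀ x y, R x z → R z y → ¬ Adjacent R x y := by
    rintro x y h1 h2 (h3 | h3)
    · exact h.ne h2 (h.right_unique h1 h3)
    · exact irrefl x (_root_.trans (h.rel h1) (_root_.trans (h.rel h2) (h.rel h3)))
  rcases h.rel_of_adjacent hx hy hxy with ⟨h1, h2⟩ | ⟨h1, h2⟩
  · exact key x y h1 h2
  · exact fun h3 => key y x h1 h2 h3.symm

end IsPathSystem

/-! ## The Falling Roofs algorithm on a system of paths -/

namespace Edge

variable {α : Type*}

@[simp] theorem src_mk (x y : α) : (mk x y).src = x := rfl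

@[simp] theorem tgt_mk (x y : α) : (mk x y).tgt = y := rfl

@[simp] theorem mk_src_tgt (e : Edge α) : mk e.src e.tgt = e := rfl

theorem ext_iff' {e f : Edge α} : e = f ↔ e.src = f.src ∧ e.tgt = f.tgt :=
  ⟨by rintro rfl; exact ⟨rfl, rfl⟩, fun h => by
    rw [← mk_src_tgt e, ← mk_src_tgt f, h.1, h.2]⟩

theorem lt_iff [LinearOrder α] {e f : Edge α} :
    e < f ↔ e.tgt < f.tgt ∨ e.tgt = f.tgt ∧ e.src < f.src :=
  Prod.Lex.lt_iff

theorem IsRoof.lt [LinearOrder α] {e f : Edge α} (h : e.IsRoof f) : e < f :=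
  lt_iff.2 (Or.inr h)

end Edge

namespace RoofState

variable {α : Type*} [LinearOrder α] {N : RoofState α} {d e e' : Edge α}

theorem mem_roofsFrom : e ∈ N.roofsFrom d ↔ e ∈ N.live ∧ d ∈ N.live ∧ d.IsRoof e := by
  classical
  exact Finset.mem_filter

theorem mem_roofsTo : e ∈ N.roofsTo d ↔ e ∈ N.live ∧ d ∈ N.live ∧ e.IsRoof d := by
  classical
  exact Finset.mem_filter

theorem mem_liveRoofs :
    toLex (e, e') ∈ N.liveRoofs ↔ e ∈ N.live ∧ e' ∈ N.live ∧ e.IsRoof e' := by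
  classical
  rw [liveRoofs, Finset.mem_map_equiv, Finset.mem_filter, Finset.mem_product, and_assoc]
  rfl

end RoofState

/-- The live edges `L` form the system of paths `R`, the targets of the other edges in `E` are
isolated, and `E` contains the given edges `S`. -/
structure RoofInv {α : Type*} [LinearOrder α] (T : α → α → Prop) (P Q : α → Prop)
    (S : Finset (Edge α)) (R : α → α → Prop) (E L : Finset (Edge α)) : Prop where
  path : IsPathSystem T P Q R
  mem_live : ∀ e, e ∈ L ↔ e.src < e.tgt ∧ Adjacent R e.src e.tgt
  live_sub : L ⊆ E
  dead : ∀ e ∈ E, e ∉ L → ∀ y, ¬ Adjacent R e.tgt y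
  init_sub : S ⊆ E
  lt : ∀ e ∈ E, e.src < e.tgt

namespace RoofInv

variable {α : Type*} [LinearOrder α] {T : α → α → Prop} {P Q : α → Prop} {S : Finset (Edge α)}
  {R : α → α → Prop} {E L : Finset (Edge α)}

/-- A dead edge ends at an isolated point, which the target of a live edge is not. -/
theorem mem_live_of_tgt_eq (h : RoofInv T P Q S R E L) {d e : Edge α} (hd : d ∈ L) (he : e ∈ E)
    (hde : e.tgt = d.tgt) : e ∈ L := by
  by_contra hel
  exact h.dead e he hel d.src (hde ▸ ((h.mem_live d).1 hd).2.symm)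

/-- This serves for the removal of `d` in the inner loop, when `d` has just died. -/
theorem erase (h : RoofInv T P Q S R E L) {d : Edge α} (hd : d ∉ L) (hdS : d ∉ S) :
    RoofInv T P Q S R (E.erase d) L where
  path := h.path
  mem_live := h.mem_live
  live_sub := fun _ he => Finset.mem_erase.2 ⟨fun hed => hd (hed ▸ he), h.live_sub he⟩
  dead := fun e he => h.dead e (Finset.mem_of_mem_erase he)
  init_sub := fun _ he => Finset.mem_erase.2 ⟨fun hed => hdS (hed ▸ he), h.init_sub he⟩
  lt := fun e he => h.lt e (Finset.mem_of_mem_erase he)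

/-- The roof uses up both neighbours of its peak, and all edges ending there are live. -/
theorem eq_or_eq_of_tgt_eq (h : RoofInv T P Q S R E L) {e e' f : Edge α} (he : e ∈ L)
    (he' : e' ∈ L) (hr : e.IsRoof e') (hf : f ∈ E) (hfe : f.tgt = e.tgt) : f = e ∨ f = e' := by
  have hfL := h.mem_live_of_tgt_eq he hf hfe
  have h1 := ((h.mem_live e).1 he).2
  have h2 := ((h.mem_live e').1 he').2
  have h3 := ((h.mem_live f).1 hfL).2
  rw [← hr.1] at h2
  rw [hfe] at h3
  rcases h.path.eq_or_eq_of_adjacent h1 h2 hr.2.ne h3 with h4 | h4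
  · exact Or.inl (Edge.ext_iff'.2 ⟨h4, hfe⟩)
  · exact Or.inr (Edge.ext_iff'.2 ⟨h4, hfe.trans hr.1⟩)

variable [IsStrictOrder α T]

/-- The base of a live roof is a new edge. -/
theorem base_notMem (h : RoofInv T P Q S R E L) {e e' : Edge α} (he : e ∈ L) (he' : e' ∈ L)
    (hr : e.IsRoof e') : Edge.mk e.src e'.src ∉ E := by
  have h1 := ((h.mem_live e).1 he).2
  have h2 := ((h.mem_live e').1 he').2
  rw [← hr.1] at h2
  intro hd
  by_cases hdL : Edge.mk e.src e'.src ∈ L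
  · exact h.path.not_adjacent h1 h2 hr.2.ne ((h.mem_live _).1 hdL).2
  · exact h.dead _ hd hdL _ h2

/-- Replacing a live roof by its base. -/
theorem contract (h : RoofInv T P Q S R E L) {e e' : Edge α} (he : e ∈ L) (he' : e' ∈ L)
    (hr : e.IsRoof e') :
    RoofInv T P Q S (contract R e.tgt) (insert (Edge.mk e.src e'.src) E)
      (insert (Edge.mk e.src e'.src) ((L.erase e).erase e')) := by
  have h1 := ((h.mem_live e).1 he).2
  have h2 := ((h.mem_live e').1 he').2
  rw [← hr.1] at h2
  have hne := hr.2.ne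
  have hz : ¬ P e.tgt ∧ ¬ Q e.tgt := by
    rcases h.path.rel_of_adjacent h1 h2 hne with ⟨h3, h4⟩ | ⟨h3, h4⟩ <;>
      exact ⟨h.path.not_left h3, h.path.not_right h4⟩
  have hdis : ∀ f ∈ E, f.tgt = e.tgt → f = e ∨ f = e' := fun f hf hfe =>
    h.eq_or_eq_of_tgt_eq he he' hr hf hfe
  refine ⟨h.path.contract _ hz.1 hz.2, ?_, ?_, ?_, ?_, ?_⟩
  · intro f
    rw [h.path.adjacent_contract_iff h1 h2 hne, Finset.mem_insert, Finset.mem_erase,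
      Finset.mem_erase, h.mem_live]
    constructor
    · rintro (rfl | ⟨hf', hf, hlt, hadj⟩)
      · exact ⟨hr.2, Or.inr (Or.inl ⟨rfl, rfl⟩)⟩
      · refine ⟨hlt, Or.inl ⟨hadj, ?_, ?_⟩⟩
        -- An edge whose source is the peak would lead up from it, but both neighbours of the peak
        -- are below it.
        · intro hfs
          rw [hfs] at hadj hlt
          rcases h.path.eq_or_eq_of_adjacent h1 h2 hne hadj.symm with h3 | h3 <;> rw [h3] at hlt
          · exact lt_asymm hlt ((h.mem_live e).1 he).1
          · exact lt_asymm hlt (hr.1 ▸ ((h.mem_live e').1 he').1)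
        · intro hft
          rcases hdis f (h.live_sub ((h.mem_live f).2 ⟨hlt, hadj⟩)) hft with h3 | h3
          · exact hf h3
          · exact hf' h3
    · rintro ⟨hlt, ⟨hadj, h3, h4⟩ | ⟨h3, h4⟩ | ⟨h3, h4⟩⟩
      · refine Or.inr ⟨?_, ?_, hlt, hadj⟩
        · rintro rfl; exact h4 hr.1.symm
        · rintro rfl; exact h4 rfl
      · exact Or.inl (Edge.ext_iff'.2 ⟨h3, h4⟩)
      · rw [h3, h4] at hlt
        exact absurd hlt hr.2.not_gt
  · intro f hf
    rcases Finset.mem_insert.1 hf with rfl | hf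
    · exact Finset.mem_insert_self _ _
    · exact Finset.mem_insert_of_mem
        (h.live_sub (Finset.mem_of_mem_erase (Finset.mem_of_mem_erase hf)))
  · intro f hf hfL y
    rw [h.path.adjacent_contract_iff h1 h2 hne]
    rw [Finset.mem_insert, not_or] at hfL
    have hfE := (Finset.mem_insert.1 hf).resolve_left hfL.1
    -- An edge that has just died ends at the peak, now isolated. One that was dead before ends at a
    -- point without neighbours, and contraction gives it none.
    by_cases hfl : f ∈ L
    · have hft : f.tgt = e.tgt := by
        by_cases hfe : f = e
        · rw [hfe]
        · by_cases hfe' : f = e'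
          · rw [hfe', hr.1]
          · exact absurd (Finset.mem_erase.2 ⟨hfe', Finset.mem_erase.2 ⟨hfe, hfl⟩⟩) hfL.2
      rw [hft]
      rintro (⟨-, h3, -⟩ | ⟨h3, -⟩ | ⟨h3, -⟩)
      · exact h3 rfl
      · exact ((h.mem_live e).1 he).1.ne' h3
      · exact ((h.mem_live e').1 he').1.ne' (hr.1 ▸ h3)
    · have h3 := h.dead f hfE hfl
      rintro (⟨h4, -⟩ | ⟨h4, -⟩ | ⟨h4, -⟩)
      · exact h3 _ h4
      · exact h3 _ (h4 ▸ h1)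
      · exact h3 _ (h4 ▸ h2)
  · exact fun f hf => Finset.mem_insert_of_mem (h.init_sub hf)
  · intro f hf
    rcases Finset.mem_insert.1 hf with rfl | hf
    · exact hr.2
    · exact h.lt f hf

theorem mem_contract_iff (h : RoofInv T P Q S R E L) {e e' f : Edge α} (he : e ∈ L) (he' : e' ∈ L)
    (hr : e.IsRoof e') (hf : f ∈ E) :
    f ∈ insert (Edge.mk e.src e'.src) ((L.erase e).erase e') ↔ f ∈ L ∧ f.tgt ≠ e.tgt := by
  have hd := h.base_notMem he he' hr
  have h1 : f ≠ Edge.mk e.src e'.src := fun hfd => hd (hfd ▸ hf)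
  rw [Finset.mem_insert, Finset.mem_erase, Finset.mem_erase]
  constructor
  · rintro (h2 | ⟨h2, h3, h4⟩)
    · exact absurd h2 h1
    · refine ⟨h4, fun h5 => ?_⟩
      rcases h.eq_or_eq_of_tgt_eq he he' hr hf h5 with h6 | h6
      · exact h3 h6
      · exact h2 h6
  · rintro ⟨h2, h3⟩
    refine Or.inr ⟨?_, ?_, h2⟩
    · rintro rfl; exact h3 hr.1.symm
    · rintro rfl; exact h3 rfl

/-- Two live edges are lost and one is gained; this decrease makes both loops terminate. -/
theorem card_contract (h : RoofInv T P Q S R E L) {e e' : Edge α} (he : e ∈ L) (he' : e' ∈ L)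
    (hr : e.IsRoof e') :
    (insert (Edge.mk e.src e'.src) ((L.erase e).erase e')).card < L.card := by
  have hd : Edge.mk e.src e'.src ∉ (L.erase e).erase e' := fun hd => h.base_notMem he he' hr
    (h.live_sub (Finset.mem_of_mem_erase (Finset.mem_of_mem_erase hd)))
  have h1 : e' ∈ L.erase e := Finset.mem_erase.2 ⟨hr.lt.ne', he'⟩
  rw [Finset.card_insert_of_notMem hd, Finset.card_erase_of_mem h1, Finset.card_erase_of_mem he]
  have := Finset.card_pos.2 ⟨_, h1⟩
  rw [Finset.card_erase_of_mem he] at this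
  omega

/-- One step of the inner loop: `d` is replaced by the base `d'` of its roof, if there is one. -/
theorem step_some {d : Edge α} (hd : d ∉ E) (hdL : d ∈ L) (hSE : S ⊆ E)
    (h : RoofInv T P Q S R (insert d E) L) :
    (RoofState.step ⟨insert d E, L, some d⟩ = some ⟨insert d E, L, none⟩ ∧
      ∀ f ∈ E, f.tgt ≠ d.tgt) ∨
    ∃ e d' L' R', e ∈ E ∧ e.tgt = d.tgt ∧ (∀ f ∈ E, f.tgt = d.tgt → f = e) ∧
      ((d.src < e.src ∧ d' = Edge.mk d.src e.src) ∨ (e.src < d.src ∧ d' = Edge.mk e.src d.src)) ∧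
      d' ∉ E ∧ d' ∈ L' ∧ L'.card < L.card ∧
      (∀ f ∈ E, f ∈ L' ↔ f ∈ L ∧ f.tgt ≠ d.tgt) ∧
      RoofState.step ⟨insert d E, L, some d⟩ = some ⟨insert d' E, L', some d'⟩ ∧
      RoofInv T P Q S R' (insert d' E) L' := by
  have hdS : d ∉ S := fun hs => hd (hSE hs)
  have hdE : d ∈ insert d E := Finset.mem_insert_self d E
  -- The base is added before `d` is removed; the net effect is to replace `d` by `d'` over the
  -- unchanged set `E`.
  have hset : ∀ d', d' ∉ insert d E → (insert d' (insert d E)).erase d = insert d' E := by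
    intro d' hd'
    ext f
    simp only [Finset.mem_erase, Finset.mem_insert]
    constructor
    · rintro ⟨h1, h2 | h2 | h2⟩
      · exact Or.inl h2
      · exact absurd h2 h1
      · exact Or.inr h2
    · rintro (h2 | h2)
      · exact ⟨fun h3 => hd' (h2 ▸ h3 ▸ hdE), Or.inl h2⟩
      · exact ⟨fun h3 => hd (h3 ▸ h2), Or.inr (Or.inr h2)⟩
  have hstate : ∀ e d' : Edge α, d' ∉ insert d E →
      ((((⟨insert d E, L, some d⟩ : RoofState α).kill e).add d').remove d) =
        ⟨insert d' E, insert d' ((L.erase e).erase d), some d⟩ := by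
    intro e d' hd'
    have h1 : d' ≠ d := fun h1 => hd' (h1 ▸ hdE)
    simp only [RoofState.kill, RoofState.add, RoofState.remove, hd', if_false]
    rw [hset d' hd', Finset.erase_insert_of_ne h1]
  by_cases h1 : (RoofState.roofsFrom ⟨insert d E, L, some d⟩ d).Nonempty
  · right
    -- Which partner is chosen does not matter: no other edge of `E` has the target of `d`.
    obtain ⟨e, he, hstep⟩ : ∃ e ∈ RoofState.roofsFrom ⟨insert d E, L, some d⟩ d,
        RoofState.step ⟨insert d E, L, some d⟩ =
          some { (((⟨insert d E, L, some d⟩ : RoofState α).kill e).add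
            (Edge.mk d.src e.src)).remove d with cur := some (Edge.mk d.src e.src) } :=
      ⟨_, Finset.min'_mem _ h1, dif_pos h1⟩
    rw [RoofState.mem_roofsFrom] at he
    obtain ⟨heL, -, hr⟩ := he
    have hne : e ≠ d := hr.lt.ne'
    have hnew := h.base_notMem hdL heL hr
    refine ⟨e, Edge.mk d.src e.src, insert (Edge.mk d.src e.src) ((L.erase d).erase e),
      _root_.contract R d.tgt,
      Finset.mem_of_mem_insert_of_ne (h.live_sub heL) hne, hr.1.symm, ?_, Or.inl ⟨hr.2, rfl⟩,
      fun hm => hnew (Finset.mem_insert_of_mem hm), Finset.mem_insert_self _ _,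
      h.card_contract hdL heL hr,
      fun f hf => h.mem_contract_iff hdL heL hr (Finset.mem_insert_of_mem hf), ?_, ?_⟩
    · intro f hf hft
      refine (h.eq_or_eq_of_tgt_eq hdL heL hr (Finset.mem_insert_of_mem hf) hft).resolve_left ?_
      rintro rfl
      exact hd hf
    · rw [hstep, hstate e _ hnew, Finset.erase_right_comm]
    · rw [← hset _ hnew]
      refine (h.contract hdL heL hr).erase ?_ hdS
      rw [h.mem_contract_iff hdL heL hr hdE]
      simp
  · by_cases h2 : (RoofState.roofsTo ⟨insert d E, L, some d⟩ d).Nonempty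
    · right
      obtain ⟨e, he, hstep⟩ : ∃ e ∈ RoofState.roofsTo ⟨insert d E, L, some d⟩ d,
          RoofState.step ⟨insert d E, L, some d⟩ =
            some { (((⟨insert d E, L, some d⟩ : RoofState α).kill e).add
              (Edge.mk e.src d.src)).remove d with cur := some (Edge.mk e.src d.src) } :=
        ⟨_, Finset.min'_mem _ h2, (dif_neg h1).trans (dif_pos h2)⟩
      rw [RoofState.mem_roofsTo] at he
      obtain ⟨heL, -, hr⟩ := he
      have hne : e ≠ d := hr.lt.ne
      have hnew := h.base_notMem heL hdL hr
      refine ⟨e, Edge.mk e.src d.src, insert (Edge.mk e.src d.src) ((L.erase e).erase d),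
        _root_.contract R e.tgt,
        Finset.mem_of_mem_insert_of_ne (h.live_sub heL) hne, hr.1, ?_, Or.inr ⟨hr.2, rfl⟩,
        fun hm => hnew (Finset.mem_insert_of_mem hm), Finset.mem_insert_self _ _,
        h.card_contract heL hdL hr,
        fun f hf => hr.1 ▸ h.mem_contract_iff heL hdL hr (Finset.mem_insert_of_mem hf), ?_, ?_⟩
      · intro f hf hft
        refine (h.eq_or_eq_of_tgt_eq heL hdL hr (Finset.mem_insert_of_mem hf)
          (hft.trans hr.1.symm)).resolve_right ?_
        rintro rfl
        exact hd hf
      · rw [hstep, hstate e _ hnew]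
      · rw [← hset _ hnew]
        refine (h.contract heL hdL hr).erase ?_ hdS
        rw [h.mem_contract_iff heL hdL hr hdE, hr.1]
        simp
    · left
      -- An edge of `E` with the target of `d` would be live and, since it differs from `d`, would
      -- form a roof with it on one side or the other.
      refine ⟨(dif_neg h1).trans (dif_neg h2), fun f hf hft => ?_⟩
      have hfL := h.mem_live_of_tgt_eq hdL (Finset.mem_insert_of_mem hf) hft
      rcases lt_trichotomy f.src d.src with h3 | h3 | h3
      · exact h2 ⟨f, RoofState.mem_roofsTo.2 ⟨hfL, hdL, hft, h3⟩⟩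
      · exact hd (Edge.ext_iff'.2 ⟨h3, hft⟩ ▸ hf)
      · exact h1 ⟨f, RoofState.mem_roofsFrom.2 ⟨hfL, hdL, hft.symm, h3⟩⟩

/-- If there are no live roofs, the live edges connect the ends of the paths. -/
theorem mem_live_iff_of_no_roof [Finite α] (h : RoofInv T P Q S R E L)
    (hno : ∀ e ∈ L, ∀ e' ∈ L, ¬ e.IsRoof e') (hPQ : ∀ x y, Q x → P y → x < y)
    (hlow : ∀ x y, P x ∨ Q x → ¬ P y → ¬ Q y → x < y) (e : Edge α) :
    e ∈ L ↔ Q e.src ∧ P e.tgt ∧ R e.tgt e.src := by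
  -- The largest interior point that still has neighbours would be the peak of a live roof, because
  -- ends of paths lie below all interior points and so both of its neighbours are smaller.
  have hint : ∀ z y, Adjacent R z y → P z ∨ Q z := by
    by_contra! hcon
    obtain ⟨z, ⟨y, hy, hz, hz'⟩, hmax⟩ := Set.Finite.exists_maximal
      (Set.toFinite {z | ∃ y, Adjacent R z y ∧ ¬ P z ∧ ¬ Q z}) hcon
    have hle : ∀ w, Adjacent R w z → w < z := by
      intro w hw
      by_cases hPQw : P w ∨ Q w
      · exact hlow w z hPQw hz hz'
      · rw [not_or] at hPQw
        have hne : w ≠ z := by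
          rintro rfl
          rcases hw with hw | hw <;> exact h.path.ne hw rfl
        rcases lt_or_ge w z with h1 | h1
        · exact h1
        · exact absurd (le_antisymm (hmax ⟨z, hw, hPQw⟩ h1) h1) hne
    have hxy : ∃ x y, R x z ∧ R z y := by
      rcases hy with hy | hy
      · obtain ⟨x, hx⟩ := h.path.exists_pred hy hz
        exact ⟨x, y, hx, hy⟩
      · obtain ⟨x, hx⟩ := h.path.exists_succ hy hz'
        exact ⟨y, x, hy, hx⟩
    obtain ⟨x, y, hx, hy⟩ := hxy
    have h1 : Edge.mk x z ∈ L := (h.mem_live _).2 ⟨hle x (Or.inl hx), Or.inl hx⟩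
    have h2 : Edge.mk y z ∈ L := (h.mem_live _).2 ⟨hle y (Or.inr hy), Or.inr hy⟩
    rcases lt_trichotomy x y with h3 | h3 | h3
    · exact hno _ h1 _ h2 ⟨rfl, h3⟩
    · subst h3
      exact irrefl x (_root_.trans (h.path.rel hx) (h.path.rel hy))
    · exact hno _ h2 _ h1 ⟨rfl, h3⟩
  have hends : ∀ x y, R x y → P x ∧ Q y := fun x y hxy =>
    ⟨(hint x y (Or.inl hxy)).resolve_right (h.path.not_right hxy),
      (hint y x (Or.inr hxy)).resolve_left (h.path.not_left hxy)⟩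
  rw [h.mem_live]
  constructor
  · rintro ⟨hlt, hr | hr⟩
    · exact absurd hlt (hPQ _ _ (hends _ _ hr).2 (hends _ _ hr).1).not_gt
    · exact ⟨(hends _ _ hr).2, (hends _ _ hr).1, hr⟩
  · rintro ⟨h1, h2, h3⟩
    exact ⟨hPQ _ _ h1 h2, Or.inr h3⟩

end RoofInv

/-! ## Division with early stopping by the polynomials of edges -/

theorem Finsupp.single_one_le_single_one_iff {σ : Type*} {x y : σ} :
    (Finsupp.single x 1 : σ →₀ ℕ) ≤ Finsupp.single y 1 ↔ x = y := by
  classical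
  constructor
  · intro h
    by_contra hne
    have := h x
    simp [Ne.symm hne] at this
  · rintro rfl; exact le_rfl

section Division

open MvPolynomial

variable {σ k : Type*} [Field k]

theorem divES_of_forall_not_lTDvd {M : MonomialOrder σ} {G : List (MvPolynomial σ k)}
    {p : MvPolynomial σ k} (h : ∀ f ∈ G, ¬ LTDvd M f p) : divES M G p = p := by
  classical
  rw [divES]
  split_ifs with hp
  · exact hp.symm
  · split
    · rfl
    · rename_i f hf
      exact absurd (by simpa using List.find?_some hf) (h f (List.mem_of_find?_eq_some hf))

/-- When only one polynomial can cancel the leading term, the order of the sequence of divisors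
plays no role. -/
theorem divES_of_lTDvd {M : MonomialOrder σ} {G : List (MvPolynomial σ k)} {p f : MvPolynomial σ k}
    (hp : p ≠ 0) (hf : f ∈ G) (hdvd : LTDvd M f p) (hun : ∀ g ∈ G, LTDvd M g p → g = f) :
    divES M G p = divES M G (cancelLT M p f) := by
  classical
  rw [divES, dif_neg hp]
  split
  · rename_i hn
    exact absurd hdvd (by simpa using List.find?_eq_none.1 hn f hf)
  · rename_i g hg
    rw [hun g (List.mem_of_find?_eq_some hg) (by simpa using List.find?_some hg)]

variable [LinearOrder σ] [Finite σ] {d e : Edge σ}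

namespace Edge

theorem degree_smul_poly (hd : d.src < d.tgt) {c : k} (hc : c ≠ 0) :
    (lexOrder σ).degree (c • d.poly k) = Finsupp.single d.tgt 1 := by
  rw [MonomialOrder.degree_smul_of_isRegular (IsRegular.of_ne_zero hc), poly, degree_X_sub_X hd]

theorem leadingCoeff_smul_poly (hd : d.src < d.tgt) {c : k} (hc : c ≠ 0) :
    (lexOrder σ).leadingCoeff (c • d.poly k) = c := by
  have h := leadingCoeff_X_sub_X (k := k) hd
  rw [MonomialOrder.leadingCoeff, degree_X_sub_X hd] at h
  rw [MonomialOrder.leadingCoeff, degree_smul_poly hd hc, coeff_smul, poly, h, smul_eq_mul, mul_one]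

theorem degree_poly (hd : d.src < d.tgt) :
    (lexOrder σ).degree (d.poly k) = Finsupp.single d.tgt 1 :=
  degree_X_sub_X hd

theorem leadingCoeff_poly (hd : d.src < d.tgt) : (lexOrder σ).leadingCoeff (d.poly k) = 1 :=
  leadingCoeff_X_sub_X hd

theorem poly_ne_zero (hd : d.src < d.tgt) : d.poly k ≠ 0 := by
  intro h
  have := leadingCoeff_poly (k := k) hd
  rw [h, MonomialOrder.leadingCoeff_zero] at this
  exact zero_ne_one this

theorem lTDvd_iff (hd : d.src < d.tgt) (he : e.src < e.tgt) {c : k} (hc : c ≠ 0) :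
    LTDvd (lexOrder σ) (e.poly k) (c • d.poly k) ↔ e.tgt = d.tgt := by
  rw [LTDvd, degree_smul_poly hd hc, degree_poly he, Finsupp.single_one_le_single_one_iff]
  exact and_iff_right (poly_ne_zero he)

/-- The common target cancels; if the sources differ, what remains is up to sign a multiple of the
polynomial of the base. -/
theorem cancelLT_smul_poly (hd : d.src < d.tgt) (he : e.src < e.tgt) {c : k} (hc : c ≠ 0)
    (h : e.tgt = d.tgt) :
    cancelLT (lexOrder σ) (c • d.poly k) (e.poly k) = c • (X e.src - X d.src) := by
  rw [cancelLT, degree_smul_poly hd hc, degree_poly he, leadingCoeff_smul_poly hd hc,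
    leadingCoeff_poly he, h, tsub_self, div_one, ← C_apply, ← smul_eq_C_mul, ← smul_sub, poly, poly,
    h, sub_sub_sub_cancel_left]

theorem sPoly_poly (hd : d.src < d.tgt) (he : e.src < e.tgt) (h : d.tgt = e.tgt) :
    sPoly (lexOrder σ) (d.poly k) (e.poly k) = (mk d.src e.src).poly k := by
  rw [sPoly, degree_poly he, degree_poly hd, leadingCoeff_poly hd, leadingCoeff_poly he, h,
    sup_idem, tsub_self, inv_one, ← C_apply, C_1, one_mul, one_mul, poly, poly, poly, h,
    sub_sub_sub_cancel_left]
  rfl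

end Edge

end Division

namespace RoofInv

variable {α : Type*} [LinearOrder α] [Finite α] {T : α → α → Prop} [IsStrictOrder α T]
  {P Q : α → Prop} {S : Finset (Edge α)} {k : Type*} [Field k] {G : List (MvPolynomial α k)}

/-- The inner loop of the Falling Roofs algorithm computes the division with early stopping. -/
theorem exists_reaches_none {E : Finset (Edge α)} (hSE : S ⊆ E)
    (hG : ∀ f, f ∈ G ↔ ∃ e ∈ E, e.poly k = f) :
    ∀ (n : ℕ) {R : α → α → Prop} {L : Finset (Edge α)} {d : Edge α} {c : k}, L.card = n →
      d ∉ E → d ∈ L → RoofInv T P Q S R (insert d E) L → c ≠ 0 →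
      ∃ d' L' R', ∃ c' : k, StateTransition.Reaches RoofState.step ⟨insert d E, L, some d⟩
          ⟨insert d' E, L', none⟩ ∧ d' ∉ E ∧ RoofInv T P Q S R' (insert d' E) L' ∧
        (∀ f ∈ E, f.tgt ≠ d'.tgt) ∧ L'.card ≤ L.card ∧
        (∀ f ∈ E, ∀ g ∈ E, f ≠ g → f.tgt = g.tgt → (f ∈ L' ↔ f ∈ L)) ∧
        divES (lexOrder α) G (c • d.poly k) = c' • d'.poly k ∧ c' ≠ 0 := by
  intro n
  -- The edge `d` stays outside `E`: it stands for the polynomial being divided, while `G` lists the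
  -- divisors and remains fixed. The scalar `c` absorbs the signs.
  induction n using Nat.strong_induction_on with
  | _ n ih =>
  intro R L d c hn hd hdL h hc
  have hdlt := h.lt d (Finset.mem_insert_self _ _)
  have hElt : ∀ f ∈ E, f.src < f.tgt := fun f hf => h.lt f (Finset.mem_insert_of_mem hf)
  rcases h.step_some hd hdL hSE with ⟨hstep, hno⟩ |
    ⟨e, d₁, L₁, R₁, heE, het, heu, hd₁, hd₁E, hd₁L, hcard, hL₁, hstep, h₁⟩
  · refine ⟨d, L, R, c, Relation.ReflTransGen.single hstep, hd, h, hno, le_rfl,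
      fun _ _ _ _ _ _ => Iff.rfl, divES_of_forall_not_lTDvd ?_, hc⟩
    intro f hf
    obtain ⟨e, he, rfl⟩ := (hG f).1 hf
    rw [Edge.lTDvd_iff hdlt (hElt e he) hc]
    exact hno e he
  · have hc₁ : ∃ c₁ : k, c₁ ≠ 0 ∧
        cancelLT (lexOrder α) (c • d.poly k) (e.poly k) = c₁ • d₁.poly k := by
      rw [Edge.cancelLT_smul_poly hdlt (hElt e heE) hc het]
      rcases hd₁ with ⟨-, rfl⟩ | ⟨-, rfl⟩
      · exact ⟨c, hc, rfl⟩
      -- Here the partner has the smaller source, so the cancellation yields minus the polynomial of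
      -- the base.
      · refine ⟨-c, neg_ne_zero.2 hc, ?_⟩
        rw [neg_smul, ← smul_neg, Edge.poly, neg_sub, Edge.src_mk, Edge.tgt_mk]
    obtain ⟨c₁, hc₁, hcancel⟩ := hc₁
    obtain ⟨d', L', R', c', hreach, hd', h', hno, hcard', hL', hdiv, hc'⟩ :=
      ih L₁.card (hn ▸ hcard) rfl hd₁E hd₁L h₁ hc₁
    refine ⟨d', L', R', c', Relation.ReflTransGen.head hstep hreach, hd', h', hno,
      hcard'.trans hcard.le, ?_, ?_, hc'⟩
    · intro f hf g hg hfg hfgt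
      -- The old edge killed in this step is the only edge of `E` with its target, so edges that
      -- share a target in `E` keep their status.
      rw [hL' f hf g hg hfg hfgt, hL₁ f hf]
      refine and_iff_left fun hft => hfg ?_
      rw [heu f hf hft, heu g hg (hfgt ▸ hft)]
    · rw [divES_of_lTDvd (f := e.poly k), hcancel, hdiv]
      · exact smul_ne_zero hc (Edge.poly_ne_zero hdlt)
      · exact (hG _).2 ⟨e, heE, rfl⟩
      · exact (Edge.lTDvd_iff hdlt (hElt e heE) hc).2 het
      · intro g hg hdvd
        obtain ⟨f, hf, rfl⟩ := (hG g).1 hg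
        rw [heu f hf ((Edge.lTDvd_iff hdlt (hElt f hf) hc).1 hdvd)]

end RoofInv

/-! ## Simulation of Buchberger's algorithm -/

/-- The edges in the list `l` are those of a state of the Falling Roofs algorithm, and the set `B`
of pairs of indices contains the live roofs and no other roofs. -/
structure BuchbergerInv {α : Type*} [LinearOrder α] (S E L : Finset (Edge α)) (l : List (Edge α))
    (B : Finset (ℕ ×ₗ ℕ)) : Prop where
  nodup : l.Nodup
  mem : ∀ e, e ∈ l ↔ e ∈ E
  init : S.sort <+: l
  lt : ∀ i j, toLex (i, j) ∈ B → i < j ∧ j < l.length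
  tgt : ∀ e ∈ E, ∀ e' ∈ E, e ≠ e' → e.tgt = e'.tgt → e ∈ S ∧ e' ∈ S
  live : ∀ i j (hi : i < l.length) (hj : j < l.length), l[i].IsRoof l[j] →
    (toLex (i, j) ∈ B ↔ l[i] ∈ L ∧ l[j] ∈ L)

namespace BuchbergerInv

variable {α : Type*} [LinearOrder α] {S E L : Finset (Edge α)} {l : List (Edge α)}
  {B : Finset (ℕ ×ₗ ℕ)}

theorem lt_card (h : BuchbergerInv S E L l B) {i : ℕ} (hi : i < l.length) (hS : l[i] ∈ S) :
    i < S.card := by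
  obtain ⟨j, hj, hji⟩ := List.getElem_of_mem ((Finset.mem_sort (· ≤ ·)).2 hS)
  have h1 := List.prefix_iff_getElem?.1 h.init j hj
  rw [hji] at h1
  obtain ⟨hj', h2⟩ := List.getElem?_eq_some_iff.1 h1
  obtain rfl := (h.nodup.getElem_inj_iff).1 h2
  rwa [Finset.length_sort] at hj

/-- Original edges occupy the sorted initial segment of the list. By the field `tgt`, every roof
consists of such edges. -/
theorem getElem_lt_iff (h : BuchbergerInv S E L l B) {i j : ℕ} (hi : i < l.length)
    (hj : j < l.length) (hiS : l[i] ∈ S) (hjS : l[j] ∈ S) : l[i] < l[j] ↔ i < j := by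
  have hi' := h.lt_card hi hiS
  have hj' := h.lt_card hj hjS
  rw [← Finset.length_sort (· ≤ ·)] at hi' hj'
  have h1 := List.prefix_iff_getElem?.1 h.init i hi'
  have h2 := List.prefix_iff_getElem?.1 h.init j hj'
  rw [List.getElem?_eq_getElem hi] at h1
  rw [List.getElem?_eq_getElem hj] at h2
  rw [Option.some.inj h1, Option.some.inj h2]
  exact (S.sortedLT_sort.strictMono_get).lt_iff_lt (a := ⟨i, hi'⟩) (b := ⟨j, hj'⟩)

theorem mem_init_of_tgt_eq (h : BuchbergerInv S E L l B) {i j : ℕ} (hi : i < l.length)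
    (hj : j < l.length) (hij : i ≠ j) (ht : l[i].tgt = l[j].tgt) : l[i] ∈ S ∧ l[j] ∈ S :=
  h.tgt _ ((h.mem _).1 (List.getElem_mem hi)) _ ((h.mem _).1 (List.getElem_mem hj))
    (fun he => hij (h.nodup.getElem_inj_iff.1 he)) ht

/-- The pairs of indices of edges with a common target, in increasing order, are the roofs. -/
theorem isRoof_iff (h : BuchbergerInv S E L l B) {i j : ℕ} (hi : i < l.length)
    (hj : j < l.length) : l[i].IsRoof l[j] ↔ i < j ∧ l[i].tgt = l[j].tgt := by
  constructor
  · intro hr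
    have hij : i ≠ j := by rintro rfl; exact hr.2.false
    obtain ⟨h1, h2⟩ := h.mem_init_of_tgt_eq hi hj hij hr.1
    exact ⟨(h.getElem_lt_iff hi hj h1 h2).1 hr.lt, hr.1⟩
  · rintro ⟨hij, ht⟩
    obtain ⟨h1, h2⟩ := h.mem_init_of_tgt_eq hi hj hij.ne ht
    have := (h.getElem_lt_iff hi hj h1 h2).2 hij
    rw [Edge.lt_iff, ht] at this
    exact ⟨ht, (this.resolve_left (lt_irrefl _)).2⟩

/-- The first live roof corresponds to the first pair in `B`, if that is a roof. -/
theorem min'_liveRoofs (h : BuchbergerInv S E L l B) (hLE : L ⊆ E) {i j : ℕ} (hi : i < l.length)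
    (hj : j < l.length) (hr : l[i].IsRoof l[j]) (hB : toLex (i, j) ∈ B)
    (hmin : ∀ p ∈ B, toLex (i, j) ≤ p) :
    ∃ hne : (RoofState.liveRoofs ⟨E, L, none⟩).Nonempty,
      (RoofState.liveRoofs ⟨E, L, none⟩).min' hne = toLex (l[i], l[j]) := by
  have hmem : toLex (l[i], l[j]) ∈ RoofState.liveRoofs ⟨E, L, none⟩ :=
    RoofState.mem_liveRoofs.2
      ⟨((h.live i j hi hj hr).1 hB).1, ((h.live i j hi hj hr).1 hB).2, hr⟩
  refine ⟨⟨_, hmem⟩, le_antisymm (Finset.min'_le _ _ hmem) (Finset.le_min' _ _ _ ?_)⟩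
  intro y hy
  obtain ⟨⟨e, e'⟩, rfl⟩ : ∃ p, toLex p = y := ⟨ofLex y, rfl⟩
  obtain ⟨he, he', hr'⟩ := RoofState.mem_liveRoofs.1 hy
  obtain ⟨a, ha, rfl⟩ := List.getElem_of_mem ((h.mem e).2 (hLE he))
  obtain ⟨b, hb, rfl⟩ := List.getElem_of_mem ((h.mem e').2 (hLE he'))
  have hab := hmin _ ((h.live a b ha hb hr').2 ⟨he, he'⟩)
  have h1 := h.mem_init_of_tgt_eq hi hj ((h.isRoof_iff hi hj).1 hr).1.ne hr.1
  have h2 := h.mem_init_of_tgt_eq ha hb ((h.isRoof_iff ha hb).1 hr').1.ne hr'.1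
  rw [Prod.Lex.toLex_le_toLex] at hab ⊢
  simp only at hab ⊢
  -- All four edges are original, so pairs of indices and roofs compare in the same way.
  rw [h.getElem_lt_iff hi ha h1.1 h2.1, h.nodup.getElem_inj_iff, ← not_lt (a := l[b]),
    h.getElem_lt_iff hb hj h2.2 h1.2, not_lt]
  exact hab

theorem erase (h : BuchbergerInv S E L l B) {p : ℕ ×ₗ ℕ}
    (hp : ∀ i j (hi : i < l.length) (hj : j < l.length), p = toLex (i, j) → ¬ l[i].IsRoof l[j]) :
    BuchbergerInv S E L l (B.erase p) where
  nodup := h.nodup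
  mem := h.mem
  init := h.init
  lt := fun i j hij => h.lt i j (Finset.mem_of_mem_erase hij)
  tgt := h.tgt
  live := fun i j hi hj hr => by
    rw [← h.live i j hi hj hr, Finset.mem_erase]
    exact and_iff_right fun he => hp i j hi hj he.symm hr

/-- Treating the first pair of `B`, if it is a roof. -/
theorem append (h : BuchbergerInv S E L l B) {i j : ℕ} (hi : i < l.length) (hj : j < l.length)
    (hr : l[i].IsRoof l[j]) {d : Edge α} {L' : Finset (Edge α)} (hd : d ∉ E)
    (hdt : ∀ f ∈ E, f.tgt ≠ d.tgt)
    (hL' : ∀ f ∈ E, ∀ g ∈ E, f ≠ g → f.tgt = g.tgt → (f ∈ L' ↔ f ∈ L ∧ f.tgt ≠ l[i].tgt))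
    (hcommon : ∀ f ∈ E, f.tgt = l[i].tgt → f = l[i] ∨ f = l[j]) :
    BuchbergerInv S (insert d E) L' (l ++ [d])
      ((B ∪ (Finset.range l.length).image fun a => toLex (a, l.length)).erase (toLex (i, j))) where
  nodup := by
    rw [List.nodup_append]
    refine ⟨h.nodup, by simp, fun a ha b hb => ?_⟩
    rintro rfl
    rw [List.mem_singleton] at hb
    exact hd (hb ▸ (h.mem a).1 ha)
  mem := fun e => by
    rw [List.mem_append, List.mem_singleton, Finset.mem_insert, h.mem, or_comm]
  init := h.init.trans (List.prefix_append _ _)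
  lt := by
    intro a b hab
    rw [Finset.mem_erase, Finset.mem_union, Finset.mem_image] at hab
    rw [List.length_append, List.length_singleton]
    rcases hab.2 with hab | ⟨c, hc, hab⟩
    · have := h.lt a b hab
      omega
    · rw [toLex_inj, Prod.mk.injEq] at hab
      rw [Finset.mem_range] at hc
      omega
  tgt := by
    intro e he e' he' hne ht
    rcases Finset.mem_insert.1 he with h1 | h1 <;> rcases Finset.mem_insert.1 he' with h2 | h2
    · exact absurd (h1.trans h2.symm) hne
    · exact absurd (ht.symm.trans (congrArg Edge.tgt h1)) (hdt _ h2)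
    · exact absurd (ht.trans (congrArg Edge.tgt h2)) (hdt _ h1)
    · exact h.tgt e h1 e' h2 hne ht
  live := by
    intro a b ha hb hr'
    have hmemE : ∀ c (hc : c < (l ++ [d]).length) (hc' : c < l.length), (l ++ [d])[c] = l[c] :=
      fun c hc hc' => List.getElem_append_left hc'
    have hlast : ∀ c (hc : c < (l ++ [d]).length), ¬ c < l.length → (l ++ [d])[c] = d := by
      intro c hc hc'
      rw [List.getElem_append_right (not_lt.1 hc')]
      simp
    have hlE : ∀ c (hc : c < l.length), l[c] ∈ E := fun c hc => (h.mem _).1 (List.getElem_mem hc)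
    by_cases ha' : a < l.length <;> by_cases hb' : b < l.length
    · rw [hmemE a ha ha', hmemE b hb hb'] at hr' ⊢
      have hne : l[a] ≠ l[b] := fun he => (he ▸ hr'.2).false
      rw [hL' _ (hlE a ha') _ (hlE b hb') hne hr'.1, hL' _ (hlE b hb') _ (hlE a ha') hne.symm
        hr'.1.symm, Finset.mem_erase, Finset.mem_union, or_iff_left, h.live a b ha' hb' hr']
      · constructor
        · rintro ⟨h1, h2, h3⟩
          -- The only roof with this peak is `(i, j)` itself, whose pair is being erased.
          have h4 : l[a].tgt ≠ l[i].tgt := by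
            intro h4
            have ha := hcommon _ (hlE a ha') h4
            have hb := hcommon _ (hlE b hb') (hr'.1 ▸ h4)
            simp only [h.nodup.getElem_inj_iff] at ha hb
            have hij := ((h.isRoof_iff hi hj).1 hr).1
            have hab := ((h.isRoof_iff ha' hb').1 hr').1
            refine h1 ?_
            rw [toLex_inj, Prod.mk.injEq]
            omega
          exact ⟨⟨h2, h4⟩, h3, hr'.1 ▸ h4⟩
        · rintro ⟨⟨h2, h4⟩, h3, -⟩
          refine ⟨fun h1 => h4 ?_, h2, h3⟩
          rw [toLex_inj, Prod.mk.injEq] at h1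
          simp only [h1.1]
      · rw [Finset.mem_image]
        rintro ⟨c, -, hc⟩
        rw [toLex_inj, Prod.mk.injEq] at hc
        omega
    -- The remaining cases involve the new edge, whose target no edge of `E` has; so there is no
    -- roof.
    · rw [hmemE a ha ha', hlast b hb hb'] at hr'
      exact absurd hr'.1 (hdt _ (hlE a ha'))
    · rw [hlast a ha ha', hmemE b hb hb'] at hr'
      exact absurd hr'.1.symm (hdt _ (hlE b hb'))
    · rw [hlast a ha ha', hlast b hb hb'] at hr'
      exact absurd hr'.2 (lt_irrefl _)

end BuchbergerInv

namespace BuchbergerState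

variable {α : Type*} {k : Type*} [Field k] {l : List (Edge α)} {B : Finset (ℕ ×ₗ ℕ)} {i j : ℕ}

theorem poly_map_poly (hi : i < l.length) :
    (⟨l.map (Edge.poly k), B⟩ : BuchbergerState α k).poly i = l[i].poly k := by
  rw [poly, List.getD_eq_getElem _ _ (by simpa using hi), List.getElem_map]

variable [LinearOrder α] [Finite α]

/-- A pair of edges with different targets is dropped. -/
theorem step_of_tgt_ne (hlt : ∀ e ∈ l, e.src < e.tgt) (hi : i < l.length) (hj : j < l.length)
    (hB : B.Nonempty) (hmin : B.min' hB = toLex (i, j)) (ht : l[i].tgt ≠ l[j].tgt) :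
    step (lexOrder α) ⟨l.map (Edge.poly k), B⟩ =
      some ⟨l.map (Edge.poly k), B.erase (toLex (i, j))⟩ := by
  classical
  rw [step, dif_pos hB]
  simp only [hmin, ofLex_toLex]
  rw [if_neg]
  rintro ⟨h, -⟩
  rw [poly_map_poly hi, poly_map_poly hj, Edge.degree_poly (hlt _ (List.getElem_mem hi)),
    Edge.degree_poly (hlt _ (List.getElem_mem hj))] at h
  -- For distinct variables the least common multiple is the product: at each variable one of the
  -- two exponents vanishes, so their maximum is their sum.
  refine h (Finsupp.ext fun x => ?_)
  rw [Finsupp.sup_apply, Finsupp.add_apply, Finsupp.single_apply, Finsupp.single_apply]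
  split_ifs with h1 h2 h2
  · exact absurd (h1.trans h2.symm) ht
  all_goals rfl

/-- For a pair of edges with the same target, the reduced `S`-polynomial is added. -/
theorem step_of_tgt_eq (hlt : ∀ e ∈ l, e.src < e.tgt) (hi : i < l.length) (hj : j < l.length)
    (hB : B.Nonempty) (hmin : B.min' hB = toLex (i, j)) (ht : l[i].tgt = l[j].tgt)
    (hcommon : ∀ f ∈ l, f.tgt = l[i].tgt → f = l[i] ∨ f = l[j]) (hl : l.Nodup) {d : Edge α}
    (hd : d.src < d.tgt) {c : k} (hc : c ≠ 0)
    (hdiv : divES (lexOrder α) (l.map (Edge.poly k)) ((Edge.mk l[i].src l[j].src).poly k) =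
      c • d.poly k) :
    step (lexOrder α) ⟨l.map (Edge.poly k), B⟩ =
      some ⟨(l ++ [d]).map (Edge.poly k),
        (B ∪ (Finset.range l.length).image fun a => toLex (a, l.length)).erase
          (toLex (i, j))⟩ := by
  classical
  have hi' := hlt _ (List.getElem_mem hi)
  have hj' := hlt _ (List.getElem_mem hj)
  rw [step, dif_pos hB]
  simp only [hmin, ofLex_toLex]
  rw [if_pos]
  · rw [poly_map_poly hi, poly_map_poly hj, Edge.sPoly_poly hi' hj' ht, hdiv,
      Edge.leadingCoeff_smul_poly hd hc, inv_smul_smul₀ hc, List.map_append, List.length_map]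
    rfl
  · rw [poly_map_poly hi, poly_map_poly hj, Edge.sPoly_poly hi' hj' ht, hdiv]
    refine ⟨?_, ?_, smul_ne_zero hc (Edge.poly_ne_zero hd)⟩
    · rw [Edge.degree_poly hi', Edge.degree_poly hj', ht, sup_idem]
      intro h
      have := DFunLike.congr_fun h l[j].tgt
      simp at this
    -- The criterion never discards a live roof, since it would require a third edge with the same
    -- target.
    · rintro ⟨a, ha, hai, haj, -, -, hdeg⟩
      have ha' : a < l.length := by simpa using ha
      rw [poly_map_poly hi, poly_map_poly hj, poly_map_poly ha',
        Edge.degree_poly (hlt _ (List.getElem_mem ha')), Edge.degree_poly hi',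
        Edge.degree_poly hj', ← ht, sup_idem, Finsupp.single_one_le_single_one_iff] at hdeg
      rcases hcommon _ (List.getElem_mem ha') hdeg with h | h
      · exact hai (hl.getElem_inj_iff.1 h)
      · exact haj (hl.getElem_inj_iff.1 h)

end BuchbergerState

/-- The Falling Roofs algorithm and Buchberger's algorithm with early stopping run in parallel. -/
theorem RoofInv.exists_reaches {α : Type*} [LinearOrder α] [Finite α] (k : Type*) [Field k]
    {T : α → α → Prop} [IsStrictOrder α T] {P Q : α → Prop} {S : Finset (Edge α)} (n : ℕ ×ₗ ℕ)
    {R : α → α → Prop} {E L : Finset (Edge α)} {l : List (Edge α)} {B : Finset (ℕ ×ₗ ℕ)}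
    (hn : toLex (L.card, B.card) = n) (h : RoofInv T P Q S R E L)
    (hB : BuchbergerInv S E L l B) :
    ∃ (E' L' : Finset (Edge α)) (R' : α → α → Prop) (l' : List (Edge α)), StateTransition.Reaches RoofState.step ⟨E, L, none⟩ ⟨E', L', none⟩ ∧
      RoofInv T P Q S R' E' L' ∧ (∀ e ∈ L', ∀ e' ∈ L', ¬ e.IsRoof e') ∧
      StateTransition.Reaches (BuchbergerState.step (lexOrder α)) ⟨l.map (Edge.poly k), B⟩
        ⟨l'.map (Edge.poly k), ∅⟩ ∧ ∀ e, e ∈ l' ↔ e ∈ E' := by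
  -- Treating a roof may enlarge `B` but lowers the number of live edges; any other pair is merely
  -- removed from `B`.
  induction n using WellFoundedLT.induction generalizing R E L l B with
  | _ n ih =>
  subst hn
  rcases B.eq_empty_or_nonempty with rfl | hne
  · refine ⟨E, L, R, l, Relation.ReflTransGen.refl, h, fun e he e' he' hr => ?_,
      Relation.ReflTransGen.refl, hB.mem⟩
    obtain ⟨i, hi, rfl⟩ := List.getElem_of_mem ((hB.mem e).2 (h.live_sub he))
    obtain ⟨j, hj, rfl⟩ := List.getElem_of_mem ((hB.mem e').2 (h.live_sub he'))
    exact Finset.notMem_empty _ ((hB.live i j hi hj hr).2 ⟨he, he'⟩)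
  obtain ⟨⟨i, j⟩, hmin⟩ : ∃ p, toLex p = B.min' hne := ⟨ofLex (B.min' hne), rfl⟩
  have hmem : toLex (i, j) ∈ B := hmin ▸ Finset.min'_mem B hne
  have hle : ∀ p ∈ B, toLex (i, j) ≤ p := fun p hp => hmin ▸ Finset.min'_le B p hp
  obtain ⟨hij, hj⟩ := hB.lt i j hmem
  have hi := hij.trans hj
  have hlt : ∀ e ∈ l, e.src < e.tgt := fun e he => h.lt e ((hB.mem e).1 he)
  by_cases ht : l[i].tgt = l[j].tgt
  · have hr := (hB.isRoof_iff hi hj).2 ⟨hij, ht⟩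
    obtain ⟨he, he'⟩ := (hB.live i j hi hj hr).1 hmem
    obtain ⟨hlive, hlmin⟩ := hB.min'_liveRoofs h.live_sub hi hj hr hmem hle
    have hnew := h.base_notMem he he' hr
    set d := Edge.mk l[i].src l[j].src
    have hstep : RoofState.step ⟨E, L, none⟩ =
        some ⟨insert d E, insert d ((L.erase l[i]).erase l[j]), some d⟩ := by
      have : RoofState.step ⟨E, L, none⟩ = _ := dif_pos hlive
      rw [this]
      simp only [hlmin, ofLex_toLex, RoofState.kill, RoofState.add]
      rw [if_neg hnew]
    have hG : ∀ f, f ∈ l.map (Edge.poly k) ↔ ∃ e ∈ E, e.poly k = f := by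
      intro f
      simp only [List.mem_map, hB.mem]
    have h₁ := h.contract he he' hr
    obtain ⟨d', L', R', c, hreach, hd', h', hno, hcard, hL', hdiv, hc⟩ :=
      RoofInv.exists_reaches_none (k := k) h.init_sub hG _ rfl hnew (Finset.mem_insert_self _ _) h₁
        one_ne_zero
    rw [one_smul] at hdiv
    have hcommon : ∀ f ∈ E, f.tgt = l[i].tgt → f = l[i] ∨ f = l[j] := fun f hf hft =>
      h.eq_or_eq_of_tgt_eq he he' hr hf hft
    -- The contraction kills the roof at this peak, and the inner loop leaves all other roofs of `E`
    -- as they are.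
    have hB' := hB.append (L' := L') hi hj hr hd' hno (fun f hf g hg hfg hft => by
      rw [hL' f hf g hg hfg hft, h.mem_contract_iff he he' hr hf]) hcommon
    have hcard' := hcard.trans_lt (h.card_contract he he' hr)
    obtain ⟨E'', L'', R'', l'', h1, h2, h3, h4, h5⟩ :=
      ih _ (Prod.Lex.toLex_lt_toLex.2 (Or.inl hcard')) rfl h' hB'
    have hreach' : StateTransition.Reaches RoofState.step ⟨E, L, none⟩ ⟨insert d' E, L', none⟩ :=
      Relation.ReflTransGen.head hstep hreach
    refine ⟨E'', L'', R'', l'', hreach'.trans h1, h2, h3,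
      Relation.ReflTransGen.head ?_ h4, h5⟩
    exact BuchbergerState.step_of_tgt_eq hlt hi hj hne hmin.symm ht
      (fun f hf => hcommon f ((hB.mem f).1 hf)) hB.nodup
      (h'.lt d' (Finset.mem_insert_self _ _)) hc hdiv
  · have hB' := hB.erase (p := toLex (i, j)) (by
      intro a b ha hb hab hr
      rw [toLex_inj, Prod.mk.injEq] at hab
      obtain ⟨rfl, rfl⟩ := hab
      exact ht hr.1)
    obtain ⟨E'', L'', R'', l'', h1, h2, h3, h4, h5⟩ :=
      ih (toLex (L.card, (B.erase (toLex (i, j))).card))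
        (Prod.Lex.toLex_lt_toLex.2 (Or.inr ⟨rfl, Finset.card_erase_lt_of_mem hmem⟩)) rfl h hB'
    exact ⟨E'', L'', R'', l'', h1, h2, h3, Relation.ReflTransGen.head
      (BuchbergerState.step_of_tgt_ne hlt hi hj hne hmin.symm ht) h4, h5⟩

/-! ### The algorithms on the graph of a proof net -/

namespace ProofStructure

variable {𝕏 : Type*} {π : ProofStructure 𝕏}

theorem mem_graph [LinearOrder π.Atom] {e : Edge π.Atom} :
    e ∈ π.graph ↔ π.Sim e.src e.tgt ∧ e.src < e.tgt := by
  simp [graph]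

/-- The order `T` is the transitive closure of the original `Succ`. It stays fixed while paths are
contracted, and so remembers which atoms lay on a common path. -/
theorem isPathSystem_succ {c : π.E} (hc : π.HasSingleConclusion c) :
    IsPathSystem (Relation.TransGen π.Succ) (fun x => x.edge = c ∧ x.sign = true)
      (fun x => x.edge = c ∧ x.sign = false) π.Succ where
  rel := Relation.TransGen.single
  right_unique := Succ.unique
  left_unique := Succ.unique'
  not_left := fun {x y} h => (exists_pred_iff hc y).1 ⟨x, h⟩
  not_right := fun {x y} h => (exists_succ_iff hc x).1 ⟨y, h⟩
  exists_succ := fun {_ y} _ h => (exists_succ_iff hc y).2 h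
  exists_pred := fun {x _} _ h => (exists_pred_iff hc x).2 h
  exists_succ_of_left := fun {x} h => (exists_succ_iff hc x).2 (by simp [h.2])

theorem roofInv_graph [LinearOrder π.Atom] {c : π.E} (hc : π.HasSingleConclusion c) :
    RoofInv (Relation.TransGen π.Succ) (fun x => x.edge = c ∧ x.sign = true)
      (fun x => x.edge = c ∧ x.sign = false) π.graph π.Succ π.graph π.graph where
  path := isPathSystem_succ hc
  mem_live := fun e => by rw [mem_graph, sim_iff_succ, and_comm]; rfl
  live_sub := Finset.Subset.refl _
  dead := fun _ h h' => absurd h h'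
  init_sub := Finset.Subset.refl _
  lt := fun _ he => (mem_graph.1 he).2

theorem buchbergerInv_sort {α : Type*} [LinearOrder α] (S : Finset (Edge α)) (k : Type*) [Field k] :
    BuchbergerInv S S S S.sort
      (BuchbergerState.init (S.sort.map (Edge.poly k))).B where
  nodup := Finset.sort_nodup _ _
  mem := fun _ => Finset.mem_sort _
  init := List.prefix_rfl
  lt := by
    intro i j hij
    rw [BuchbergerState.init, Finset.mem_map_equiv, Finset.mem_filter, Finset.mem_product,
      Finset.mem_range, Finset.mem_range, List.length_map] at hij
    exact ⟨hij.2, hij.1.2⟩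
  tgt := fun _ he _ he' _ _ => ⟨he, he'⟩
  live := by
    intro i j hi hj hr
    rw [BuchbergerState.init, Finset.mem_map_equiv, Finset.mem_filter, Finset.mem_product,
      Finset.mem_range, Finset.mem_range, List.length_map]
    refine iff_of_true ⟨⟨hi, hj⟩, ?_⟩ ⟨(Finset.mem_sort _).1 (List.getElem_mem hi),
      (Finset.mem_sort _).1 (List.getElem_mem hj)⟩
    exact (S.sortedLT_sort.strictMono_get).lt_iff_lt (a := ⟨i, hi⟩) (b := ⟨j, hj⟩) |>.1 hr.lt

end ProofStructure

theorem mainTheorem4 {𝕏 : Type*} (k : Type*) [Field k] (π : ProofStructure 𝕏)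
    (hπ : π.IsProofNet) (c : π.E) (hc : π.HasSingleConclusion c) :
    ∃ (m : ℕ) (U V : Fin m → π.Boundary c) (σ : Equiv.Perm (Fin m)),
      π.IsSubseqOfSign c U true ∧ π.IsSubseqOfSign c V false ∧
      Function.Bijective (π.toCoordRing k (fun i => (U i).1)) ∧
      Function.Bijective (π.toCoordRing k (fun i => (V i).1)) ∧
      (∀ i, π.toCoordRing k (fun i => (U i).1) (MvPolynomial.X i) =
        π.toCoordRing k (fun i => (V i).1) (MvPolynomial.X (σ i))) ∧
      ∀ [LinearOrder π.Atom], (∀ i j, (V i).1 < (U j).1) →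
        (∀ j w, w.edge ≠ c → (U j).1 < w) →
        ∃ N ∈ StateTransition.eval RoofState.step (RoofState.init π.graph),
          Edge.poly k '' N.live =
            Set.range (fun i => (MvPolynomial.X (U i).1 - MvPolynomial.X (V (σ i)).1 :
              MvPolynomial π.Atom k)) ∧
          IsGroebnerBasis (lexOrder (π.Boundary c))
            (Set.range fun i => MvPolynomial.X (U i) - MvPolynomial.X (V (σ i)))
            (π.boundaryIdeal k c) ∧
          ∃ s ∈ StateTransition.eval (BuchbergerState.step (lexOrder π.Atom))
              (BuchbergerState.init (π.graph.sort.map (Edge.poly k))),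
            {f | f ∈ s.G} = Edge.poly k '' N.edges := by
  obtain ⟨m, U, V, σ, hU, hV, hUV⟩ := hπ.exists_matching hc
  obtain ⟨p, hpU, hUp, hp⟩ := hπ.exists_component hc hU
  have hpsim : ∀ a b, π.Sim a b → p a = p b := by
    intro a b h
    rcases ProofStructure.sim_iff_succ.1 h with h | h
    · exact hp a b h
    · exact (hp b a h).symm
  have hUmk : ∀ a, Ideal.Quotient.mk (π.ideal k) (MvPolynomial.X (U (p a)).1) =
      Ideal.Quotient.mk (π.ideal k) (MvPolynomial.X a) := fun a =>
    ProofStructure.mk_X_eq_of_reflTransGen (hUp a)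
  have hσ : ∀ i, Ideal.Quotient.mk (π.ideal k) (MvPolynomial.X (U i).1) =
      Ideal.Quotient.mk (π.ideal k) (MvPolynomial.X (V (σ i)).1) := fun i =>
    ProofStructure.mk_X_eq_of_reflTransGen (hUV i)
  have hpV : ∀ i, p (V (σ i)).1 = i := fun i => hpU i _ (hUV i)
  have hbijU : Function.Bijective (π.toCoordRing k (fun i => (U i).1)) :=
    ProofStructure.bijective_toCoordRing (fun i => hpU i _ Relation.ReflTransGen.refl) hpsim hUmk
  have hbijV : Function.Bijective (π.toCoordRing k (fun i => (V i).1)) :=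
    ProofStructure.bijective_toCoordRing (p := fun a => σ (p a))
      (fun i => by
        obtain ⟨j, rfl⟩ := σ.surjective i
        rw [hpV])
      (fun a b h => by rw [hpsim a b h]) (fun a => (hσ _).symm.trans (hUmk a))
  refine ⟨m, U, V, σ, hU, hV, hbijU, hbijV, fun i => ?_, ?_⟩
  · rw [ProofStructure.toCoordRing_X, ProofStructure.toCoordRing_X, hσ]
  intro _ hVU hW
  have : IsStrictOrder π.Atom (Relation.TransGen π.Succ) :=
    { irrefl := hπ.succ_acyclic hc
      trans := fun _ _ _ => Relation.TransGen.trans }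
  have hrangeU : ∀ x : π.Atom, x.edge = c ∧ x.sign = true → ∃ i, (U i).1 = x := by
    rintro x ⟨hx, hs⟩
    obtain ⟨i, hi⟩ := (hU.2 ⟨x, hx⟩).2 hs
    exact ⟨i, congrArg Subtype.val hi⟩
  have hrangeV : ∀ x : π.Atom, x.edge = c ∧ x.sign = false → ∃ i, (V i).1 = x := by
    rintro x ⟨hx, hs⟩
    obtain ⟨i, hi⟩ := (hV.2 ⟨x, hx⟩).2 hs
    exact ⟨i, congrArg Subtype.val hi⟩
  have hUend : ∀ i, (U i).1.edge = c ∧ (U i).1.sign = true := fun i =>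
    ⟨(U i).2, (hU.2 _).1 ⟨i, rfl⟩⟩
  have hVend : ∀ i, (V i).1.edge = c ∧ (V i).1.sign = false := fun i =>
    ⟨(V i).2, (hV.2 _).1 ⟨i, rfl⟩⟩
  obtain ⟨E, L, R, l, h1, h2, h3, h4, h5⟩ := RoofInv.exists_reaches k _ rfl
    (ProofStructure.roofInv_graph hc) (ProofStructure.buchbergerInv_sort π.graph k)
  have hlive := h2.mem_live_iff_of_no_roof h3
    (by
      rintro x y hx hy
      obtain ⟨i, rfl⟩ := hrangeV x hx
      obtain ⟨j, rfl⟩ := hrangeU y hy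
      exact hVU i j)
    (by
      rintro x y hx hy hy'
      have hyc : y.edge ≠ c := by
        intro hyc
        cases hs : y.sign
        · exact hy' ⟨hyc, hs⟩
        · exact hy ⟨hyc, hs⟩
      rcases hx with hx | hx
      · obtain ⟨i, rfl⟩ := hrangeU x hx
        exact hW i y hyc
      · obtain ⟨i, rfl⟩ := hrangeV x hx
        obtain ⟨j, rfl⟩ := σ.surjective i
        exact (hVU _ j).trans (hW j y hyc))
  have hcomp : ∀ x y, Relation.TransGen π.Succ x y → p x = p y := by
    intro x y h
    induction h with
    | single h => exact hp _ _ h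
    | tail _ h ih => exact ih.trans (hp _ _ h)
  -- A step of the contracted system stays within one path of `∼`, and this identifies its terminal
  -- point.
  have hRUV : ∀ i j, R (U i).1 (V j).1 → j = σ i := by
    intro i j h
    obtain ⟨j, rfl⟩ := σ.surjective j
    have := hcomp _ _ (h2.path.rel h)
    rw [hpU i _ Relation.ReflTransGen.refl, hpV] at this
    rw [this]
  have hliveUV : ∀ e, e ∈ L ↔ ∃ i, e = Edge.mk (V (σ i)).1 (U i).1 := by
    intro e
    rw [hlive]
    constructor
    · rintro ⟨hs, ht, hr⟩
      obtain ⟨i, hi⟩ := hrangeU _ ht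
      obtain ⟨j, hj⟩ := hrangeV _ hs
      rw [← hi, ← hj] at hr
      obtain rfl := hRUV i j hr
      exact ⟨i, Edge.ext_iff'.2 ⟨hj.symm, hi.symm⟩⟩
    · rintro ⟨i, rfl⟩
      refine ⟨hVend _, hUend _, ?_⟩
      -- The point `U i` never becomes isolated, so a live edge meets it; that edge does not start
      -- there, because sources of live edges are now negative atoms.
      obtain ⟨y, hy⟩ := h2.path.exists_succ_of_left (hUend i)
      have hadj : Edge.mk y (U i).1 ∈ L ∨ Edge.mk (U i).1 y ∈ L := by
        rcases lt_or_gt_of_ne (h2.path.ne hy) with hlt | hlt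
        · exact Or.inr ((h2.mem_live _).2 ⟨hlt, Or.inl hy⟩)
        · exact Or.inl ((h2.mem_live _).2 ⟨hlt, Or.inr hy⟩)
      rcases hadj with hadj | hadj
      · obtain ⟨j, rfl⟩ := hrangeV y ((hlive _).1 hadj).1
        obtain rfl := hRUV i j hy
        exact hy
      · have := ((hlive _).1 hadj).1.2
        rw [Edge.src_mk, (hUend i).2] at this
        exact absurd this (by decide)
  refine ⟨⟨E, L, none⟩, StateTransition.mem_eval.2 ⟨h1, ?_⟩, ?_, ?_,
    ⟨l.map (Edge.poly k), ∅⟩, StateTransition.mem_eval.2 ⟨h4, ?_⟩, ?_⟩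
  · refine dif_neg fun hne => ?_
    obtain ⟨q, hq⟩ := hne
    obtain ⟨⟨e, e'⟩, rfl⟩ : ∃ q', toLex q' = q := ⟨ofLex q, rfl⟩
    obtain ⟨he, he', hr⟩ := RoofState.mem_liveRoofs.1 hq
    exact h3 e he e' he' hr
  · ext f
    simp only [Set.mem_image, Finset.mem_coe, Set.mem_range, hliveUV]
    constructor
    · rintro ⟨_, ⟨i, rfl⟩, rfl⟩
      exact ⟨i, rfl⟩
    · rintro ⟨i, rfl⟩
      exact ⟨_, ⟨i, rfl⟩, rfl⟩
  · refine ProofStructure.isGroebnerBasis_boundary (fun x => ?_) hV.injective hVU hbijV.1 hσ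
    cases hs : x.1.sign
    · exact Or.inr ((hV.2 x).2 hs)
    · exact Or.inl ((hU.2 x).2 hs)
  · exact dif_neg (by simp)
  · ext f
    simp [h5]
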